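/- Let $1\le K$, $n$, $p$ be integers, $A\in\mathbb R^{p\times K}$, $\beta\in\mathbb R^K$, and consider the factor regression model $$X=AZ+E,\qquad y=Z^\top\beta+\varepsilon,$$ where $Z\in\mathbb R^K$, $E\in\mathbb R^p$, $\varepsilon\in\mathbb R$ are mean-zero and mutually independent, with $\Sigma_Z=\mathrm{Cov}(Z)$, $\Sigma_E=\mathrm{Cov}(E)$, $\sigma_\varepsilon^2=\mathrm{Var}(\varepsilon)$. Assume that $A$ and $\Sigma_Z$ have rank $K$, and that for a constant $M>0$: $E=\Sigma_E^{1/2}\tilde E$ where $\tilde E$ has independent entries with mean zero, unit variance and sub-Gaussian norm at most $M$; $Z=\Sigma_Z^{1/2}\tilde Z$ and $\varepsilon=\sigma_\varepsilon\tilde\varepsilon$ where $\tilde Z$ and $\tilde\varepsilon$ have mean zero and sub-Gaussian norm at most $M$. Here $\|U\|_{\psi_2}=\inf\{t>0:\mathbb E\exp(U^2/t^2)\le 2\}$ for a real random variable and $\|V\|_{\psi_2}=\sup_{\|u\|=1}\|V^\top u\|_{\psi_2}$ for a random vector. The data are $(X_i,y_i)=(AZ_i+E_i,\;Z_i^\top\beta+\varepsilon_i)$,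 $i=1,\dots,n$, where $(Z_i,E_i,\varepsilon_i)$ are i.i.d. copies of $(Z,E,\varepsilon)$; $\mathbf X\in\mathbb R^{n\times p}$ has rows $X_i^\top$ and $\mathbf y=(y_1,\dots,y_n)^\top$. Let $\widehat\alpha$ be the vector of least Euclidean norm among the minimizers of $u\mapsto\|\mathbf X u-\mathbf y\|$ (so $\widehat\alpha=\mathbf X^+\mathbf y$), let $R(\alpha)=\mathbb E_{X,y}[(X^\top\alpha-y)^2]$ be the risk at a new independent data point, and write $\lambda_k(Q)$ for the $k$-th largest eigenvalue of a symmetric matrix $Q$, $\|Q\|$ for its operator norm, $\|v\|_Q^2=v^\top Qv$, and $\mathrm{r_e}(Q)=\mathrm{tr}(Q)/\|Q\|$ for $Q\ne0$, $\mathrm{r_e}(0)=1$. For every $M>0$ there are constants $C,c>0$ depending only on $M$ such that the following holds. Suppose that $n>CK$, $\mathrm{r_e}(\Sigma_E)>Cn$, and, for positive constants $z_1,z_2,e_1,e_2,r_1,r_2,b$, $$z_1\le\lambda_K(\Sigma_Z)\le z_2,\quad e_1\le\|\Sigma_E\|\le e_2,\quad r_1p\le\mathrm{r_e}(\Sigma_E)\le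 r_2p,\quad \|\beta\|^2_{\Sigma_Z}\le bK .$$ Then $R$ has a minimizer over $\mathbb R^p$, and for every minimizer $\alpha^*$ of $R$: 1. with probability at least $1-c/n$ (over the data), $$R(\widehat\alpha)-R(\alpha^*)\le R(\widehat\alpha)-\sigma_\varepsilon^2\le D\left\{\frac{K}{\lambda_K(A^\top A)}\cdot\frac pn+\sigma_\varepsilon^2\Big(\frac np+\frac Kn\Big)\log n\right\},$$ where $D>0$ depends only on $M,z_1,z_2,e_1,e_2,r_1,r_2,b$; 2. if moreover $\lambda_K(A^\top A)\ge a\,p/K$ for a constant $a>0$, then with probability at least $1-c/n$, $$R(\widehat\alpha)-R(\alpha^*)\le R(\widehat\alpha)-\sigma_\varepsilon^2\le D'\left\{\frac{K^2}{n}+\sigma_\varepsilon^2\Big(\frac np+\frac Kn\Big)\log n\right\},$$ where $D'>0$ depends only on $M,z_1,z_2,e_1,e_2,r_1,r_2,b,a$. -/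

import Mathlib

open MeasureTheory ProbabilityTheory

noncomputable section

namespace FactorRegression

/-! ### Matrices -/

/-- The `k`-th largest eigenvalue `lam_k(Q)`, `1 ≤ k ≤ d`, of a symmetric `d × d` matrix, so that
`lam_1(Q) ≥ lam_2(Q) ≥ ... ≥ lam_d(Q)`. (It is `0` where the notion makes no sense.) -/
def kthEigenvalue {d : ℕ} (k : ℕ) (Q : Matrix (Fin d) (Fin d) ℝ) : ℝ :=
  open scoped Classical in
  if h : Q.IsHermitian ∧ 1 ≤ k ∧ k ≤ d then
    h.1.eigenvalues₀ ⟨k - 1, by rw [Fintype.card_fin]; omega⟩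
  else 0

/-- The operator norm of a square matrix with respect to the Euclidean norm. -/
def opNorm {d : ℕ} (Q : Matrix (Fin d) (Fin d) ℝ) : ℝ :=
  ‖Matrix.toEuclideanCLM (n := Fin d) (𝕜 := ℝ) Q‖

/-- The effective rank `tr(Q) / ‖Q‖`, with the convention that it is `1` for `Q = 0`. -/
def effRank {d : ℕ} (Q : Matrix (Fin d) (Fin d) ℝ) : ℝ :=
  open scoped Classical in
  if Q = 0 then 1 else Q.trace / opNorm Q

/-- The positive semi-definite square root of a positive semi-definite matrix. -/
def psdSqrt {d : ℕ} (Q : Matrix (Fin d) (Fin d) ℝ) : Matrix (Fin d) (Fin d) ℝ :=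
  open scoped MatrixOrder in
  CFC.sqrt Q

/-- The squared seminorm `‖v‖²_Q = vᵀ Q v`. -/
def quadForm {d : ℕ} (Q : Matrix (Fin d) (Fin d) ℝ) (v : EuclideanSpace ℝ (Fin d)) : ℝ :=
  inner ℝ v (Matrix.toEuclideanLin Q v)

/-! ### The minimum-norm least-squares estimator -/

/-- `α` minimizes `‖𝐗 u - 𝐲‖` over all `u`, and has the least norm among all such minimizers. -/
def IsMinNormLeastSquares {n p : ℕ} (X : Matrix (Fin n) (Fin p) ℝ)
    (y : EuclideanSpace ℝ (Fin n)) (α : EuclideanSpace ℝ (Fin p)) : Prop :=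
  (∀ u, ‖Matrix.toEuclideanLin X α - y‖ ≤ ‖Matrix.toEuclideanLin X u - y‖) ∧
  ∀ α', (∀ u, ‖Matrix.toEuclideanLin X α' - y‖ ≤ ‖Matrix.toEuclideanLin X u - y‖) → ‖α‖ ≤ ‖α'‖

theorem exists_isMinNormLeastSquares {n p : ℕ} (X : Matrix (Fin n) (Fin p) ℝ)
    (y : EuclideanSpace ℝ (Fin n)) : ∃ α, IsMinNormLeastSquares X y α := by
  let T := Matrix.toEuclideanLin X
  let S : Set (EuclideanSpace ℝ (Fin p)) := {α | ∀ u, ‖T α - y‖ ≤ ‖T u - y‖}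
  have hTc : Continuous T := T.continuous_of_finiteDimensional
  have hne : S.Nonempty := by
    obtain ⟨w, hw⟩ : ∃ w ∈ T.range, ‖y - w‖ = ⨅ v : T.range, ‖y - v‖ :=
      Submodule.exists_norm_eq_iInf_of_complete_subspace T.range
        (Submodule.complete_of_finiteDimensional T.range) y
    obtain ⟨⟨α, rfl⟩, h2⟩ := hw
    refine ⟨α, fun u => ?_⟩
    rw [norm_sub_rev, h2, norm_sub_rev (T u)]
    exact ciInf_le ⟨0, by rintro _ ⟨v, rfl⟩; exact norm_nonneg _⟩
      (⟨T u, LinearMap.mem_range_self T u⟩ : T.range)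
  have hcl : IsClosed S := by
    have : S = ⋂ u, {α | ‖T α - y‖ ≤ ‖T u - y‖} := by
      ext α
      simp [S]
    rw [this]
    exact isClosed_iInter fun u =>
      isClosed_le ((hTc.sub continuous_const).norm) continuous_const
  obtain ⟨α, hα, h0⟩ := hcl.exists_infDist_eq_dist hne 0
  refine ⟨α, hα, fun α' h' => ?_⟩
  have h1 := Metric.infDist_le_dist_of_mem (x := (0 : EuclideanSpace ℝ (Fin p))) (s := S) h'
  rw [h0] at h1
  simpa using h1

/-- The minimum-norm estimator (generalized least squares, `𝐗⁺ 𝐲`). -/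
def minNormEstimator {n p : ℕ} (X : Matrix (Fin n) (Fin p) ℝ)
    (y : EuclideanSpace ℝ (Fin n)) : EuclideanSpace ℝ (Fin p) :=
  (exists_isMinNormLeastSquares X y).choose

/-! ### Random vectors -/

section Random

variable {Ω : Type*} [MeasurableSpace Ω]

/-- The covariance matrix of a random vector. -/
def covMatrix {d : ℕ} (V : Ω → EuclideanSpace ℝ (Fin d)) (P : Measure Ω) :
    Matrix (Fin d) (Fin d) ℝ :=
  Matrix.of fun i j => cov[fun ω => V ω i, fun ω => V ω j; P]

/-- The sub-Gaussian norm `‖U‖_{ψ₂} = inf {t > 0 : 𝔼 exp(U² / t²) ≤ 2}`, in `[0, ∞]`. -/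
def psi2Norm (U : Ω → ℝ) (P : Measure Ω) : ENNReal :=
  ⨅ (t : ℝ) (_ : 0 < t ∧ ∫⁻ ω, ENNReal.ofReal (Real.exp (U ω ^ 2 / t ^ 2)) ∂P ≤ 2),
    ENNReal.ofReal t

/-- The sub-Gaussian norm of a random vector, `sup {‖⟨V, u⟩‖_{ψ₂} : ‖u‖ = 1}`. -/
def psi2NormVec {d : ℕ} (V : Ω → EuclideanSpace ℝ (Fin d)) (P : Measure Ω) : ENNReal :=
  ⨆ (u : EuclideanSpace ℝ (Fin d)) (_ : ‖u‖ = 1), psi2Norm (fun ω => inner ℝ (V ω) u) P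

/-! ### The factor regression model -/

/-- The feature vector `X = A Z + E`. -/
def feature {p K : ℕ} (A : Matrix (Fin p) (Fin K) ℝ) (Z : Ω → EuclideanSpace ℝ (Fin K))
    (E : Ω → EuclideanSpace ℝ (Fin p)) : Ω → EuclideanSpace ℝ (Fin p) :=
  fun ω => Matrix.toEuclideanLin A (Z ω) + E ω

/-- The response `y = Zᵀ β + ε`. -/
def response {K : ℕ} (β : EuclideanSpace ℝ (Fin K)) (Z : Ω → EuclideanSpace ℝ (Fin K))
    (ε : Ω → ℝ) : Ω → ℝ :=
  fun ω => inner ℝ (Z ω) β + ε ω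

/-- The prediction risk `R(α) = 𝔼[(Xᵀ α - y)²]` under the law of `(X, y)`. -/
def risk {p : ℕ} (P : Measure Ω) (X : Ω → EuclideanSpace ℝ (Fin p)) (y : Ω → ℝ)
    (α : EuclideanSpace ℝ (Fin p)) : ℝ :=
  ∫ ω, (inner ℝ (X ω) α - y ω) ^ 2 ∂P

/-- The latent factor `Z` and the noise terms `E`, `ε` are mean-zero random elements, mutually
independent. -/
structure IsFactorModel {p K : ℕ} (P : Measure Ω) (Z : Ω → EuclideanSpace ℝ (Fin K))
    (E : Ω → EuclideanSpace ℝ (Fin p)) (ε : Ω → ℝ) : Prop where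
  measurable_Z : Measurable Z
  measurable_E : Measurable E
  measurable_ε : Measurable ε
  mean_Z : ∀ k, ∫ ω, Z ω k ∂P = 0
  mean_E : ∀ j, ∫ ω, E ω j ∂P = 0
  mean_ε : ∫ ω, ε ω ∂P = 0
  indep_Z : IndepFun Z (fun ω => (E ω, ε ω)) P
  indep_E_ε : IndepFun E ε P

/-- The sub-Gaussian assumption with constant `M`: `E = Σ_E^{1/2} Ẽ` where `Ẽ` has independent
entries with zero mean, unit variance and sub-Gaussian norm at most `M`; `Z = Σ_Z^{1/2} Z̃` and
`ε = σ_ε ε̃` where `Z̃`, `ε̃` have zero mean and sub-Gaussian norm at most `M`. -/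
structure IsSubGaussianModel {p K : ℕ} (M : ℝ) (P : Measure Ω)
    (Z : Ω → EuclideanSpace ℝ (Fin K)) (E : Ω → EuclideanSpace ℝ (Fin p)) (ε : Ω → ℝ) :
    Prop where
  noise_E : ∃ E' : Ω → EuclideanSpace ℝ (Fin p), Measurable E' ∧
    (∀ᵐ ω ∂P, E ω = Matrix.toEuclideanLin (psdSqrt (covMatrix E P)) (E' ω)) ∧
    iIndepFun (fun (j : Fin p) ω => E' ω j) P ∧
    ∀ j, ∫ ω, E' ω j ∂P = 0 ∧ Var[fun ω => E' ω j; P] = 1 ∧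
      psi2Norm (fun ω => E' ω j) P ≤ ENNReal.ofReal M
  factor_Z : ∃ Z' : Ω → EuclideanSpace ℝ (Fin K), Measurable Z' ∧
    (∀ᵐ ω ∂P, Z ω = Matrix.toEuclideanLin (psdSqrt (covMatrix Z P)) (Z' ω)) ∧
    (∀ k, ∫ ω, Z' ω k ∂P = 0) ∧ psi2NormVec Z' P ≤ ENNReal.ofReal M
  noise_ε : ∃ ε' : Ω → ℝ, Measurable ε' ∧
    (∀ᵐ ω ∂P, ε ω = √(Var[ε; P]) * ε' ω) ∧
    ∫ ω, ε' ω ∂P = 0 ∧ psi2Norm ε' P ≤ ENNReal.ofReal M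

/-- `(Zs i, Es i, εs i)`, `i = 1, ..., n`, are i.i.d. copies of `(Z, E, ε)`. -/
structure IsIIDSample {Ω' : Type*} [MeasurableSpace Ω'] {n p K : ℕ} (P : Measure Ω)
    (Z : Ω → EuclideanSpace ℝ (Fin K)) (E : Ω → EuclideanSpace ℝ (Fin p)) (ε : Ω → ℝ)
    (P' : Measure Ω') (Zs : Fin n → Ω' → EuclideanSpace ℝ (Fin K))
    (Es : Fin n → Ω' → EuclideanSpace ℝ (Fin p)) (εs : Fin n → Ω' → ℝ) : Prop where
  indep : iIndepFun (fun i ω => (Zs i ω, Es i ω, εs i ω)) P'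
  identDistrib : ∀ i, IdentDistrib (fun ω => (Zs i ω, Es i ω, εs i ω))
    (fun ω => (Z ω, E ω, ε ω)) P' P

/-- The `n × p` data matrix whose rows are the observed features. -/
def dataMatrix {n p : ℕ} (Xs : Fin n → Ω → EuclideanSpace ℝ (Fin p)) (ω : Ω) :
    Matrix (Fin n) (Fin p) ℝ :=
  Matrix.of fun i j => Xs i ω j

/-- The minimum-norm estimator computed from `n` observations of the factor regression model. -/
def glsEstimator {n p K : ℕ} (A : Matrix (Fin p) (Fin K) ℝ) (β : EuclideanSpace ℝ (Fin K))
    (Zs : Fin n → Ω → EuclideanSpace ℝ (Fin K)) (Es : Fin n → Ω → EuclideanSpace ℝ (Fin p))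
    (εs : Fin n → Ω → ℝ) (ω : Ω) : EuclideanSpace ℝ (Fin p) :=
  minNormEstimator (dataMatrix (fun i => feature A (Zs i) (Es i)) ω)
    (WithLp.toLp 2 fun i => response β (Zs i) (εs i) ω)

end Random

end FactorRegression

end

/-! Write `s = 8M²`, `τ = tr Σ_E`, `O = ‖Σ_E‖`, so that `τ/O` is the effective rank. Independence
and zero means split the risk (`risk_eq`): `R(α) - σ² = ‖Σ_Z^{1/2}(Aᵀα - β)‖² + ‖Σ_E^{1/2}α‖²`.
Hence `R ≥ σ²` everywhere, which gives the comparison with `R(α*)`, and it remains to bound the two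
squares at the estimator.

The reason why interpolation is harmless: when `τ/O > Cn`, the `n` noise rows are nearly orthogonal
with squared lengths of order `τ`, and they act like a ridge penalty. On a good sample the noise
matrix `Em` satisfies `‖Em‖² ≲ τ`, its transpose remains bounded below by a multiple of `√τ` even
after projection off the range of `A`, and the factor matrix satisfies `‖Zm x‖² ≥
(n/16)‖Σ_Z^{1/2}x‖²`. The projection kills the signal part `A Zmᵀ` of `Xᵀ`, so `Xᵀ` is bounded below
too and the estimator is the interpolant `X⁺y`.

The rest is deterministic (`error_le_of_good_sample`). Put `α₀ = A(AᵀA)⁻¹β`, so that `Aᵀα₀ = β`. The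
signal part `αs = X⁺Zmβ` has norm `≲ ‖α₀‖`, and interpolation forces `Zm(Aᵀαs - β) = -Em αs`; the
factor error is therefore `≲ (τ/n)‖α₀‖²`, where `‖α₀‖² ≤ bK/(z₁ λ_K(AᵀA))`. For the response noise,
`Σ_Z^{1/2}AᵀX⁺` has `K` rows of squared norm `≲ 1/n`, and `‖X⁺ε‖² ≲ ‖ε‖²/τ`; coordinatewise
sub-Gaussian tails turn these into `σ² log n · K/n` and `σ² log n · n/p`.

The probabilistic content is a net argument over spheres of dimension `K` and `n`, with exponential
bounds at each net point. The upper tail of a norm follows by Gaussian linearization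
(`lintegral_exp_norm_sq_le`). The lower tail (`lintegral_exp_neg_norm_sq_le`) separates diagonal
from off-diagonal terms and replaces the variables by Gaussians one coordinate at a time. The
conditions `n > CK` and `τ/O > Cn` pay for the cardinality of the nets. -/

noncomputable section

namespace FactorRegression

/-! ### Nets of the unit sphere -/

section Net

variable {E : Type*} [NormedAddCommGroup E] [NormedSpace ℝ E] [FiniteDimensional ℝ E]

/-- Volume comparison: the balls of radius `γ/2` about the points are disjoint and lie in the ball
of radius `1 + γ/2`. -/
theorem card_le_of_separated_sphere {γ : ℝ} (hγ : 0 < γ) (s : Finset E)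
    (hs : ∀ c ∈ s, ‖c‖ = 1) (h : ∀ c ∈ s, ∀ d ∈ s, c ≠ d → γ ≤ ‖c - d‖) :
    (s.card : ℝ) ≤ (1 + 2 / γ) ^ Module.finrank ℝ E := by
  borelize E
  let μ : Measure E := Measure.addHaar
  have hρ : 0 < 1 + γ / 2 := by positivity
  have hγ2 : 0 < γ / 2 := by positivity
  have hdisj : Set.Pairwise (s : Set E)
      (Function.onFun Disjoint fun c => Metric.ball (c : E) (γ / 2)) := by
    rintro c hc d hd hcd
    apply Metric.ball_disjoint_ball
    rw [dist_eq_norm]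
    linarith [h c hc d hd hcd]
  have hsub : (⋃ c ∈ s, Metric.ball (c : E) (γ / 2)) ⊆ Metric.ball (0 : E) (1 + γ / 2) := by
    refine Set.iUnion₂_subset fun x hx => Metric.ball_subset_ball' ?_
    rw [dist_zero_right, hs x hx]
    linarith
  have hvol : (s.card : ENNReal) * ENNReal.ofReal ((γ / 2) ^ Module.finrank ℝ E) *
      μ (Metric.ball 0 1) ≤
      ENNReal.ofReal ((1 + γ / 2) ^ Module.finrank ℝ E) * μ (Metric.ball 0 1) :=
    calc
      _ = μ (⋃ c ∈ s, Metric.ball (c : E) (γ / 2)) := by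
        rw [measure_biUnion_finset hdisj fun c _ => measurableSet_ball]
        simp only [μ.addHaar_ball_of_pos _ hγ2]
        simp only [Finset.sum_const, nsmul_eq_mul, mul_assoc]
      _ ≤ μ (Metric.ball (0 : E) (1 + γ / 2)) := measure_mono hsub
      _ = _ := by simp only [μ.addHaar_ball_of_pos _ hρ]
  have hcard := (ENNReal.mul_le_mul_iff_left
    (Metric.measure_ball_pos _ _ zero_lt_one).ne' measure_ball_lt_top.ne).1 hvol
  have h2 := ENNReal.toReal_le_of_le_ofReal (pow_nonneg hρ.le _) hcard
  rw [ENNReal.toReal_mul, ENNReal.toReal_natCast, ENNReal.toReal_ofReal (by positivity),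
    ← le_div_iff₀ (by positivity), ← div_pow] at h2
  have : (1 + γ / 2) / (γ / 2) = 1 + 2 / γ := by field_simp; ring
  rwa [this] at h2

/-- A separated subset of maximal cardinality is a net, since a point far from all of it could be
added. The volume bound makes the maximum exist. -/
theorem exists_sphere_net (E : Type*) [NormedAddCommGroup E] [NormedSpace ℝ E]
    [FiniteDimensional ℝ E] {γ : ℝ} (hγ : 0 < γ) :
    ∃ N : Finset E, (∀ v ∈ N, ‖v‖ = 1) ∧ (N.card : ℝ) ≤ (1 + 2 / γ) ^ Module.finrank ℝ E ∧
      ∀ u : E, ‖u‖ = 1 → ∃ v ∈ N, ‖u - v‖ ≤ γ := by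
  classical
  let Q : Finset E → Prop := fun s =>
    (∀ c ∈ s, ‖c‖ = 1) ∧ ∀ c ∈ s, ∀ d ∈ s, c ≠ d → γ ≤ ‖c - d‖
  let S : Set ℕ := {m | ∃ s, Q s ∧ s.card = m}
  have hbdd : BddAbove S := by
    refine ⟨⌊(1 + 2 / γ) ^ Module.finrank ℝ E⌋₊, ?_⟩
    rintro _ ⟨s, hs, rfl⟩
    exact Nat.le_floor (card_le_of_separated_sphere hγ s hs.1 hs.2)
  obtain ⟨N, hN, hcard⟩ : sSup S ∈ S := Nat.sSup_mem ⟨0, ∅, by simp [Q], rfl⟩ hbdd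
  refine ⟨N, hN.1, card_le_of_separated_sphere hγ N hN.1 hN.2, fun u hu => ?_⟩
  by_contra! hcon
  have huN : u ∉ N := fun hm => by
    have := hcon u hm
    simp at this
    linarith
  have hQ : Q (insert u N) := by
    refine ⟨?_, ?_⟩
    · intro c hc
      rcases Finset.mem_insert.1 hc with rfl | hc
      exacts [hu, hN.1 c hc]
    · intro c hc d hd hcd
      rcases Finset.mem_insert.1 hc with rfl | hc <;> rcases Finset.mem_insert.1 hd with rfl | hd
      · exact absurd rfl hcd
      · exact (hcon d hd).le
      · rw [norm_sub_rev]; exact (hcon c ((Finset.mem_insert.1 hc).resolve_left hcd)).le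
      · exact hN.2 c hc d hd hcd
  have := le_csSup hbdd (show (insert u N).card ∈ S from ⟨_, hQ, rfl⟩)
  rw [Finset.card_insert_of_notMem huN, hcard] at this
  omega

variable {F : Type*} [NormedAddCommGroup F] [NormedSpace ℝ F]

/-- Approximating a unit vector by a net point gives `‖T‖ ≤ U + γ‖T‖`, and `γ ≤ 1/2` lets the last
term be absorbed. -/
theorem norm_le_of_net {γ : ℝ} (hγ : γ ≤ 1 / 2) {N : Finset E}
    (hnet : ∀ u : E, ‖u‖ = 1 → ∃ v ∈ N, ‖u - v‖ ≤ γ) (T : E →ₗ[ℝ] F) {U : ℝ}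
    (hU : ∀ v ∈ N, ‖T v‖ ≤ U) (x : E) : ‖T x‖ ≤ 2 * U * ‖x‖ := by
  let T' : E →L[ℝ] F := LinearMap.toContinuousLinearMap T
  rcases subsingleton_or_nontrivial E with hE | hE
  · simp [Subsingleton.elim x 0]
  have hU0 : 0 ≤ U := by
    obtain ⟨u, hu⟩ := exists_norm_eq E zero_le_one
    obtain ⟨v, hv, -⟩ := hnet u hu
    exact (norm_nonneg _).trans (hU v hv)
  have key : ‖T'‖ ≤ U + γ * ‖T'‖ := by
    have hγ0 : 0 ≤ γ := by
      obtain ⟨u, hu⟩ := exists_norm_eq E zero_le_one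
      obtain ⟨v, hv, h⟩ := hnet u hu
      exact (norm_nonneg _).trans h
    refine T'.opNorm_le_of_unit_norm (by positivity) fun u hu => ?_
    obtain ⟨v, hv, h⟩ := hnet u hu
    calc ‖T' u‖ = ‖T' v + T' (u - v)‖ := by rw [← map_add]; congr 2; abel
      _ ≤ ‖T' v‖ + ‖T' (u - v)‖ := norm_add_le _ _
      _ ≤ U + ‖T'‖ * ‖u - v‖ := add_le_add (hU v hv) (T'.le_opNorm _)
      _ ≤ U + γ * ‖T'‖ := by nlinarith [norm_nonneg T']
  have h2 : ‖T'‖ ≤ 2 * U := by nlinarith [norm_nonneg T']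
  calc ‖T x‖ = ‖T' x‖ := rfl
    _ ≤ ‖T'‖ * ‖x‖ := T'.le_opNorm x
    _ ≤ 2 * U * ‖x‖ := by gcongr

end Net

/-- Passing from a unit vector to its net point costs at most `γU`, so a lower bound on the net
needs an upper bound on the whole space. -/
theorem le_norm_of_net {E F : Type*} [NormedAddCommGroup E] [NormedSpace ℝ E]
    [NormedAddCommGroup F] [NormedSpace ℝ F] {γ : ℝ} {N : Finset E}
    (hnet : ∀ u : E, ‖u‖ = 1 → ∃ v ∈ N, ‖u - v‖ ≤ γ) (T : E →ₗ[ℝ] F) {U l : ℝ} (hU0 : 0 ≤ U)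
    (hU : ∀ x, ‖T x‖ ≤ U * ‖x‖) (hl : ∀ v ∈ N, l ≤ ‖T v‖) (x : E) :
    (l - γ * U) * ‖x‖ ≤ ‖T x‖ := by
  rcases eq_or_ne x 0 with rfl | hx
  · simp
  have hx' : 0 < ‖x‖ := norm_pos_iff.2 hx
  have hu : ‖‖x‖⁻¹ • x‖ = 1 := by rw [norm_smul, norm_inv, norm_norm, inv_mul_cancel₀ hx'.ne']
  obtain ⟨v, hv, h⟩ := hnet _ hu
  have h1 : ‖T (‖x‖⁻¹ • x)‖ = ‖x‖⁻¹ * ‖T x‖ := by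
    rw [map_smul, norm_smul, norm_inv, norm_norm]
  have h2 : ‖T v‖ ≤ ‖T (‖x‖⁻¹ • x)‖ + U * γ := by
    calc ‖T v‖ = ‖T (‖x‖⁻¹ • x) - T (‖x‖⁻¹ • x - v)‖ := by rw [← map_sub]; congr 2; abel
      _ ≤ ‖T (‖x‖⁻¹ • x)‖ + ‖T (‖x‖⁻¹ • x - v)‖ := norm_sub_le _ _
      _ ≤ _ := by gcongr; exact (hU _).trans (by gcongr)
  rw [h1] at h2
  have h3 : l - γ * U ≤ ‖x‖⁻¹ * ‖T x‖ := by linarith [hl v hv]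
  calc (l - γ * U) * ‖x‖ ≤ ‖x‖⁻¹ * ‖T x‖ * ‖x‖ := by gcongr
    _ = ‖T x‖ := by field_simp

/-! ### Matrices as operators on Euclidean space -/

section Operators

variable {m ι : Type*} [Fintype ι] [DecidableEq ι]

theorem toEuclideanLin_mul_apply {κ : Type*} [Fintype κ] [DecidableEq κ] (R : Matrix m ι ℝ)
    (Q : Matrix ι κ ℝ) (x : EuclideanSpace ℝ κ) :
    Matrix.toEuclideanLin (R * Q) x = Matrix.toEuclideanLin R (Matrix.toEuclideanLin Q x) := by
  ext i
  simp [Matrix.toEuclideanLin]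

theorem toEuclideanLin_single_apply (R : Matrix m ι ℝ) (i : ι) (k : m) :
    Matrix.toEuclideanLin R (EuclideanSpace.single i 1) k = R k i := by
  simp [Matrix.toEuclideanLin]

variable [Fintype m] [DecidableEq m]

theorem inner_toEuclideanLin_transpose (R : Matrix m ι ℝ) (x : EuclideanSpace ℝ ι)
    (y : EuclideanSpace ℝ m) :
    inner ℝ x (Matrix.toEuclideanLin R.transpose y) = inner ℝ (Matrix.toEuclideanLin R x) y := by
  rw [← Matrix.conjTranspose_eq_transpose_of_trivial,
    Matrix.toEuclideanLin_conjTranspose_eq_adjoint,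
    LinearMap.adjoint_inner_right]

theorem norm_sq_toEuclideanLin_transpose_le {R : Matrix m ι ℝ} {L : ℝ} (hL : 0 ≤ L)
    (hR : ∀ x : EuclideanSpace ℝ ι, ‖Matrix.toEuclideanLin R x‖ ^ 2 ≤ L * ‖x‖ ^ 2)
    (y : EuclideanSpace ℝ m) : ‖Matrix.toEuclideanLin R.transpose y‖ ^ 2 ≤ L * ‖y‖ ^ 2 := by
  set z := Matrix.toEuclideanLin R.transpose y
  have h1 : ‖z‖ ^ 2 ≤ ‖Matrix.toEuclideanLin R z‖ * ‖y‖ := by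
    rw [← real_inner_self_eq_norm_sq]
    exact (inner_toEuclideanLin_transpose R z y).le.trans (real_inner_le_norm _ _)
  have h2 := hR z
  rcases (norm_nonneg z).eq_or_lt with h0 | h0
  · have : 0 ≤ L * ‖y‖ ^ 2 := by positivity
    rw [← h0]
    simpa using this
  have h3 : (‖z‖ ^ 2) ^ 2 ≤ (‖Matrix.toEuclideanLin R z‖ * ‖y‖) ^ 2 := by gcongr
  have h4 : ‖z‖ ^ 2 * ‖z‖ ^ 2 ≤ ‖z‖ ^ 2 * (L * ‖y‖ ^ 2) := by
    nlinarith [mul_le_mul_of_nonneg_right h2 (sq_nonneg ‖y‖)]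
  exact le_of_mul_le_mul_left h4 (by positivity)

end Operators

/-! ### Scalar inequalities -/

theorem exp_neg_le_quadratic {x : ℝ} (hx : 0 ≤ x) : Real.exp (-x) ≤ 1 - x + x ^ 2 / 2 := by
  have hmono : MonotoneOn (fun y : ℝ => 1 - y + y ^ 2 / 2 - Real.exp (-y)) (Set.Ici 0) := by
    have hd : ∀ y : ℝ, HasDerivAt (fun y : ℝ => 1 - y + y ^ 2 / 2 - Real.exp (-y))
        (-1 + y + Real.exp (-y)) y := fun y => by
      have h1 := (((hasDerivAt_const y (1 : ℝ)).sub (hasDerivAt_id y)).add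
        ((hasDerivAt_pow 2 y).div_const 2)).sub ((hasDerivAt_neg y).exp)
      convert! h1 using 1
      simp
    apply monotoneOn_of_deriv_nonneg (convex_Ici 0) (by fun_prop)
      (fun y _ => (hd y).differentiableAt.differentiableWithinAt)
    intro y hy
    rw [(hd y).deriv]
    linarith [Real.add_one_le_exp (-y)]
  have := hmono (Set.mem_Ici.2 le_rfl) (Set.mem_Ici.2 hx) hx
  simp at this
  linarith

/-- The linear term disappears on integrating a centred variable, leaving only the
square-exponential moment. -/
theorem exp_le_add_exp_sq (x : ℝ) : Real.exp x ≤ x + Real.exp (x ^ 2) := by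
  have h1 : ∀ y : ℝ, |y| ≤ 1 → Real.exp y ≤ 1 + y + y ^ 2 := fun y hy => by
    have := Real.abs_exp_sub_one_sub_id_le hy
    linarith [(abs_le.1 this).2]
  have h2 := Real.add_one_le_exp (x ^ 2)
  by_cases h : |x| ≤ 1
  · linarith [h1 x h]
  · push Not at h
    rcases lt_abs.1 h with h | h
    · have : Real.exp x ≤ Real.exp (x ^ 2) := Real.exp_le_exp.2 (by nlinarith)
      linarith
    · have h3 : Real.exp x ≤ 1 := Real.exp_le_one_iff.2 (by linarith)
      nlinarith

/-- The left side is the exponential moment `𝔼 exp(x g²)` of a standard Gaussian `g`. -/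
theorem inv_sqrt_one_sub_le_exp {x : ℝ} (hx : |x| ≤ 1 / 4) :
    (√(1 - 2 * x))⁻¹ ≤ Real.exp (x + 4 * x ^ 2) := by
  have ⟨hx1, hx2⟩ := abs_le.1 hx
  have hpos : 0 < 1 - 2 * x := by linarith
  have hlog : -(2 * (x + 4 * x ^ 2)) ≤ Real.log (1 - 2 * x) := by
    have h2x : |2 * x| ≤ 1 / 2 := by rw [abs_mul]; norm_num; linarith
    have hab := Real.abs_log_sub_add_sum_range_le (x := 2 * x) (by linarith) 1
    simp only [Finset.range_one, Finset.sum_singleton, Nat.cast_zero, zero_add, pow_one,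
      div_one, Nat.reduceAdd] at hab
    have h4 : |2 * x| ^ 2 / (1 - |2 * x|) ≤ 8 * x ^ 2 := by
      rw [sq_abs, div_le_iff₀ (by linarith)]
      nlinarith [sq_nonneg x]
    linarith [(abs_le.1 (hab.trans h4)).1]
  have h1 : (1 - 2 * x)⁻¹ ≤ Real.exp (2 * (x + 4 * x ^ 2)) := by
    rw [inv_le_comm₀ hpos (Real.exp_pos _), ← Real.exp_neg]
    calc Real.exp (-(2 * (x + 4 * x ^ 2))) ≤ Real.exp (Real.log (1 - 2 * x)) :=
          Real.exp_le_exp.2 hlog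
      _ = 1 - 2 * x := Real.exp_log hpos
  rw [← Real.sqrt_inv]
  calc √((1 - 2 * x)⁻¹) ≤ √(Real.exp (2 * (x + 4 * x ^ 2))) := Real.sqrt_le_sqrt h1
    _ = Real.exp (x + 4 * x ^ 2) := by
      rw [two_mul, Real.exp_add, Real.sqrt_mul_self (Real.exp_pos _).le]

/-! ### Exponential integrals -/

theorem lintegral_prod_pi {ι α : Type*} [Fintype ι] [MeasurableSpace α] (μ : ι → Measure α)
    [∀ i, IsProbabilityMeasure (μ i)] {f : ι → α → ENNReal} (hf : ∀ i, Measurable (f i)) :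
    ∫⁻ x, ∏ i, f i (x i) ∂Measure.pi μ = ∏ i, ∫⁻ t, f i t ∂μ i := by
  rw [lintegral_prod_eq_prod_lintegral_of_indepFun Finset.univ
    (fun i (x : ι → α) => f i (x i)) (iIndepFun_pi fun i => (hf i).aemeasurable)
    (fun i => (hf i).comp (measurable_pi_apply i))]
  refine Finset.prod_congr rfl fun i _ => ?_
  exact (measurePreserving_eval μ i).lintegral_comp (hf i)

theorem ofReal_exp_sum {ι : Type*} (s : Finset ι) (a : ι → ℝ) :
    ENNReal.ofReal (Real.exp (∑ i ∈ s, a i)) = ∏ i ∈ s, ENNReal.ofReal (Real.exp (a i)) := by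
  rw [Real.exp_sum, ENNReal.ofReal_prod_of_nonneg fun i _ => (Real.exp_pos _).le]

theorem ofReal_exp_add (a b : ℝ) :
    ENNReal.ofReal (Real.exp (a + b)) =
      ENNReal.ofReal (Real.exp a) * ENNReal.ofReal (Real.exp b) := by
  rw [Real.exp_add, ENNReal.ofReal_mul (Real.exp_pos _).le]

/-- Cauchy–Schwarz: two dependent exponents can be treated separately at the price of doubling each.
-/
theorem lintegral_exp_add_le {α : Type*} [MeasurableSpace α] {μ : Measure α} {φ ψ : α → ℝ}
    (hφ : Measurable φ) (hψ : Measurable ψ) {a b : ℝ}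
    (ha : ∫⁻ x, ENNReal.ofReal (Real.exp (2 * φ x)) ∂μ ≤ ENNReal.ofReal (Real.exp (2 * a)))
    (hb : ∫⁻ x, ENNReal.ofReal (Real.exp (2 * ψ x)) ∂μ ≤ ENNReal.ofReal (Real.exp (2 * b))) :
    ∫⁻ x, ENNReal.ofReal (Real.exp (φ x + ψ x)) ∂μ ≤ ENNReal.ofReal (Real.exp (a + b)) := by
  have hsq : ∀ t : ℝ, ENNReal.ofReal (Real.exp t) ^ (2 : ℝ) = ENNReal.ofReal (Real.exp (2 * t)) :=
    fun t => by
      rw [ENNReal.ofReal_rpow_of_pos (Real.exp_pos _), ← Real.exp_mul, mul_comm]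
  have hroot : ∀ t : ℝ, ENNReal.ofReal (Real.exp (2 * t)) ^ (1 / 2 : ℝ) =
      ENNReal.ofReal (Real.exp t) := fun t => by
    rw [ENNReal.ofReal_rpow_of_pos (Real.exp_pos _), ← Real.exp_mul]
    congr 2
    ring
  have h := ENNReal.lintegral_mul_le_Lp_mul_Lq μ Real.HolderConjugate.two_two
    (f := fun x => ENNReal.ofReal (Real.exp (φ x))) (g := fun x => ENNReal.ofReal (Real.exp (ψ x)))
    (by fun_prop) (by fun_prop)
  simp only [Pi.mul_apply, hsq, ← ofReal_exp_add] at h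
  refine h.trans ?_
  rw [ofReal_exp_add, ← hroot a, ← hroot b]
  gcongr

/-! ### Gaussian integrals -/

theorem lintegral_exp_mul_gaussianReal (t : ℝ) :
    ∫⁻ x, ENNReal.ofReal (Real.exp (t * x)) ∂gaussianReal 0 1 =
      ENNReal.ofReal (Real.exp (t ^ 2 / 2)) := by
  rw [← ofReal_integral_eq_lintegral_ofReal (integrable_exp_mul_gaussianReal t)
    (Filter.Eventually.of_forall fun _ => (Real.exp_pos _).le)]
  have h := congrFun (mgf_fun_id_gaussianReal (μ := 0) (v := 1)) t
  simp only [mgf] at h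
  rw [h]
  simp

theorem lintegral_exp_mul_sq_gaussianReal {x : ℝ} (hx : |x| ≤ 1 / 4) :
    ∫⁻ t, ENNReal.ofReal (Real.exp (x * t ^ 2)) ∂gaussianReal 0 1 ≤
      ENNReal.ofReal (Real.exp (x + 4 * x ^ 2)) := by
  have ⟨hx1, hx2⟩ := abs_le.1 hx
  have hpos : 0 < 1 / 2 - x := by linarith
  rw [gaussianReal_of_var_ne_zero 0 one_ne_zero,
    lintegral_withDensity_eq_lintegral_mul _ (measurable_gaussianPDF 0 1) (by fun_prop)]
  have hfun : ∀ t : ℝ, (gaussianPDF 0 1 * fun t => ENNReal.ofReal (Real.exp (x * t ^ 2))) t =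
      ENNReal.ofReal ((√(2 * Real.pi))⁻¹ * Real.exp (-(1 / 2 - x) * t ^ 2)) := fun t => by
    simp only [Pi.mul_apply, gaussianPDF, gaussianPDFReal]
    rw [← ENNReal.ofReal_mul (by positivity), mul_assoc, ← Real.exp_add]
    congr 3
    · simp
    · simp; ring
  simp_rw [hfun]
  rw [← ofReal_integral_eq_lintegral_ofReal ((integrable_exp_neg_mul_sq hpos).const_mul _)
    (Filter.Eventually.of_forall fun _ => by positivity), integral_const_mul, integral_gaussian]
  refine ENNReal.ofReal_le_ofReal (le_trans (le_of_eq ?_) (inv_sqrt_one_sub_le_exp hx))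
  rw [← Real.sqrt_inv, ← Real.sqrt_mul (by positivity), ← Real.sqrt_inv]
  congr 1
  have h3 : 1 - 2 * x ≠ 0 := by linarith
  have hpi := Real.pi_ne_zero
  have : 1 / 2 - x = (1 - 2 * x) / 2 := by ring
  rw [this]
  field_simp

theorem lintegral_exp_inner_stdGaussian {ι : Type*} [Fintype ι] (w : EuclideanSpace ℝ ι) :
    ∫⁻ h, ENNReal.ofReal (Real.exp (inner ℝ w h)) ∂stdGaussian (EuclideanSpace ℝ ι) =
      ENNReal.ofReal (Real.exp (‖w‖ ^ 2 / 2)) := by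
  rw [← map_pi_eq_stdGaussian, lintegral_map (by fun_prop) (by fun_prop)]
  simp only [PiLp.inner_apply, RCLike.inner_apply, conj_trivial]
  simp_rw [ofReal_exp_sum, mul_comm _ (w _)]
  rw [lintegral_prod_pi (fun _ => gaussianReal 0 1)
    (f := fun i t => ENNReal.ofReal (Real.exp (w i * t))) (fun i => by fun_prop)]
  simp_rw [lintegral_exp_mul_gaussianReal]
  rw [← ofReal_exp_sum, EuclideanSpace.real_norm_sq_eq, Finset.sum_div]

variable {ι : Type*} [Fintype ι] [DecidableEq ι]

/-- By rotation invariance the coordinates in an eigenbasis of `S` are again independent standard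
Gaussians. The form becomes `∑ e_k x_k²`, while the trace and the squared Frobenius norm are `∑ e_k`
and `∑ e_k²`. -/
theorem lintegral_exp_quadratic_stdGaussian {S : Matrix ι ι ℝ} (hS : S.IsHermitian)
    (hb : ∀ x : EuclideanSpace ℝ ι, |inner ℝ x (Matrix.toEuclideanLin S x)| ≤ 1 / 4 * ‖x‖ ^ 2) :
    ∫⁻ h, ENNReal.ofReal (Real.exp (inner ℝ h (Matrix.toEuclideanLin S h)))
      ∂stdGaussian (EuclideanSpace ℝ ι) ≤
      ENNReal.ofReal (Real.exp (S.trace + 4 * ∑ i, ∑ j, S i j ^ 2)) := by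
  let b := hS.eigenvectorBasis
  let e := hS.eigenvalues
  have hSb : ∀ k, Matrix.toEuclideanLin S (b k) = e k • b k := fun k => by
    have := hS.mulVec_eigenvectorBasis k
    ext i
    simpa [Matrix.toEuclideanLin] using congrFun this i
  have he : ∀ k, |e k| ≤ 1 / 4 := fun k => by
    have := hb (b k)
    rw [hSb, inner_smul_right, real_inner_self_eq_norm_sq, b.norm_eq_one] at this
    simpa using this
  have hquad : ∀ x : ι → ℝ, inner ℝ (∑ i, x i • b i) (Matrix.toEuclideanLin S (∑ i, x i • b i)) =
      ∑ k, e k * x k ^ 2 := fun x => by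
    simp only [map_sum, map_smul, hSb]
    simp_rw [smul_smul]
    rw [b.orthonormal.inner_sum]
    refine Finset.sum_congr rfl fun k _ => ?_
    simp only [conj_trivial]
    ring
  have htr : S.trace = ∑ k, e k := by
    simpa using hS.trace_eq_sum_eigenvalues
  have hfrob : ∑ i, ∑ j, S i j ^ 2 = ∑ k, e k ^ 2 := by
    have h1 : ∀ i, ∑ j, S i j ^ 2 = ∑ k, (e k * b k i) ^ 2 := fun i => by
      have hrow : ∀ x : EuclideanSpace ℝ ι, inner ℝ x (WithLp.toLp 2 (S i)) =
          Matrix.toEuclideanLin S x i := fun x => by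
        simp [PiLp.inner_apply, Matrix.toEuclideanLin, Matrix.mulVec, dotProduct]
      have h2 := b.sum_sq_inner_right (WithLp.toLp 2 (S i))
      rw [EuclideanSpace.real_norm_sq_eq] at h2
      simp only [hrow, hSb] at h2
      simpa using h2.symm
    simp_rw [h1]
    rw [Finset.sum_comm]
    refine Finset.sum_congr rfl fun k _ => ?_
    simp_rw [mul_pow]
    rw [← Finset.mul_sum, ← EuclideanSpace.real_norm_sq_eq, b.norm_eq_one]
    simp
  rw [stdGaussian_eq_map_pi_orthonormalBasis b, lintegral_map (by fun_prop) (by fun_prop)]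
  simp_rw [hquad, ofReal_exp_sum]
  rw [lintegral_prod_pi (fun _ => gaussianReal 0 1)
    (f := fun i t => ENNReal.ofReal (Real.exp (e i * t ^ 2))) (fun i => by fun_prop), htr, hfrob,
    Finset.mul_sum, ← Finset.sum_add_distrib, ofReal_exp_sum]
  exact Finset.prod_le_prod' fun k _ => lintegral_exp_mul_sq_gaussianReal (he k)

/-! ### Comparison of product measures -/

/-- Replacement of one coordinate at a time: a comparison valid in each coordinate, with the others
frozen, passes to the product measures. -/
theorem lintegral_pi_le_of_update_le {μ ν : ι → Measure ℝ} [∀ i, IsProbabilityMeasure (μ i)]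
    [∀ i, IsProbabilityMeasure (ν i)] {f : (ι → ℝ) → ENNReal} (hf : Measurable f)
    (h : ∀ i x, ∫⁻ t, f (Function.update x i t) ∂μ i ≤ ∫⁻ t, f (Function.update x i t) ∂ν i) :
    ∫⁻ x, f x ∂Measure.pi μ ≤ ∫⁻ x, f x ∂Measure.pi ν := by
  have key : ∀ s : Finset ι, lmarginal μ s f ≤ lmarginal ν s f := by
    intro s
    induction s using Finset.induction_on with
    | empty => simp
    | insert i s hi ih =>
      have h1 : lmarginal μ (insert i s) f ≤
          fun x => ∫⁻ t, lmarginal ν s f (Function.update x i t) ∂μ i := fun x => by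
        rw [lmarginal_insert f hf hi]
        exact lintegral_mono fun t => ih _
      -- Hybrid family: `μ` in coordinate `i`, `ν` elsewhere. Fubini for this product moves
      -- coordinate `i` to the innermost place, where `h` applies.
      let κ : ι → Measure ℝ := Function.update ν i (μ i)
      have hκi : κ i = μ i := Function.update_self ..
      have hκ : ∀ j, IsProbabilityMeasure (κ j) := fun j => by
        rcases eq_or_ne j i with rfl | hj
        · rw [hκi]; infer_instance
        · rw [show κ j = ν j from Function.update_of_ne hj ..]; infer_instance
      have hκs : ∀ g, lmarginal κ s g = lmarginal ν s g := fun g => by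
        have : (fun j : s => κ j) = fun j : s => ν j := funext fun j =>
          Function.update_of_ne (fun hj => hi (by rw [← hj]; exact j.2)) ..
        funext x
        simp only [lmarginal, this]
      refine h1.trans (le_trans (le_of_eq ?_) (?_ : lmarginal κ (insert i s) f ≤ _))
      · funext x
        rw [lmarginal_insert f hf hi, hκi, hκs]
      · rw [lmarginal_insert' f hf hi, lmarginal_insert' f hf hi, hκs, hκi]
        exact lmarginal_mono fun x => h i x
  have := key Finset.univ 0
  simpa [lmarginal_univ] using this

/-! ### Upper tail of the norm of a sub-Gaussian vector -/

/-- Column `i` of `RᵀR` is `Rᵀ` applied to column `i` of `R`, and `Rᵀ` has the same norm bound as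
`R`. -/
theorem sum_sq_transpose_mul_self_le {m : Type*} [Fintype m] [DecidableEq m] {R : Matrix m ι ℝ}
    {L : ℝ} (hL : 0 ≤ L)
    (hR : ∀ x : EuclideanSpace ℝ ι, ‖Matrix.toEuclideanLin R x‖ ^ 2 ≤ L * ‖x‖ ^ 2) (i : ι) :
    ∑ j, (R.transpose * R) j i ^ 2 ≤ L * ∑ k, R k i ^ 2 := by
  have h2 := norm_sq_toEuclideanLin_transpose_le hL hR
    (Matrix.toEuclideanLin R (EuclideanSpace.single i 1))
  rw [← toEuclideanLin_mul_apply, EuclideanSpace.real_norm_sq_eq,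
    EuclideanSpace.real_norm_sq_eq] at h2
  simpa only [toEuclideanLin_single_apply] using h2

/-- Gaussian linearization: `exp(l‖v‖²)` is the mean of `exp(⟨√(2l) v, h⟩)` over a standard Gaussian
`h`. After exchanging the integrals, the sub-Gaussian bound on linear forms of `V` leaves a Gaussian
quadratic form in `h`. -/
theorem lintegral_exp_norm_sq_le {m : Type*} [Fintype m] [DecidableEq m] {Ω : Type*}
    [MeasurableSpace Ω] {P : Measure Ω} [SFinite P]
    {V : Ω → EuclideanSpace ℝ ι} (hV : AEMeasurable V P) {s L l : ℝ} {R : Matrix m ι ℝ}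
    (hL : 0 ≤ L) (hs : 0 ≤ s)
    (hR : ∀ x : EuclideanSpace ℝ ι, ‖Matrix.toEuclideanLin R x‖ ^ 2 ≤ L * ‖x‖ ^ 2)
    (hsub : ∀ w, ∫⁻ ω, ENNReal.ofReal (Real.exp (inner ℝ w (V ω))) ∂P ≤
      ENNReal.ofReal (Real.exp (s * ‖Matrix.toEuclideanLin R w‖ ^ 2 / 2)))
    (hl : 0 ≤ l) (hls : 4 * l * s * L ≤ 1) :
    ∫⁻ ω, ENNReal.ofReal (Real.exp (l * ‖V ω‖ ^ 2)) ∂P ≤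
      ENNReal.ofReal (Real.exp (2 * l * s * ∑ i, ∑ k, R k i ^ 2)) := by
  let S : Matrix ι ι ℝ := (l * s) • (R.transpose * R)
  have hS : S.IsHermitian := by
    ext i j
    simp [S, Matrix.mul_apply, mul_comm]
  have hform : ∀ x : EuclideanSpace ℝ ι, inner ℝ x (Matrix.toEuclideanLin S x) =
      l * s * ‖Matrix.toEuclideanLin R x‖ ^ 2 := fun x => by
    simp only [S, map_smul, LinearMap.smul_apply, inner_smul_right, toEuclideanLin_mul_apply,
      inner_toEuclideanLin_transpose, real_inner_self_eq_norm_sq]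
  have hSb : ∀ x : EuclideanSpace ℝ ι,
      |inner ℝ x (Matrix.toEuclideanLin S x)| ≤ 1 / 4 * ‖x‖ ^ 2 := fun x => by
    rw [hform, abs_of_nonneg (by positivity)]
    calc l * s * ‖Matrix.toEuclideanLin R x‖ ^ 2 ≤ l * s * (L * ‖x‖ ^ 2) := by
          gcongr; exact hR x
      _ = (4 * l * s * L) / 4 * ‖x‖ ^ 2 := by ring
      _ ≤ 1 / 4 * ‖x‖ ^ 2 := by gcongr
  have hgauss : ∀ v : EuclideanSpace ℝ ι, ENNReal.ofReal (Real.exp (l * ‖v‖ ^ 2)) =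
      ∫⁻ h, ENNReal.ofReal (Real.exp (inner ℝ (√(2 * l) • v) h))
        ∂stdGaussian (EuclideanSpace ℝ ι) := fun v => by
    rw [lintegral_exp_inner_stdGaussian, norm_smul, mul_pow, Real.norm_eq_abs, sq_abs,
      Real.sq_sqrt (by positivity)]
    congr 2
    ring
  simp_rw [hgauss]
  have hmeas : AEMeasurable (Function.uncurry fun (ω : Ω) (h : EuclideanSpace ℝ ι) =>
      ENNReal.ofReal (Real.exp (inner ℝ (√(2 * l) • V ω) h)))
      (P.prod (stdGaussian (EuclideanSpace ℝ ι))) := by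
    have h1 : AEMeasurable (fun q : Ω × EuclideanSpace ℝ ι => V q.1)
        (P.prod (stdGaussian (EuclideanSpace ℝ ι))) :=
      hV.comp_quasiMeasurePreserving Measure.quasiMeasurePreserving_fst
    have h2 : AEMeasurable (fun q : Ω × EuclideanSpace ℝ ι => q.2)
        (P.prod (stdGaussian (EuclideanSpace ℝ ι))) := measurable_snd.aemeasurable
    exact ((AEMeasurable.inner (𝕜 := ℝ) (h1.const_smul (√(2 * l))) h2).exp).ennreal_ofReal
  rw [lintegral_lintegral_swap hmeas]
  calc _ ≤ ∫⁻ h, ENNReal.ofReal (Real.exp (inner ℝ h (Matrix.toEuclideanLin S h)))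
      ∂stdGaussian (EuclideanSpace ℝ ι) := by
        refine lintegral_mono fun h => ?_
        have h1 := hsub (√(2 * l) • h)
        rw [map_smul, norm_smul, mul_pow, Real.norm_eq_abs, sq_abs,
          Real.sq_sqrt (by positivity)] at h1
        have h2 : s * (2 * l * ‖Matrix.toEuclideanLin R h‖ ^ 2) / 2 =
            inner ℝ h (Matrix.toEuclideanLin S h) := by rw [hform]; ring
        rw [h2] at h1
        refine le_trans (le_of_eq ?_) h1
        refine lintegral_congr fun ω => ?_
        rw [real_inner_smul_left, real_inner_smul_left, real_inner_comm]
    _ ≤ _ := lintegral_exp_quadratic_stdGaussian hS hSb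
    _ ≤ _ := by
        refine ENNReal.ofReal_le_ofReal (Real.exp_le_exp.2 ?_)
        have htr : S.trace = l * s * ∑ i, ∑ k, R k i ^ 2 := by
          simp only [S, Matrix.trace, Matrix.diag, Matrix.smul_apply, smul_eq_mul,
            Matrix.mul_apply, Matrix.transpose_apply, sq, Finset.mul_sum]
        have hfrob : ∑ i, ∑ j, S i j ^ 2 ≤ (l * s) ^ 2 * (L * ∑ i, ∑ k, R k i ^ 2) := by
          simp only [S, Matrix.smul_apply, smul_eq_mul, mul_pow]
          rw [Finset.sum_comm]
          simp only [← Finset.mul_sum]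
          rw [Finset.mul_sum (a := L)]
          rw [← mul_pow]
          gcongr
          exact sum_sq_transpose_mul_self_le hL hR _
        have h0 : 0 ≤ ∑ i, ∑ k, R k i ^ 2 := by positivity
        rw [htr]
        -- The smallness of `l` keeps the Frobenius correction below the trace term; this is the
        -- origin of the factor `2`.
        have h1 : l * s * (4 * l * s * L * ∑ i, ∑ k, R k i ^ 2) ≤
            l * s * (1 * ∑ i, ∑ k, R k i ^ 2) := by gcongr
        nlinarith

/-! ### Lower tail of a quadratic form in independent sub-Gaussian variables -/

/-- The form `‖Rx‖²` is the sum of its diagonal `∑ d_i x_i²`, which factors over coordinates and is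
governed by `hvar`, and of an off-diagonal part, which is affine in each coordinate and can be
compared with its Gaussian analogue. Cauchy–Schwarz joins the two. -/
theorem lintegral_exp_neg_norm_sq_le {m : Type*} [Fintype m] [DecidableEq m]
    (μ : ι → Measure ℝ) [∀ i, IsProbabilityMeasure (μ i)] {s q L l : ℝ} (hs : 0 < s) (hq : 0 ≤ q)
    (hsub : ∀ i t, ∫⁻ x, ENNReal.ofReal (Real.exp (t * x)) ∂μ i ≤
      ENNReal.ofReal (Real.exp (s * t ^ 2 / 2)))
    (hvar : ∀ i, ∀ a : ℝ, 0 ≤ a → ∫⁻ x, ENNReal.ofReal (Real.exp (-(a * x ^ 2))) ∂μ i ≤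
      ENNReal.ofReal (Real.exp (-a + q * a ^ 2 / 2)))
    (R : Matrix m ι ℝ) (hL : 0 ≤ L)
    (hR : ∀ x : EuclideanSpace ℝ ι, ‖Matrix.toEuclideanLin R x‖ ^ 2 ≤ L * ‖x‖ ^ 2)
    (hl : 0 ≤ l) (hls : 8 * l * s * L ≤ 1) :
    ∫⁻ x, ENNReal.ofReal (Real.exp (-(l * ‖Matrix.toEuclideanLin R (WithLp.toLp 2 x)‖ ^ 2)))
      ∂Measure.pi μ ≤
    ENNReal.ofReal (Real.exp (-(l * ∑ i, ∑ k, R k i ^ 2) +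
      l ^ 2 * (q + 8 * s ^ 2) * L * ∑ i, ∑ k, R k i ^ 2)) := by
  let W : Matrix ι ι ℝ := R.transpose * R
  let d : ι → ℝ := fun i => ∑ k, R k i ^ 2
  let S : Matrix ι ι ℝ := (-(2 * l * s)) • (W - Matrix.diagonal d)
  let T : ℝ := ∑ i, d i
  have hWd : ∀ i, W i i = d i := fun i => by
    simp [W, d, Matrix.mul_apply, sq]
  have hd0 : ∀ i, 0 ≤ d i := fun i => Finset.sum_nonneg fun _ _ => sq_nonneg _
  have hRe : ∀ i, ‖Matrix.toEuclideanLin R (EuclideanSpace.single i 1)‖ ^ 2 = d i := fun i => by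
    rw [EuclideanSpace.real_norm_sq_eq]
    simp [d, Matrix.toEuclideanLin]
  have hdL : ∀ i, d i ≤ L := fun i => by
    have := hR (EuclideanSpace.single i 1)
    rw [hRe] at this
    simpa using this
  have hform : ∀ x : EuclideanSpace ℝ ι, inner ℝ x (Matrix.toEuclideanLin S x) =
      -(2 * l * s) * (‖Matrix.toEuclideanLin R x‖ ^ 2 - ∑ i, d i * x i ^ 2) := fun x => by
    simp only [S, W, map_smul, map_sub, LinearMap.smul_apply, LinearMap.sub_apply, inner_smul_right,
      inner_sub_right, toEuclideanLin_mul_apply, inner_toEuclideanLin_transpose,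
      real_inner_self_eq_norm_sq]
    congr 2
    simp only [PiLp.inner_apply, RCLike.inner_apply, conj_trivial, Matrix.toEuclideanLin]
    refine Finset.sum_congr rfl fun i _ => ?_
    simp [Matrix.mulVec_diagonal]
    ring
  have hWfrob : ∑ i, ∑ j, S i j ^ 2 ≤ (2 * l * s) ^ 2 * (L * T) := by
    have h1 : ∀ i, ∑ j, W j i ^ 2 ≤ L * d i := sum_sq_transpose_mul_self_le hL hR
    have h2 : ∀ i j, S j i ^ 2 ≤ (2 * l * s) ^ 2 * W j i ^ 2 := fun i j => by
      simp only [S, Matrix.smul_apply, Matrix.sub_apply, smul_eq_mul, mul_pow, neg_sq]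
      refine mul_le_mul_of_nonneg_left ?_ (by positivity)
      rcases eq_or_ne j i with rfl | hij
      · rw [Matrix.diagonal_apply_eq, hWd, sub_self, zero_pow two_ne_zero]; positivity
      · rw [Matrix.diagonal_apply_ne _ hij, sub_zero]
    rw [Finset.sum_comm, Finset.mul_sum, Finset.mul_sum]
    refine Finset.sum_le_sum fun i _ => ?_
    refine (Finset.sum_le_sum fun j _ => h2 i j).trans ?_
    rw [← Finset.mul_sum]
    exact mul_le_mul_of_nonneg_left (h1 i) (sq_nonneg _)
  have hS : S.IsHermitian := by
    ext i j
    simp [S, W, Matrix.mul_apply, Matrix.diagonal_apply, mul_comm, eq_comm]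
    rcases eq_or_ne i j with rfl | hij <;> simp [*]
  have hSb : ∀ x : EuclideanSpace ℝ ι,
      |inner ℝ x (Matrix.toEuclideanLin S x)| ≤ 1 / 4 * ‖x‖ ^ 2 := fun x => by
    have h1 : ∑ i, d i * x i ^ 2 ≤ L * ‖x‖ ^ 2 := by
      rw [EuclideanSpace.real_norm_sq_eq, Finset.mul_sum]
      exact Finset.sum_le_sum fun i _ => mul_le_mul_of_nonneg_right (hdL i) (sq_nonneg _)
    have h2 : 0 ≤ ∑ i, d i * x i ^ 2 :=
      Finset.sum_nonneg fun i _ => mul_nonneg (hd0 i) (sq_nonneg _)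
    have h3 : |‖Matrix.toEuclideanLin R x‖ ^ 2 - ∑ i, d i * x i ^ 2| ≤ L * ‖x‖ ^ 2 := by
      rw [abs_le]
      constructor <;> linarith [hR x, sq_nonneg ‖Matrix.toEuclideanLin R x‖]
    rw [hform, abs_mul, abs_neg, abs_of_nonneg (by positivity)]
    calc 2 * l * s * |‖Matrix.toEuclideanLin R x‖ ^ 2 - ∑ i, d i * x i ^ 2|
        ≤ 2 * l * s * (L * ‖x‖ ^ 2) := by gcongr
      _ = (8 * l * s * L) / 4 * ‖x‖ ^ 2 := by ring
      _ ≤ 1 / 4 * ‖x‖ ^ 2 := by gcongr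
  -- No diagonal means no first-order term in the Gaussian bound: the off-diagonal part contributes
  -- only at order `l²`.
  have htr : S.trace = 0 := by
    simp [S, Matrix.trace, hWd]
  have hdiag : ∫⁻ x : ι → ℝ, ENNReal.ofReal (Real.exp (2 * (-(l * ∑ i, d i * x i ^ 2))))
      ∂Measure.pi μ ≤ ENNReal.ofReal (Real.exp (2 * (-(l * T) + l ^ 2 * q * L * T))) := by
    have h1 : ∀ x : ι → ℝ, ENNReal.ofReal (Real.exp (2 * (-(l * ∑ i, d i * x i ^ 2)))) =
        ∏ i, ENNReal.ofReal (Real.exp (-(2 * l * d i * x i ^ 2))) := fun x => by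
      rw [← ofReal_exp_sum, Finset.mul_sum, ← Finset.sum_neg_distrib, Finset.mul_sum]
      congr 3
      funext i
      ring
    simp_rw [h1]
    rw [lintegral_prod_pi μ (f := fun i t => ENNReal.ofReal (Real.exp (-(2 * l * d i * t ^ 2))))
      (fun i => by fun_prop)]
    refine (Finset.prod_le_prod' fun i _ => hvar i _ (mul_nonneg (by positivity) (hd0 i))).trans ?_
    rw [← ofReal_exp_sum]
    refine ENNReal.ofReal_le_ofReal (Real.exp_le_exp.2 ?_)
    simp only [T, Finset.mul_sum, ← Finset.sum_neg_distrib, ← Finset.sum_add_distrib]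
    refine Finset.sum_le_sum fun i _ => ?_
    have : d i * d i ≤ L * d i := mul_le_mul_of_nonneg_right (hdL i) (hd0 i)
    have : l ^ 2 * q * (d i * d i) ≤ l ^ 2 * q * (L * d i) := by gcongr
    nlinarith
  have hoff : ∫⁻ x : ι → ℝ, ENNReal.ofReal (Real.exp (2 * (-(l *
      (‖Matrix.toEuclideanLin R (WithLp.toLp 2 x)‖ ^ 2 - ∑ i, d i * x i ^ 2)))))
      ∂Measure.pi μ ≤ ENNReal.ofReal (Real.exp (2 * (8 * l ^ 2 * s ^ 2 * L * T))) := by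
    -- The factor `s⁻¹` cancels the `s` contained in `S`; the latter is there so that rescaling to
    -- Gaussians of variance `s` produces exactly the form `S`.
    let f : (ι → ℝ) → ENNReal := fun x => ENNReal.ofReal (Real.exp (s⁻¹ *
      inner ℝ (WithLp.toLp 2 x) (Matrix.toEuclideanLin S (WithLp.toLp 2 x))))
    have hf : Measurable f := by
      have : Continuous (Matrix.toEuclideanLin S) :=
        (Matrix.toEuclideanLin S).continuous_of_finiteDimensional
      fun_prop
    have hSii : ∀ i, S i i = 0 := fun i => by simp [S, hWd]
    -- Centred Gaussians of variance `s` attain equality in the bound `hsub`.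
    obtain ⟨ν, hνdef⟩ : ∃ ν : ι → Measure ℝ, ν = fun _ => (gaussianReal 0 1).map (√s * ·) :=
      ⟨_, rfl⟩
    have hν : ∀ i, IsProbabilityMeasure (ν i) := fun i => by
      rw [hνdef]; exact Measure.isProbabilityMeasure_map (by fun_prop)
    -- As `S i i = 0`, the exponent is affine in the coordinate `t`, so only exponential moments of
    -- linear functions are compared.
    have hupd : ∀ i x t, f (Function.update x i t) =
        f (Function.update x i 0) * ENNReal.ofReal (Real.exp (s⁻¹ *
          (inner ℝ (WithLp.toLp 2 (Function.update x i 0))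
            (Matrix.toEuclideanLin S (EuclideanSpace.single i 1)) +
          inner ℝ (EuclideanSpace.single i 1)
            (Matrix.toEuclideanLin S (WithLp.toLp 2 (Function.update x i 0)))) * t)) :=
      fun i x t => by
        have h1 : WithLp.toLp 2 (Function.update x i t) =
            WithLp.toLp 2 (Function.update x i 0) + t • EuclideanSpace.single i (1 : ℝ) := by
          ext j
          rcases eq_or_ne j i with rfl | hj <;> simp [*]
        have h2 : inner ℝ (EuclideanSpace.single i (1 : ℝ))
            (Matrix.toEuclideanLin S (EuclideanSpace.single i 1)) = 0 := by
          simp [EuclideanSpace.inner_single_left, toEuclideanLin_single_apply, hSii]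
        simp only [f]
        rw [← ofReal_exp_add, h1]
        simp only [map_add, map_smul, inner_add_left, inner_add_right, inner_smul_left,
          inner_smul_right, h2, conj_trivial]
        congr 2
        ring
    have hνt : ∀ i t, ∫⁻ x, ENNReal.ofReal (Real.exp (t * x)) ∂ν i =
        ENNReal.ofReal (Real.exp (s * t ^ 2 / 2)) := fun i t => by
      rw [hνdef, lintegral_map (by fun_prop) (by fun_prop)]
      simp_rw [← mul_assoc]
      rw [lintegral_exp_mul_gaussianReal, mul_pow, Real.sq_sqrt hs.le, mul_comm]
    have hcmp := lintegral_pi_le_of_update_le (μ := μ) (ν := ν) hf fun i x => by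
      rw [lintegral_congr (hupd i x), lintegral_congr (hupd i x),
        lintegral_const_mul _ (by fun_prop), lintegral_const_mul _ (by fun_prop), hνt]
      gcongr
      exact hsub i _
    have hleft : ∀ x : ι → ℝ, ENNReal.ofReal (Real.exp (2 * (-(l *
        (‖Matrix.toEuclideanLin R (WithLp.toLp 2 x)‖ ^ 2 - ∑ i, d i * x i ^ 2))))) = f x :=
      fun x => by
        simp only [f, hform]
        congr 2
        field_simp
    simp_rw [hleft]
    refine hcmp.trans ?_
    have hpi : Measure.pi ν = (Measure.pi fun _ : ι => gaussianReal 0 1).map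
        (fun x i => √s * x i) := by
      subst hνdef
      exact (Measure.pi_map_pi (fun _ => by fun_prop)).symm
    rw [hpi, lintegral_map hf (by fun_prop)]
    have hscale : ∀ x : ι → ℝ, f (fun i => √s * x i) = (fun h => ENNReal.ofReal (Real.exp
        (inner ℝ h (Matrix.toEuclideanLin S h)))) (WithLp.toLp 2 x) := fun x => by
      have : WithLp.toLp 2 (fun i => √s * x i) = √s • WithLp.toLp 2 x := by ext; simp
      simp only [f]
      rw [this, map_smul, inner_smul_left, inner_smul_right, conj_trivial, ← mul_assoc √s,
        Real.mul_self_sqrt hs.le, inv_mul_cancel_left₀ hs.ne']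
    simp_rw [hscale]
    have hSc : Continuous (Matrix.toEuclideanLin S) :=
      (Matrix.toEuclideanLin S).continuous_of_finiteDimensional
    rw [← lintegral_map (f := fun h => ENNReal.ofReal (Real.exp
      (inner ℝ h (Matrix.toEuclideanLin S h)))) (by fun_prop) (by fun_prop), map_pi_eq_stdGaussian]
    refine (lintegral_exp_quadratic_stdGaussian hS hSb).trans ?_
    refine ENNReal.ofReal_le_ofReal (Real.exp_le_exp.2 ?_)
    rw [htr]
    nlinarith
  have := lintegral_exp_add_le (by fun_prop) (by fun_prop) hdiag hoff
  refine le_trans (le_of_eq ?_) (this.trans (le_of_eq ?_))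
  · refine lintegral_congr fun x => ?_
    congr 2
    ring
  · congr 2
    simp only [T, d]
    ring

/-! ### Sub-Gaussian random variables -/

section SubGaussian

variable {Ω : Type*} [MeasurableSpace Ω] {P : Measure Ω}

/-- Doubling `M` makes the inequality strict, so an admissible `t` below `2M` exists without knowing
that the infimum is attained. -/
theorem lintegral_exp_sq_le_two_of_psi2Norm_le {U : Ω → ℝ} {M : ℝ} (hM : 0 < M)
    (h : psi2Norm U P ≤ ENNReal.ofReal M) :
    ∫⁻ ω, ENNReal.ofReal (Real.exp (U ω ^ 2 / (2 * M) ^ 2)) ∂P ≤ 2 := by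
  have hlt : psi2Norm U P < ENNReal.ofReal (2 * M) :=
    h.trans_lt ((ENNReal.ofReal_lt_ofReal_iff (by positivity)).2 (by linarith))
  simp only [psi2Norm, iInf_lt_iff] at hlt
  obtain ⟨t, ⟨ht, hint⟩, hlt⟩ := hlt
  have htM : t ≤ 2 * M := ((ENNReal.ofReal_lt_ofReal_iff (by positivity)).1 hlt).le
  refine le_trans (lintegral_mono fun ω => ?_) hint
  gcongr

/-- `𝔼 exp(U² / L²) ≤ 2`. -/
structure SubGaussianBound (U : Ω → ℝ) (L : ℝ) (P : Measure Ω) : Prop where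
  pos : 0 < L
  aemeasurable : AEMeasurable U P
  lintegral_le : ∫⁻ ω, ENNReal.ofReal (Real.exp (U ω ^ 2 / L ^ 2)) ∂P ≤ 2

variable {U : Ω → ℝ} {L : ℝ}

namespace SubGaussianBound

theorem integrable_exp (h : SubGaussianBound U L P) :
    Integrable (fun ω => Real.exp (U ω ^ 2 / L ^ 2)) P := by
  have := h.aemeasurable
  refine (lintegral_ofReal_ne_top_iff_integrable (by fun_prop)
    (Filter.Eventually.of_forall fun _ => (Real.exp_pos _).le)).1 ?_
  exact (h.lintegral_le.trans_lt (by simp)).ne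

theorem integral_exp_le (h : SubGaussianBound U L P) :
    ∫ ω, Real.exp (U ω ^ 2 / L ^ 2) ∂P ≤ 2 := by
  rw [integral_eq_lintegral_of_nonneg_ae (Filter.Eventually.of_forall fun _ => (Real.exp_pos _).le)
    h.integrable_exp.aestronglyMeasurable]
  exact ENNReal.toReal_le_of_le_ofReal (by norm_num) (by simpa using h.lintegral_le)

theorem congr {V : Ω → ℝ} (h : SubGaussianBound U L P) (hUV : U =ᵐ[P] V) :
    SubGaussianBound V L P where
  pos := h.pos
  aemeasurable := h.aemeasurable.congr hUV
  lintegral_le := by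
    refine le_trans (le_of_eq (lintegral_congr_ae ?_)) h.lintegral_le
    filter_upwards [hUV] with ω hω
    rw [hω]

theorem sq_le (h : SubGaussianBound U L P) (ω : Ω) :
    U ω ^ 2 ≤ L ^ 2 * Real.exp (U ω ^ 2 / L ^ 2) := by
  have := h.pos
  have h1 := Real.add_one_le_exp (U ω ^ 2 / L ^ 2)
  rw [← div_le_iff₀' (by positivity)]
  linarith

theorem pow_four_le (h : SubGaussianBound U L P) (ω : Ω) :
    U ω ^ 4 ≤ 2 * L ^ 4 * Real.exp (U ω ^ 2 / L ^ 2) := by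
  have := h.pos
  have h1 := Real.quadratic_le_exp_of_nonneg (x := U ω ^ 2 / L ^ 2) (by positivity)
  have h2 : (U ω ^ 2 / L ^ 2) ^ 2 / 2 ≤ Real.exp (U ω ^ 2 / L ^ 2) := by
    have : 0 ≤ U ω ^ 2 / L ^ 2 := by positivity
    linarith
  calc U ω ^ 4 = 2 * L ^ 4 * ((U ω ^ 2 / L ^ 2) ^ 2 / 2) := by field_simp
    _ ≤ _ := by gcongr

theorem memLp_two (h : SubGaussianBound U L P) : MemLp U 2 P := by
  rw [memLp_two_iff_integrable_sq h.aemeasurable.aestronglyMeasurable]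
  refine (h.integrable_exp.const_mul (L ^ 2)).mono'
    (h.aemeasurable.pow_const 2).aestronglyMeasurable
    (Filter.Eventually.of_forall fun ω => ?_)
  rw [Real.norm_of_nonneg (sq_nonneg _)]
  exact h.sq_le ω

theorem integrable_pow_four (h : SubGaussianBound U L P) : Integrable (fun ω => U ω ^ 4) P := by
  refine (h.integrable_exp.const_mul (2 * L ^ 4)).mono'
    (h.aemeasurable.pow_const 4).aestronglyMeasurable (Filter.Eventually.of_forall fun ω => ?_)
  rw [Real.norm_of_nonneg (by positivity)]
  exact h.pow_four_le ω

theorem integral_pow_four_le (h : SubGaussianBound U L P) : ∫ ω, U ω ^ 4 ∂P ≤ 4 * L ^ 4 := by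
  have := h.pos
  calc ∫ ω, U ω ^ 4 ∂P ≤ ∫ ω, 2 * L ^ 4 * Real.exp (U ω ^ 2 / L ^ 2) ∂P :=
        integral_mono h.integrable_pow_four (h.integrable_exp.const_mul _) h.pow_four_le
    _ = 2 * L ^ 4 * ∫ ω, Real.exp (U ω ^ 2 / L ^ 2) ∂P := integral_const_mul _ _
    _ ≤ 2 * L ^ 4 * 2 := by gcongr; exact h.integral_exp_le
    _ = _ := by ring

theorem integrable_exp_mul_sq (h : SubGaussianBound U L P) {θ : ℝ} (h1 : θ ≤ 1) :
    Integrable (fun ω => Real.exp (θ * (U ω ^ 2 / L ^ 2))) P := by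
  have := h.aemeasurable
  refine h.integrable_exp.mono' (by fun_prop) (Filter.Eventually.of_forall fun ω => ?_)
  rw [Real.norm_of_nonneg (Real.exp_pos _).le]
  refine Real.exp_le_exp.2 ?_
  have : 0 ≤ U ω ^ 2 / L ^ 2 := by positivity
  nlinarith

variable [IsProbabilityMeasure P]

/-- Convexity of `exp` between `a - log 2` and `0` gives `𝔼 Y^θ ≤ 2^θ` for `Y = exp(U²/L²)`, a bound
that tends to `1` with `θ → 0`. -/
theorem integral_exp_mul_sq_le (h : SubGaussianBound U L P) {θ : ℝ} (h0 : 0 ≤ θ) (h1 : θ ≤ 1) :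
    ∫ ω, Real.exp (θ * (U ω ^ 2 / L ^ 2)) ∂P ≤ Real.exp (θ * Real.log 2) := by
  have hpt : ∀ a : ℝ, Real.exp (θ * a) ≤
      Real.exp (θ * Real.log 2) * (θ / 2) * Real.exp a +
        Real.exp (θ * Real.log 2) * (1 - θ) := fun a => by
    have hc := convexOn_exp.2 (Set.mem_univ (a - Real.log 2)) (Set.mem_univ 0) h0
      (sub_nonneg.2 h1) (by ring)
    simp only [smul_eq_mul, mul_zero, add_zero, Real.exp_zero, mul_one] at hc
    rw [Real.exp_sub, Real.exp_log (by norm_num)] at hc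
    calc Real.exp (θ * a) = Real.exp (θ * Real.log 2) * Real.exp (θ * (a - Real.log 2)) := by
          rw [← Real.exp_add]; congr 1; ring
      _ ≤ Real.exp (θ * Real.log 2) * (θ * (Real.exp a / 2) + (1 - θ)) := by gcongr
      _ = _ := by ring
  calc ∫ ω, Real.exp (θ * (U ω ^ 2 / L ^ 2)) ∂P
      ≤ ∫ ω, (Real.exp (θ * Real.log 2) * (θ / 2) * Real.exp (U ω ^ 2 / L ^ 2) +
        Real.exp (θ * Real.log 2) * (1 - θ)) ∂P :=
        integral_mono (h.integrable_exp_mul_sq h1)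
          ((h.integrable_exp.const_mul _).add (integrable_const _)) fun ω => hpt _
    _ = Real.exp (θ * Real.log 2) * (θ / 2) * ∫ ω, Real.exp (U ω ^ 2 / L ^ 2) ∂P +
        Real.exp (θ * Real.log 2) * (1 - θ) := by
        rw [integral_add (h.integrable_exp.const_mul _) (integrable_const _), integral_const_mul]
        simp
    _ ≤ Real.exp (θ * Real.log 2) * (θ / 2) * 2 + Real.exp (θ * Real.log 2) * (1 - θ) := by
        gcongr; exact h.integral_exp_le
    _ = _ := by ring

/-- Two regimes in `θ = t²L²`. For `θ ≤ 1` the inequality `exp x ≤ x + exp(x²)` uses the zero mean;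
for `θ ≥ 1` the inequality `tU ≤ (t²L² + U²/L²)/2` suffices. -/
theorem lintegral_exp_mul_le (h : SubGaussianBound U L P) (hmean : ∫ ω, U ω ∂P = 0) (t : ℝ) :
    ∫⁻ ω, ENNReal.ofReal (Real.exp (t * U ω)) ∂P ≤
      ENNReal.ofReal (Real.exp (2 * L ^ 2 * t ^ 2 / 2)) := by
  have hL := h.pos
  have hU := h.aemeasurable
  have hUi : Integrable U P := h.memLp_two.integrable (by norm_num)
  have hlog : Real.log 2 ≤ 1 := by linarith [Real.log_two_lt_d9]
  have hlog0 : 0 ≤ Real.log 2 := Real.log_nonneg (by norm_num)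
  set θ : ℝ := t ^ 2 * L ^ 2
  have hθ : 0 ≤ θ := by positivity
  have key : ∀ g : Ω → ℝ, Integrable g P → (∀ ω, Real.exp (t * U ω) ≤ g ω) →
      ∫ ω, g ω ∂P ≤ Real.exp θ → ∫⁻ ω, ENNReal.ofReal (Real.exp (t * U ω)) ∂P ≤
      ENNReal.ofReal (Real.exp (2 * L ^ 2 * t ^ 2 / 2)) := fun g hg hle hint => by
    calc _ ≤ ∫⁻ ω, ENNReal.ofReal (g ω) ∂P :=
          lintegral_mono fun ω => ENNReal.ofReal_le_ofReal (hle ω)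
      _ = ENNReal.ofReal (∫ ω, g ω ∂P) := (ofReal_integral_eq_lintegral_ofReal hg
          (Filter.Eventually.of_forall fun ω => (Real.exp_pos _).le.trans (hle ω))).symm
      _ ≤ _ := ENNReal.ofReal_le_ofReal (hint.trans (le_of_eq (by congr 1; simp only [θ]; ring)))
  rcases le_total θ 1 with hθ1 | hθ1
  · refine key (fun ω => t * U ω + Real.exp (θ * (U ω ^ 2 / L ^ 2)))
      ((hUi.const_mul t).add (h.integrable_exp_mul_sq hθ1)) (fun ω => ?_) ?_
    · refine (exp_le_add_exp_sq _).trans (le_of_eq ?_)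
      congr 2
      simp only [θ]
      field_simp
    · rw [integral_add (hUi.const_mul t) (h.integrable_exp_mul_sq hθ1), integral_const_mul, hmean,
        mul_zero, zero_add]
      refine (h.integral_exp_mul_sq_le hθ hθ1).trans (Real.exp_le_exp.2 ?_)
      nlinarith
  · refine key (fun ω => Real.exp (θ / 2) * Real.exp (1 / 2 * (U ω ^ 2 / L ^ 2)))
      ((h.integrable_exp_mul_sq (by norm_num)).const_mul _) (fun ω => ?_) ?_
    · rw [← Real.exp_add]
      refine Real.exp_le_exp.2 ?_
      have h1 : t * U ω = (t * L) * (U ω / L) := by field_simp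
      have h2 : θ / 2 + 1 / 2 * (U ω ^ 2 / L ^ 2) = ((t * L) ^ 2 + (U ω / L) ^ 2) / 2 := by
        simp only [θ]
        rw [div_pow]
        ring
      rw [h1, h2]
      nlinarith [sq_nonneg (t * L - U ω / L)]
    · rw [integral_const_mul]
      calc _ ≤ Real.exp (θ / 2) * Real.exp (1 / 2 * Real.log 2) := by
            gcongr
            exact h.integral_exp_mul_sq_le (by norm_num) (by norm_num)
        _ = Real.exp (θ / 2 + 1 / 2 * Real.log 2) := (Real.exp_add _ _).symm
        _ ≤ _ := Real.exp_le_exp.2 (by linarith)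

/-- For a nonnegative variable the lower tail needs only two moments: expand `exp(-aU²)` to second
order and use `𝔼U⁴ ≤ 4L⁴`. -/
theorem lintegral_exp_neg_mul_sq_le (h : SubGaussianBound U L P) (hvar : ∫ ω, U ω ^ 2 ∂P = 1)
    {a : ℝ} (ha : 0 ≤ a) :
    ∫⁻ ω, ENNReal.ofReal (Real.exp (-(a * U ω ^ 2))) ∂P ≤
      ENNReal.ofReal (Real.exp (-a + 4 * L ^ 4 * a ^ 2 / 2)) := by
  have hsq := h.memLp_two.integrable_sq
  have h4 := h.integrable_pow_four
  have hint : Integrable (fun ω => 1 - a * U ω ^ 2 + a ^ 2 / 2 * U ω ^ 4) P :=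
    ((integrable_const 1).sub (hsq.const_mul a)).add (h4.const_mul _)
  have hle : ∀ ω, Real.exp (-(a * U ω ^ 2)) ≤ 1 - a * U ω ^ 2 + a ^ 2 / 2 * U ω ^ 4 := fun ω =>
    (exp_neg_le_quadratic (by positivity)).trans (le_of_eq (by ring))
  calc _ ≤ ∫⁻ ω, ENNReal.ofReal (1 - a * U ω ^ 2 + a ^ 2 / 2 * U ω ^ 4) ∂P :=
        lintegral_mono fun ω => ENNReal.ofReal_le_ofReal (hle ω)
    _ = ENNReal.ofReal (∫ ω, (1 - a * U ω ^ 2 + a ^ 2 / 2 * U ω ^ 4) ∂P) :=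
        (ofReal_integral_eq_lintegral_ofReal hint
          (Filter.Eventually.of_forall fun ω => (Real.exp_pos _).le.trans (hle ω))).symm
    _ ≤ _ := by
      refine ENNReal.ofReal_le_ofReal ?_
      rw [integral_add (f := fun ω => 1 - a * U ω ^ 2)
        ((integrable_const 1).sub (hsq.const_mul a)) (h4.const_mul _),
        integral_sub (integrable_const 1) (hsq.const_mul a), integral_const_mul,
        integral_const_mul, hvar]
      simp only [integral_const, probReal_univ, smul_eq_mul, mul_one]
      have h1 := mul_le_mul_of_nonneg_left h.integral_pow_four_le
        (show 0 ≤ a ^ 2 / 2 by positivity)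
      have h2 := Real.add_one_le_exp (-a + 4 * L ^ 4 * a ^ 2 / 2)
      linarith

end SubGaussianBound

/-! ### Chernoff bounds -/

theorem measure_ge_le_of_lintegral_exp_le {φ : Ω → ℝ} (hφ : AEMeasurable φ P) {a b : ℝ}
    (h : ∫⁻ ω, ENNReal.ofReal (Real.exp (φ ω)) ∂P ≤ ENNReal.ofReal (Real.exp a)) :
    P {ω | b ≤ φ ω} ≤ ENNReal.ofReal (Real.exp (a - b)) := by
  have h1 := mul_meas_ge_le_lintegral₀ (μ := P)
    (f := fun ω => ENNReal.ofReal (Real.exp (φ ω))) (by fun_prop) (ENNReal.ofReal (Real.exp b))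
  have h2 : {ω | ENNReal.ofReal (Real.exp b) ≤ ENNReal.ofReal (Real.exp (φ ω))} =
      {ω | b ≤ φ ω} := by
    ext ω
    simp [ENNReal.ofReal_le_ofReal_iff (Real.exp_pos _).le]
  rw [h2] at h1
  have h3 : ENNReal.ofReal (Real.exp (a - b)) =
      ENNReal.ofReal (Real.exp a) / ENNReal.ofReal (Real.exp b) := by
    rw [Real.exp_sub, ENNReal.ofReal_div_of_pos (Real.exp_pos _)]
  rw [h3, ENNReal.le_div_iff_mul_le (by simp [Real.exp_pos]) (by simp), mul_comm]
  exact h1.trans h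

end SubGaussian

/-! ### Eigenvalues, square roots and norms of symmetric matrices -/

section Matrices

variable {d : ℕ} {Q : Matrix (Fin d) (Fin d) ℝ}

theorem inner_toEuclideanLin_eq_sum_eigenvalues (hQ : Q.IsHermitian)
    (x : EuclideanSpace ℝ (Fin d)) : inner ℝ x (Matrix.toEuclideanLin Q x) =
      ∑ i, hQ.eigenvalues i * inner ℝ (hQ.eigenvectorBasis i) x ^ 2 := by
  have hQb : ∀ k, Matrix.toEuclideanLin Q (hQ.eigenvectorBasis k) =
      hQ.eigenvalues k • hQ.eigenvectorBasis k := fun k => by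
    have := hQ.mulVec_eigenvectorBasis k
    ext i
    simpa [Matrix.toEuclideanLin] using congrFun this i
  rw [← hQ.eigenvectorBasis.sum_inner_mul_inner]
  refine Finset.sum_congr rfl fun i _ => ?_
  have h1 : inner ℝ (hQ.eigenvectorBasis i) (Matrix.toEuclideanLin Q x) =
      hQ.eigenvalues i * inner ℝ (hQ.eigenvectorBasis i) x := by
    have hT : Q.transpose = Q := by
      rw [← Matrix.conjTranspose_eq_transpose_of_trivial]; exact hQ
    have h2 := inner_toEuclideanLin_transpose Q (hQ.eigenvectorBasis i) x
    rw [hT] at h2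
    rw [h2, hQb, real_inner_smul_left]
  rw [h1, real_inner_comm]
  ring

/-- The eigenvalues are listed in decreasing order from index `0`, so the `d`-th largest, at index
`d - 1`, is the smallest. -/
theorem kthEigenvalue_eq (hd : 1 ≤ d) (hQ : Q.IsHermitian) :
    (∃ i, kthEigenvalue d Q = hQ.eigenvalues i) ∧
      ∀ i, kthEigenvalue d Q ≤ hQ.eigenvalues i := by
  have h : Q.IsHermitian ∧ 1 ≤ d ∧ d ≤ d := ⟨hQ, hd, le_rfl⟩
  have hk : kthEigenvalue d Q =
      hQ.eigenvalues₀ ⟨d - 1, by rw [Fintype.card_fin]; omega⟩ := by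
    rw [kthEigenvalue, dif_pos h]
  let e : Fin (Fintype.card (Fin d)) ≃ Fin d := Fintype.equivOfCardEq (Fintype.card_fin _)
  refine ⟨⟨e ⟨d - 1, by rw [Fintype.card_fin]; omega⟩, ?_⟩, fun i => ?_⟩
  · rw [hk, Matrix.IsHermitian.eigenvalues, Equiv.symm_apply_apply]
  · rw [hk, Matrix.IsHermitian.eigenvalues]
    refine hQ.eigenvalues₀_antitone ?_
    have := (e.symm i).2
    rw [Fin.le_def]
    simp only [Fintype.card_fin] at this
    change ((e.symm i) : ℕ) ≤ d - 1
    omega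

theorem kthEigenvalue_mul_norm_sq_le (hd : 1 ≤ d) (hQ : Q.IsHermitian)
    (x : EuclideanSpace ℝ (Fin d)) :
    kthEigenvalue d Q * ‖x‖ ^ 2 ≤ inner ℝ x (Matrix.toEuclideanLin Q x) := by
  rw [inner_toEuclideanLin_eq_sum_eigenvalues hQ, ← hQ.eigenvectorBasis.sum_sq_inner_right,
    Finset.mul_sum]
  exact Finset.sum_le_sum fun i _ =>
    mul_le_mul_of_nonneg_right ((kthEigenvalue_eq hd hQ).2 i) (sq_nonneg _)

theorem kthEigenvalue_pos (hd : 1 ≤ d) (hQ : Q.PosDef) : 0 < kthEigenvalue d Q := by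
  obtain ⟨i, hi⟩ := (kthEigenvalue_eq hd hQ.1).1
  rw [hi]
  exact hQ.eigenvalues_pos i

theorem psdSqrt_transpose (Q : Matrix (Fin d) (Fin d) ℝ) : (psdSqrt Q).transpose = psdSqrt Q := by
  open scoped MatrixOrder in
  have h : (psdSqrt Q).IsHermitian := (Matrix.nonneg_iff_posSemidef.1 (CFC.sqrt_nonneg Q)).1
  rw [← Matrix.conjTranspose_eq_transpose_of_trivial]
  exact h

theorem psdSqrt_mul_self (hQ : Q.PosSemidef) : psdSqrt Q * psdSqrt Q = Q := by
  open scoped MatrixOrder in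
  exact CFC.sqrt_mul_sqrt_self Q hQ.nonneg

theorem quadForm_eq_norm_sq (hQ : Q.PosSemidef) (x : EuclideanSpace ℝ (Fin d)) :
    quadForm Q x = ‖Matrix.toEuclideanLin (psdSqrt Q) x‖ ^ 2 := by
  conv_lhs => rw [quadForm, ← psdSqrt_mul_self hQ, toEuclideanLin_mul_apply]
  rw [← real_inner_self_eq_norm_sq, ← inner_toEuclideanLin_transpose, psdSqrt_transpose]

theorem norm_toEuclideanLin_le_opNorm (Q : Matrix (Fin d) (Fin d) ℝ)
    (x : EuclideanSpace ℝ (Fin d)) : ‖Matrix.toEuclideanLin Q x‖ ≤ opNorm Q * ‖x‖ :=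
  (Matrix.toEuclideanCLM (n := Fin d) (𝕜 := ℝ) Q).le_opNorm x

theorem norm_sq_psdSqrt_le (hQ : Q.PosSemidef) (x : EuclideanSpace ℝ (Fin d)) :
    ‖Matrix.toEuclideanLin (psdSqrt Q) x‖ ^ 2 ≤ opNorm Q * ‖x‖ ^ 2 := by
  rw [← quadForm_eq_norm_sq hQ, quadForm]
  calc _ ≤ ‖x‖ * ‖Matrix.toEuclideanLin Q x‖ := real_inner_le_norm _ _
    _ ≤ ‖x‖ * (opNorm Q * ‖x‖) := by gcongr; exact norm_toEuclideanLin_le_opNorm Q x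
    _ = _ := by ring

theorem sum_sq_psdSqrt (hQ : Q.PosSemidef) : ∑ i, ∑ k, psdSqrt Q k i ^ 2 = Q.trace := by
  conv_rhs => rw [← psdSqrt_mul_self hQ]
  simp only [Matrix.trace, Matrix.diag, Matrix.mul_apply]
  refine Finset.sum_congr rfl fun i _ => Finset.sum_congr rfl fun k _ => ?_
  conv_rhs => rw [← psdSqrt_transpose Q, Matrix.transpose_apply, psdSqrt_transpose Q]
  ring

theorem mulVec_injective_of_rank_eq {m : Type*} [Fintype m] {A : Matrix m (Fin d) ℝ}
    (hA : A.rank = d) : Function.Injective A.mulVec := by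
  have h : Module.finrank ℝ (LinearMap.ker A.mulVecLin) = 0 := by
    have := A.mulVecLin.finrank_range_add_finrank_ker
    rw [Module.finrank_fin_fun] at this
    change A.rank + _ = d at this
    omega
  have h2 : LinearMap.ker A.mulVecLin = ⊥ := Submodule.finrank_eq_zero.1 h
  exact LinearMap.ker_eq_bot.1 h2

theorem posDef_transpose_mul_self {m : Type*} [Fintype m] {A : Matrix m (Fin d) ℝ}
    (hA : A.rank = d) : (A.transpose * A).PosDef := by
  rw [← Matrix.conjTranspose_eq_transpose_of_trivial]
  exact Matrix.PosDef.conjTranspose_mul_self A (mulVec_injective_of_rank_eq hA)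

/-- Invertibility of `Σ_Z^{1/2}` lets a net of the sphere be pulled back to the ellipsoid
`‖Σ_Z^{1/2}x‖ = 1`. -/
theorem psdSqrt_surjective (hQ : Q.PosSemidef) (hr : Q.rank = d) :
    Function.Surjective (Matrix.toEuclideanLin (psdSqrt Q)) := by
  refine LinearMap.injective_iff_surjective.1 ?_
  rw [← LinearMap.ker_eq_bot, LinearMap.ker_eq_bot']
  intro x hx
  have h1 : Matrix.toEuclideanLin Q x = 0 := by
    rw [← psdSqrt_mul_self hQ, toEuclideanLin_mul_apply, hx, map_zero]
  have h2 : Q.mulVec x.ofLp = Q.mulVec 0 := by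
    rw [Matrix.mulVec_zero]
    ext i
    have := congrFun (congrArg WithLp.ofLp h1) i
    simpa [Matrix.toEuclideanLin] using this
  ext i
  exact congrFun (mulVec_injective_of_rank_eq hr h2) i

end Matrices

/-! ### Covariance matrices -/

section Covariance

variable {Ω : Type*} [MeasurableSpace Ω] {P : Measure Ω} {d : ℕ}
  {V : Ω → EuclideanSpace ℝ (Fin d)}

theorem memLp_inner (hV : ∀ i, MemLp (fun ω => V ω i) 2 P) (x : EuclideanSpace ℝ (Fin d)) :
    MemLp (fun ω => inner ℝ (V ω) x) 2 P := by
  simp only [PiLp.inner_apply, RCLike.inner_apply, conj_trivial]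
  exact memLp_finsetSum _ fun i _ => (hV i).const_mul (x i)

variable [IsProbabilityMeasure P]

theorem integral_inner_eq_zero (hV : ∀ i, MemLp (fun ω => V ω i) 2 P)
    (hmean : ∀ i, ∫ ω, V ω i ∂P = 0) (x : EuclideanSpace ℝ (Fin d)) :
    ∫ ω, inner ℝ (V ω) x ∂P = 0 := by
  simp only [PiLp.inner_apply, RCLike.inner_apply, conj_trivial]
  rw [integral_finsetSum _ fun i _ => ((hV i).integrable (by norm_num)).const_mul (x i)]
  simp [integral_const_mul, hmean]

theorem variance_inner (hV : ∀ i, MemLp (fun ω => V ω i) 2 P) (x : EuclideanSpace ℝ (Fin d)) :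
    Var[fun ω => inner ℝ (V ω) x; P] = quadForm (covMatrix V P) x := by
  have hx : AEMeasurable (fun ω => inner ℝ (V ω) x) P :=
    (memLp_inner hV x).aestronglyMeasurable.aemeasurable
  rw [← covariance_self hx]
  simp only [PiLp.inner_apply, RCLike.inner_apply, conj_trivial]
  rw [covariance_fun_sum_fun_sum (X := fun i ω => x i * V ω i) (Y := fun i ω => x i * V ω i)
    (fun i => (hV i).const_mul (x i)) (fun i => (hV i).const_mul (x i))]
  simp only [covariance_const_mul_left, covariance_const_mul_right, quadForm, PiLp.inner_apply,
    RCLike.inner_apply, conj_trivial]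
  refine Finset.sum_congr rfl fun i _ => ?_
  simp only [Matrix.toLpLin_apply, Matrix.mulVec, dotProduct, covMatrix, Matrix.of_apply,
    Finset.sum_mul]
  refine Finset.sum_congr rfl fun j _ => ?_
  ring

theorem covMatrix_posSemidef (hV : ∀ i, MemLp (fun ω => V ω i) 2 P) :
    (covMatrix V P).PosSemidef := by
  refine Matrix.PosSemidef.of_dotProduct_mulVec_nonneg ?_ fun x => ?_
  · ext i j
    simp [covMatrix, covariance_comm]
  · have h := variance_inner hV (WithLp.toLp 2 x)
    have h0 := variance_nonneg (fun ω => inner ℝ (V ω) (WithLp.toLp 2 x)) P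
    rw [h, quadForm] at h0
    simpa [PiLp.inner_apply, Matrix.toEuclideanLin, dotProduct, mul_comm] using h0

end Covariance

/-! ### Consequences of the sub-Gaussian assumption -/

section Model

variable {Ω : Type*} [MeasurableSpace Ω] {P : Measure Ω} {p K : ℕ}
  {Z : Ω → EuclideanSpace ℝ (Fin K)} {E : Ω → EuclideanSpace ℝ (Fin p)} {ε : Ω → ℝ} {M : ℝ}

theorem memLp_coord_of_ae_eq {d d' : ℕ} {V : Ω → EuclideanSpace ℝ (Fin d)}
    {V' : Ω → EuclideanSpace ℝ (Fin d')} {B : Matrix (Fin d) (Fin d') ℝ}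
    (h : ∀ᵐ ω ∂P, V ω = Matrix.toEuclideanLin B (V' ω))
    (hV' : ∀ i, MemLp (fun ω => V' ω i) 2 P) (i : Fin d) : MemLp (fun ω => V ω i) 2 P := by
  have h1 : MemLp (fun ω => ∑ j, B i j * V' ω j) 2 P :=
    memLp_finsetSum _ fun j _ => (hV' j).const_mul (B i j)
  refine h1.ae_eq ?_
  filter_upwards [h] with ω hω
  rw [hω]
  simp [Matrix.toEuclideanLin, Matrix.mulVec, dotProduct]

namespace IsSubGaussianModel

/-- The standardized noise: independent entries, each with a sub-Gaussian bound. -/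
theorem exists_noise (h : IsSubGaussianModel M P Z E ε) (hM : 0 < M) :
    ∃ E' : Ω → EuclideanSpace ℝ (Fin p), Measurable E' ∧
      (∀ᵐ ω ∂P, E ω = Matrix.toEuclideanLin (psdSqrt (covMatrix E P)) (E' ω)) ∧
      iIndepFun (fun (j : Fin p) ω => E' ω j) P ∧
      ∀ j, SubGaussianBound (fun ω => E' ω j) (2 * M) P ∧ ∫ ω, E' ω j ∂P = 0 ∧
        ∫ ω, E' ω j ^ 2 ∂P = 1 := by
  obtain ⟨E', hmeas, hae, hind, hE'⟩ := h.noise_E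
  refine ⟨E', hmeas, hae, hind, fun j => ?_⟩
  obtain ⟨hmean, hvar, hpsi⟩ := hE' j
  have hj : Measurable fun ω => E' ω j := by fun_prop
  refine ⟨⟨by positivity, hj.aemeasurable, lintegral_exp_sq_le_two_of_psi2Norm_le hM hpsi⟩,
    hmean, ?_⟩
  rw [← variance_of_integral_eq_zero hj.aemeasurable hmean, hvar]

theorem memLp_E (h : IsSubGaussianModel M P Z E ε) (hM : 0 < M) (j : Fin p) :
    MemLp (fun ω => E ω j) 2 P := by
  obtain ⟨E', -, hae, -, hE'⟩ := h.exists_noise hM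
  exact memLp_coord_of_ae_eq hae (fun i => (hE' i).1.memLp_two) j

theorem exists_factor (h : IsSubGaussianModel M P Z E ε) (hM : 0 < M) :
    ∃ Z' : Ω → EuclideanSpace ℝ (Fin K), Measurable Z' ∧
      (∀ᵐ ω ∂P, Z ω = Matrix.toEuclideanLin (psdSqrt (covMatrix Z P)) (Z' ω)) ∧
      ∀ u : EuclideanSpace ℝ (Fin K), ‖u‖ = 1 →
        SubGaussianBound (fun ω => inner ℝ (Z' ω) u) (2 * M) P := by
  obtain ⟨Z', hmeas, hae, -, hpsi⟩ := h.factor_Z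
  refine ⟨Z', hmeas, hae, fun u hu => ⟨by positivity, by fun_prop,
    lintegral_exp_sq_le_two_of_psi2Norm_le hM (le_trans ?_ hpsi)⟩⟩
  exact le_iSup₂ (f := fun (u : EuclideanSpace ℝ (Fin K)) (_ : ‖u‖ = 1) =>
    psi2Norm (fun ω => inner ℝ (Z' ω) u) P) u hu

theorem memLp_Z (h : IsSubGaussianModel M P Z E ε) (hM : 0 < M) (k : Fin K) :
    MemLp (fun ω => Z ω k) 2 P := by
  obtain ⟨Z', -, hae, hZ'⟩ := h.exists_factor hM
  refine memLp_coord_of_ae_eq hae (fun i => ?_) k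
  have := (hZ' (EuclideanSpace.single i 1) (by simp)).memLp_two
  simpa [EuclideanSpace.inner_single_right] using this

theorem exists_response_noise (h : IsSubGaussianModel M P Z E ε) (hM : 0 < M) :
    ∃ ε' : Ω → ℝ, (∀ᵐ ω ∂P, ε ω = √(Var[ε; P]) * ε' ω) ∧ ∫ ω, ε' ω ∂P = 0 ∧
      SubGaussianBound ε' (2 * M) P := by
  obtain ⟨ε', hmeas, hae, hmean, hpsi⟩ := h.noise_ε
  exact ⟨ε', hae, hmean, by positivity, hmeas.aemeasurable,
    lintegral_exp_sq_le_two_of_psi2Norm_le hM hpsi⟩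

theorem memLp_ε (h : IsSubGaussianModel M P Z E ε) (hM : 0 < M) : MemLp ε 2 P := by
  obtain ⟨ε', hae, -, hε'⟩ := h.exists_response_noise hM
  refine (hε'.memLp_two.const_mul (√(Var[ε; P]))).ae_eq ?_
  filter_upwards [hae] with ω hω
  rw [hω]

theorem lintegral_exp_mul_ε_le [IsProbabilityMeasure P] (h : IsSubGaussianModel M P Z E ε)
    (hM : 0 < M) (t : ℝ) :
    ∫⁻ ω, ENNReal.ofReal (Real.exp (t * ε ω)) ∂P ≤
      ENNReal.ofReal (Real.exp (2 * (2 * M) ^ 2 * Var[ε; P] * t ^ 2 / 2)) := by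
  obtain ⟨ε', hae, hmean, hε'⟩ := h.exists_response_noise hM
  have h1 := hε'.lintegral_exp_mul_le hmean (t * √(Var[ε; P]))
  rw [mul_pow t, Real.sq_sqrt (variance_nonneg _ _)] at h1
  refine le_trans (le_of_eq (lintegral_congr_ae ?_)) (h1.trans (le_of_eq ?_))
  · filter_upwards [hae] with ω hω
    rw [hω, mul_assoc]
  · congr 2
    ring

/-- A linear form in the factor with unit variance. -/
theorem subGaussianBound_inner_Z (h : IsSubGaussianModel M P Z E ε) (hM : 0 < M)
    {x : EuclideanSpace ℝ (Fin K)}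
    (hx : ‖Matrix.toEuclideanLin (psdSqrt (covMatrix Z P)) x‖ = 1) :
    SubGaussianBound (fun ω => inner ℝ (Z ω) x) (2 * M) P := by
  obtain ⟨Z', -, hae, hZ'⟩ := h.exists_factor hM
  refine (hZ' _ hx).congr ?_
  filter_upwards [hae] with ω hω
  rw [hω, ← inner_toEuclideanLin_transpose, psdSqrt_transpose]

theorem integral_inner_Z_sq [IsProbabilityMeasure P] (h : IsSubGaussianModel M P Z E ε) (hM : 0 < M)
    (hmean : ∀ k, ∫ ω, Z ω k ∂P = 0) (x : EuclideanSpace ℝ (Fin K)) :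
    ∫ ω, inner ℝ (Z ω) x ^ 2 ∂P =
      ‖Matrix.toEuclideanLin (psdSqrt (covMatrix Z P)) x‖ ^ 2 := by
  have hmem := memLp_inner (h.memLp_Z hM) x
  rw [← quadForm_eq_norm_sq (covMatrix_posSemidef (h.memLp_Z hM)), ← variance_inner (h.memLp_Z hM),
    variance_of_integral_eq_zero hmem.aestronglyMeasurable.aemeasurable
      (integral_inner_eq_zero (h.memLp_Z hM) hmean x)]

theorem lintegral_exp_inner_E_le [IsProbabilityMeasure P] (h : IsSubGaussianModel M P Z E ε)
    (hM : 0 < M) (w : EuclideanSpace ℝ (Fin p)) :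
    ∫⁻ ω, ENNReal.ofReal (Real.exp (inner ℝ w (E ω))) ∂P ≤
      ENNReal.ofReal (Real.exp (2 * (2 * M) ^ 2 *
        ‖Matrix.toEuclideanLin (psdSqrt (covMatrix E P)) w‖ ^ 2 / 2)) := by
  obtain ⟨E', hmeas, hae, hind, hE'⟩ := h.exists_noise hM
  set w' := Matrix.toEuclideanLin (psdSqrt (covMatrix E P)) w
  have h1 : ∀ᵐ ω ∂P, ENNReal.ofReal (Real.exp (inner ℝ w (E ω))) =
      ∏ j, ENNReal.ofReal (Real.exp (w' j * E' ω j)) := by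
    filter_upwards [hae] with ω hω
    rw [← ofReal_exp_sum, hω, ← psdSqrt_transpose, inner_toEuclideanLin_transpose]
    simp only [PiLp.inner_apply, RCLike.inner_apply, conj_trivial]
    congr 2
    exact Finset.sum_congr rfl fun j _ => mul_comm _ _
  rw [lintegral_congr_ae h1, lintegral_prod_eq_prod_lintegral_of_indepFun Finset.univ
    (fun j ω => ENNReal.ofReal (Real.exp (w' j * E' ω j)))
    (hind.comp (fun j t => ENNReal.ofReal (Real.exp (w' j * t))) fun j => by fun_prop)
    (fun j => by fun_prop)]
  refine (Finset.prod_le_prod' fun j _ =>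
    (hE' j).1.lintegral_exp_mul_le (hE' j).2.1 (w' j)).trans ?_
  rw [← ofReal_exp_sum, EuclideanSpace.real_norm_sq_eq, Finset.mul_sum, Finset.sum_div]

end IsSubGaussianModel

/-! ### The risk -/

/-- The residual is `⟨Z, Aᵀα - β⟩ + (⟨E, α⟩ - ε)`. All three pieces are centred and independent, so
the risk is a variance and the variances add. -/
theorem risk_eq [IsProbabilityMeasure P] {A : Matrix (Fin p) (Fin K) ℝ}
    {β : EuclideanSpace ℝ (Fin K)} (hM : 0 < M) (hF : IsFactorModel P Z E ε)
    (h : IsSubGaussianModel M P Z E ε) (α : EuclideanSpace ℝ (Fin p)) :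
    risk P (feature A Z E) (response β Z ε) α =
      quadForm (covMatrix Z P) (Matrix.toEuclideanLin A.transpose α - β) +
        quadForm (covMatrix E P) α + Var[ε; P] := by
  have hZ := h.memLp_Z hM
  have hE := h.memLp_E hM
  have hε := h.memLp_ε hM
  set w := Matrix.toEuclideanLin A.transpose α - β with hw
  let f : Ω → ℝ := fun ω => inner ℝ (Z ω) w
  let g : Ω → ℝ := fun ω => inner ℝ (E ω) α - ε ω
  have hf : MemLp f 2 P := memLp_inner hZ w
  have hgE : MemLp (fun ω => inner ℝ (E ω) α) 2 P := memLp_inner hE α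
  have hg : MemLp g 2 P := hgE.sub hε
  have hf0 : ∫ ω, f ω ∂P = 0 := integral_inner_eq_zero hZ hF.mean_Z w
  have hg0 : ∫ ω, g ω ∂P = 0 := by
    simp only [g]
    rw [integral_sub (hgE.integrable (by norm_num)) (hε.integrable (by norm_num)), hF.mean_ε,
      integral_inner_eq_zero hE hF.mean_E, sub_zero]
  have hfg : IndepFun f g P :=
    hF.indep_Z.comp (φ := fun z => inner ℝ z w)
      (ψ := fun q : EuclideanSpace ℝ (Fin p) × ℝ => inner ℝ q.1 α - q.2)
      (measurable_id.inner_const) ((measurable_fst.inner_const).sub measurable_snd)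
  have hEε : IndepFun (fun ω => inner ℝ (E ω) α) (fun ω => -ε ω) P :=
    hF.indep_E_ε.comp (φ := fun e => inner ℝ e α) (ψ := fun t : ℝ => -t)
      (measurable_id.inner_const) measurable_neg
  have hrisk : risk P (feature A Z E) (response β Z ε) α = ∫ ω, (f + g) ω ^ 2 ∂P := by
    refine integral_congr_ae (Filter.Eventually.of_forall fun ω => ?_)
    simp only [feature, response, Pi.add_apply, f, g, hw, inner_add_left, inner_sub_right,
      inner_toEuclideanLin_transpose]
    ring
  have hfg0 : ∫ ω, (f + g) ω ∂P = 0 := by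
    simp only [Pi.add_apply]
    rw [integral_add (hf.integrable (by norm_num)) (hg.integrable (by norm_num)), hf0, hg0,
      add_zero]
  have hgvar : Var[g; P] = quadForm (covMatrix E P) α + Var[ε; P] := by
    have h1 : g = (fun ω => inner ℝ (E ω) α) + fun ω => -ε ω := by
      funext ω; simp [g, sub_eq_add_neg]
    have hεn : MemLp (fun ω => -ε ω) 2 P := hε.neg
    rw [h1, IndepFun.variance_add (Y := fun ω => -ε ω) hgE hεn hEε, variance_inner hE]
    congr 1
    exact variance_fun_neg
  rw [hrisk, ← variance_of_integral_eq_zero (hf.add hg).aestronglyMeasurable.aemeasurable hfg0,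
    hfg.variance_add hf hg, hgvar, variance_inner hZ, add_assoc]

end Model

/-! ### Right inverses and the minimum-norm estimator -/

section RightInverse

variable {p d : ℕ} {A : Matrix (Fin p) (Fin d) ℝ}

/-- The right inverse `A (Aᵀ A)⁻¹` of `Aᵀ`. -/
def rightInv (A : Matrix (Fin p) (Fin d) ℝ) : Matrix (Fin p) (Fin d) ℝ :=
  A * (A.transpose * A)⁻¹

theorem isUnit_transpose_mul_self (h : Function.Injective A.mulVec) :
    IsUnit (A.transpose * A) := by
  have : (A.transpose * A).PosDef := by
    rw [← Matrix.conjTranspose_eq_transpose_of_trivial]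
    exact Matrix.PosDef.conjTranspose_mul_self A h
  exact this.isUnit

theorem transpose_mul_rightInv (h : Function.Injective A.mulVec) :
    A.transpose * rightInv A = 1 := by
  have h1 := (Matrix.isUnit_iff_isUnit_det _).1 (isUnit_transpose_mul_self h)
  rw [rightInv, ← Matrix.mul_assoc, Matrix.mul_nonsing_inv _ h1]

theorem injective_mulVec_of_le {l : ℝ} (hl : 0 < l)
    (h : ∀ w, l * ‖w‖ ^ 2 ≤ ‖Matrix.toEuclideanLin A w‖ ^ 2) : Function.Injective A.mulVec := by
  rw [← Matrix.coe_mulVecLin, ← LinearMap.ker_eq_bot, LinearMap.ker_eq_bot']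
  intro x hx
  have h1 := h (WithLp.toLp 2 x)
  have h2 : Matrix.toEuclideanLin A (WithLp.toLp 2 x) = 0 := by
    ext i
    simpa [Matrix.toEuclideanLin] using congrFun hx i
  rw [h2, norm_zero] at h1
  have h3 : ‖WithLp.toLp 2 x‖ ^ 2 = 0 := by nlinarith [sq_nonneg ‖WithLp.toLp 2 x‖]
  have h4 : WithLp.toLp 2 x = 0 := by simpa using h3
  ext i
  exact congrFun (congrArg WithLp.ofLp h4) i

theorem transpose_rightInv_apply (h : Function.Injective A.mulVec)
    (u : EuclideanSpace ℝ (Fin d)) :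
    Matrix.toEuclideanLin A.transpose (Matrix.toEuclideanLin (rightInv A) u) = u := by
  rw [← toEuclideanLin_mul_apply, transpose_mul_rightInv h]
  ext i
  simp [Matrix.toEuclideanLin]

/-- Two solutions of `Aᵀα = u` differ by an element of the kernel of `Aᵀ`, which is orthogonal to
the range of `A`, where `rightInv A u` lies. -/
theorem inner_rightInv (h : Function.Injective A.mulVec) (u : EuclideanSpace ℝ (Fin d))
    (α : EuclideanSpace ℝ (Fin p)) (hα : Matrix.toEuclideanLin A.transpose α = u) :
    inner ℝ α (Matrix.toEuclideanLin (rightInv A) u) =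
      ‖Matrix.toEuclideanLin (rightInv A) u‖ ^ 2 := by
  set w := Matrix.toEuclideanLin (A.transpose * A)⁻¹ u
  have hw : Matrix.toEuclideanLin (rightInv A) u = Matrix.toEuclideanLin A w :=
    toEuclideanLin_mul_apply _ _ _
  have h1 : ∀ v, inner ℝ v (Matrix.toEuclideanLin A w) =
      inner ℝ (Matrix.toEuclideanLin A.transpose v) w := fun v => by
    have := inner_toEuclideanLin_transpose A.transpose v w
    rwa [Matrix.transpose_transpose] at this
  rw [← real_inner_self_eq_norm_sq]
  conv_rhs => rw [hw, h1, ← hw, transpose_rightInv_apply h]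
  rw [hw, h1, hα]

/-- `rightInv A * Aᵀ` is the orthogonal projection onto the range of `A`. -/
theorem norm_rightInv_le (h : Function.Injective A.mulVec) (α : EuclideanSpace ℝ (Fin p)) :
    ‖Matrix.toEuclideanLin (rightInv A) (Matrix.toEuclideanLin A.transpose α)‖ ≤ ‖α‖ := by
  set z := Matrix.toEuclideanLin (rightInv A) (Matrix.toEuclideanLin A.transpose α)
  have h1 : ‖z‖ ^ 2 ≤ ‖α‖ * ‖z‖ := by
    rw [← inner_rightInv h _ α rfl]
    exact real_inner_le_norm _ _
  rcases (norm_nonneg z).eq_or_lt with h0 | h0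
  · rw [← h0]; exact norm_nonneg _
  · exact le_of_mul_le_mul_right (by rwa [sq] at h1) h0

/-- With `z = Aw` the image of `u`, one has `‖z‖² = ⟨w, u⟩`, and the lower bound on `A` controls
`‖w‖` by `‖z‖`. -/
theorem mul_norm_sq_rightInv_le {l : ℝ} (hl : 0 < l)
    (h : ∀ w, l * ‖w‖ ^ 2 ≤ ‖Matrix.toEuclideanLin A w‖ ^ 2) (u : EuclideanSpace ℝ (Fin d)) :
    l * ‖Matrix.toEuclideanLin (rightInv A) u‖ ^ 2 ≤ ‖u‖ ^ 2 := by
  set w := Matrix.toEuclideanLin (A.transpose * A)⁻¹ u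
  have hinj := injective_mulVec_of_le hl h
  have hw : Matrix.toEuclideanLin (rightInv A) u = Matrix.toEuclideanLin A w :=
    toEuclideanLin_mul_apply _ _ _
  set z := Matrix.toEuclideanLin (rightInv A) u
  have h1 : ‖z‖ ^ 2 ≤ ‖u‖ * ‖w‖ := by
    calc ‖z‖ ^ 2 = inner ℝ (Matrix.toEuclideanLin A w) z := by
          rw [← hw, real_inner_self_eq_norm_sq]
      _ = inner ℝ w (Matrix.toEuclideanLin A.transpose z) :=
          (inner_toEuclideanLin_transpose A w z).symm
      _ = inner ℝ w u := by rw [transpose_rightInv_apply hinj]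
      _ ≤ ‖u‖ * ‖w‖ := by rw [mul_comm]; exact real_inner_le_norm _ _
  have h2 : l * ‖w‖ ^ 2 ≤ ‖z‖ ^ 2 := by rw [hw]; exact h w
  rcases (norm_nonneg z).eq_or_lt with h0 | h0
  · rw [← h0]; simp
  have h3 : (‖z‖ ^ 2) ^ 2 ≤ (‖u‖ * ‖w‖) ^ 2 := by gcongr
  have h4 : ‖z‖ ^ 2 * (l * ‖z‖ ^ 2) ≤ ‖z‖ ^ 2 * ‖u‖ ^ 2 := by
    nlinarith [mul_le_mul_of_nonneg_right h2 (sq_nonneg ‖u‖)]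
  exact le_of_mul_le_mul_left h4 (by positivity)

/-- Full row rank makes every least-squares solution an interpolant. By `inner_rightInv` the
distance to `α₀` satisfies `‖α - α₀‖² = ‖α‖² - ‖α₀‖²`, which minimality of `‖α‖` makes nonpositive.
-/
theorem minNormEstimator_eq {n : ℕ} {X : Matrix (Fin n) (Fin p) ℝ}
    (h : Function.Injective X.transpose.mulVec) (y : EuclideanSpace ℝ (Fin n)) :
    minNormEstimator X y = Matrix.toEuclideanLin (rightInv X.transpose) y := by
  obtain ⟨h1, h2⟩ : IsMinNormLeastSquares X y (minNormEstimator X y) :=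
    (exists_isMinNormLeastSquares X y).choose_spec
  set α := minNormEstimator X y
  set α₀ := Matrix.toEuclideanLin (rightInv X.transpose) y with hα₀
  have hX0 : Matrix.toEuclideanLin X α₀ = y := by
    have := transpose_rightInv_apply h y
    rwa [Matrix.transpose_transpose] at this
  have hX : Matrix.toEuclideanLin X α = y := by
    have := h1 α₀
    rw [hX0, sub_self, norm_zero] at this
    exact sub_eq_zero.1 (norm_le_zero_iff.1 this)
  have hle : ‖α‖ ≤ ‖α₀‖ := h2 α₀ fun u => by
    rw [hX0, sub_self, norm_zero]
    exact norm_nonneg _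
  have hin : inner ℝ α α₀ = ‖α₀‖ ^ 2 :=
    inner_rightInv h y α (by rwa [Matrix.transpose_transpose])
  have h3 : ‖α - α₀‖ ^ 2 = ‖α‖ ^ 2 - ‖α₀‖ ^ 2 := by
    rw [norm_sub_sq_real, hin]
    ring
  have h4 : ‖α‖ ^ 2 ≤ ‖α₀‖ ^ 2 := by gcongr
  have h5 : ‖α - α₀‖ ^ 2 = 0 := le_antisymm (by linarith) (sq_nonneg _)
  exact sub_eq_zero.1 (by simpa using h5)

end RightInverse

/-! ### The error bound on a good sample -/

theorem norm_add_sq_le {E : Type*} [SeminormedAddCommGroup E] (x y : E) :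
    ‖x + y‖ ^ 2 ≤ 2 * ‖x‖ ^ 2 + 2 * ‖y‖ ^ 2 := by
  have h1 : ‖x + y‖ ^ 2 ≤ (‖x‖ + ‖y‖) ^ 2 := by gcongr; exact norm_add_le x y
  nlinarith [sq_nonneg (‖x‖ - ‖y‖)]

section Deterministic

variable {n p K : ℕ} {A : Matrix (Fin p) (Fin K) ℝ} {B : Matrix (Fin K) (Fin K) ℝ}
  {Zm : Matrix (Fin n) (Fin K) ℝ} {Em : Matrix (Fin n) (Fin p) ℝ} {X : Matrix (Fin n) (Fin p) ℝ}
  {a u l : ℝ}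

/-- All randomness enters through `hZ`, `hE`, `hX` and `hε`. The estimator is `αs + αn`, its
responses to the signal `Zm β` and to the noise `ε`; each part is bounded in the factor seminorm and
in the Euclidean norm. -/
theorem error_le_of_good_sample (hXeq : X = Zm * A.transpose + Em) (ha : 0 < a) (hu : 0 ≤ u)
    (hl : 0 < l)
    (hZ : ∀ x, a * ‖Matrix.toEuclideanLin B x‖ ^ 2 ≤ ‖Matrix.toEuclideanLin Zm x‖ ^ 2)
    (hE : ∀ α, ‖Matrix.toEuclideanLin Em α‖ ^ 2 ≤ u * ‖α‖ ^ 2)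
    (hX : ∀ v, l * ‖v‖ ^ 2 ≤ ‖Matrix.toEuclideanLin X.transpose v‖ ^ 2)
    {β : EuclideanSpace ℝ (Fin K)} {α₀ : EuclideanSpace ℝ (Fin p)}
    (hα₀ : Matrix.toEuclideanLin A.transpose α₀ = β) {ε : EuclideanSpace ℝ (Fin n)} {t e : ℝ}
    (ht : 0 ≤ t) (he : 0 ≤ e)
    (hε : ‖Matrix.toEuclideanLin (B * A.transpose * rightInv X.transpose) ε‖ ^ 2 ≤
      t * ∑ k, ∑ i, (B * A.transpose * rightInv X.transpose) k i ^ 2) :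
    ‖Matrix.toEuclideanLin B (Matrix.toEuclideanLin A.transpose
        (minNormEstimator X (Matrix.toEuclideanLin Zm β + ε)) - β)‖ ^ 2 +
      e * ‖minNormEstimator X (Matrix.toEuclideanLin Zm β + ε)‖ ^ 2 ≤
    (4 * (1 + u / l) * (u / a + e)) * ‖α₀‖ ^ 2 + 4 * t * K * (1 + u / l) / a +
      2 * e * ‖ε‖ ^ 2 / l := by
  set G := rightInv X.transpose with hG
  have hinj := injective_mulVec_of_le hl hX
  have hXG : ∀ v, Matrix.toEuclideanLin X (Matrix.toEuclideanLin G v) = v := fun v => by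
    have := transpose_rightInv_apply hinj v
    rwa [Matrix.transpose_transpose] at this
  have hGl : ∀ v, ‖Matrix.toEuclideanLin G v‖ ^ 2 ≤ ‖v‖ ^ 2 / l := fun v => by
    rw [le_div_iff₀' hl]
    exact mul_norm_sq_rightInv_le hl hX v
  have hXapp : ∀ α, Matrix.toEuclideanLin X α =
      Matrix.toEuclideanLin Zm (Matrix.toEuclideanLin A.transpose α) +
        Matrix.toEuclideanLin Em α := fun α => by
    rw [hXeq, map_add, LinearMap.add_apply, toEuclideanLin_mul_apply]
  rw [minNormEstimator_eq hinj, map_add]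
  set αs := Matrix.toEuclideanLin G (Matrix.toEuclideanLin Zm β) with hαs
  set αn := Matrix.toEuclideanLin G ε with hαn
  have hul : 0 ≤ u / l := by positivity
  have hGE : ∀ α, ‖Matrix.toEuclideanLin G (Matrix.toEuclideanLin Em α)‖ ^ 2 ≤
      u / l * ‖α‖ ^ 2 := fun α => by
    refine (hGl _).trans ?_
    rw [div_mul_eq_mul_div]
    gcongr
    exact hE α
  -- `Zm β = X α₀ - Em α₀`, and `GX` is an orthogonal projection, so `αs` is a projection of `α₀` up
  -- to the term `G Em α₀`.
  have hs1 : ‖αs‖ ^ 2 ≤ 2 * (1 + u / l) * ‖α₀‖ ^ 2 := by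
    have h1 : αs = Matrix.toEuclideanLin G (Matrix.toEuclideanLin X α₀) +
        -Matrix.toEuclideanLin G (Matrix.toEuclideanLin Em α₀) := by
      rw [← sub_eq_add_neg, ← map_sub, hXapp, hα₀, add_sub_cancel_right]
    have h2 : ‖Matrix.toEuclideanLin G (Matrix.toEuclideanLin X α₀)‖ ≤ ‖α₀‖ := by
      have := norm_rightInv_le hinj α₀
      rwa [Matrix.transpose_transpose] at this
    have h3 : ‖Matrix.toEuclideanLin G (Matrix.toEuclideanLin X α₀)‖ ^ 2 ≤ ‖α₀‖ ^ 2 := by gcongr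
    have h4 := norm_add_sq_le (Matrix.toEuclideanLin G (Matrix.toEuclideanLin X α₀))
      (-Matrix.toEuclideanLin G (Matrix.toEuclideanLin Em α₀))
    rw [← h1, norm_neg] at h4
    linarith [hGE α₀]
  -- Since `X αs = Zm β`, the vectors `Zm(Aᵀαs - β)` and `Em αs` are opposite.
  have hs2 : ‖Matrix.toEuclideanLin B (Matrix.toEuclideanLin A.transpose αs - β)‖ ^ 2 ≤
      u / a * ‖αs‖ ^ 2 := by
    rw [div_mul_eq_mul_div, le_div_iff₀' ha]
    refine (hZ _).trans (le_trans (le_of_eq ?_) (hE αs))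
    have h1 := hXG (Matrix.toEuclideanLin Zm β)
    rw [hXapp] at h1
    rw [map_sub, ← norm_neg (Matrix.toEuclideanLin Em αs), eq_sub_of_add_eq h1]
    congr 2
    abel
  have hn1 : ‖αn‖ ^ 2 ≤ ‖ε‖ ^ 2 / l := hGl ε
  set W := B * A.transpose * G with hW
  have hWapp : ∀ v, Matrix.toEuclideanLin W v =
      Matrix.toEuclideanLin B (Matrix.toEuclideanLin A.transpose (Matrix.toEuclideanLin G v)) :=
    fun v => by rw [hW, toEuclideanLin_mul_apply, toEuclideanLin_mul_apply]
  -- `XGv = v` reads `Zm AᵀGv = v - Em G v`; division by `a` gives `W` an operator norm smaller than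
  -- that of `G` would suggest.
  have hWop : ∀ v, ‖Matrix.toEuclideanLin W v‖ ^ 2 ≤ 2 * (1 + u / l) / a * ‖v‖ ^ 2 := fun v => by
    rw [div_mul_eq_mul_div, le_div_iff₀' ha, hWapp]
    refine (hZ _).trans ?_
    have h1 := hXG v
    rw [hXapp] at h1
    rw [eq_sub_of_add_eq h1, sub_eq_add_neg]
    have h2 := norm_add_sq_le v (-Matrix.toEuclideanLin Em (Matrix.toEuclideanLin G v))
    rw [norm_neg] at h2
    have h3 : ‖Matrix.toEuclideanLin Em (Matrix.toEuclideanLin G v)‖ ^ 2 ≤ u / l * ‖v‖ ^ 2 := by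
      refine (hE _).trans ?_
      rw [div_mul_eq_mul_div, mul_div_assoc]
      gcongr
      exact hGl v
    linarith
  -- Each of the only `K` rows of `W` has squared norm at most the squared operator norm.
  have hfrob : ∑ k, ∑ i, W k i ^ 2 ≤ K * (2 * (1 + u / l) / a) := by
    have h1 : ∀ k, ∑ i, W k i ^ 2 ≤ 2 * (1 + u / l) / a := fun k => by
      have h2 := norm_sq_toEuclideanLin_transpose_le (by positivity) hWop
        (EuclideanSpace.single k 1)
      rw [EuclideanSpace.real_norm_sq_eq] at h2
      simpa only [toEuclideanLin_single_apply, Matrix.transpose_apply, PiLp.norm_single,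
        norm_one, one_pow, mul_one] using h2
    calc _ ≤ ∑ _k : Fin K, 2 * (1 + u / l) / a := Finset.sum_le_sum fun k _ => h1 k
      _ = _ := by simp
  have hn2 : ‖Matrix.toEuclideanLin B (Matrix.toEuclideanLin A.transpose αn)‖ ^ 2 ≤
      t * (K * (2 * (1 + u / l) / a)) := by
    rw [← hWapp]
    exact hε.trans (by gcongr)
  have hsplit : Matrix.toEuclideanLin B (Matrix.toEuclideanLin A.transpose (αs + αn) - β) =
      Matrix.toEuclideanLin B (Matrix.toEuclideanLin A.transpose αs - β) +
        Matrix.toEuclideanLin B (Matrix.toEuclideanLin A.transpose αn) := by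
    rw [map_add (Matrix.toEuclideanLin A.transpose), ← map_add (Matrix.toEuclideanLin B),
      add_sub_right_comm]
  rw [hsplit]
  have h1 := norm_add_sq_le (Matrix.toEuclideanLin B (Matrix.toEuclideanLin A.transpose αs - β))
    (Matrix.toEuclideanLin B (Matrix.toEuclideanLin A.transpose αn))
  have h2 := mul_le_mul_of_nonneg_left (norm_add_sq_le αs αn) he
  have h3 : u / a * ‖αs‖ ^ 2 ≤ u / a * (2 * (1 + u / l) * ‖α₀‖ ^ 2) := by gcongr
  have h4 : e * ‖αs‖ ^ 2 ≤ e * (2 * (1 + u / l) * ‖α₀‖ ^ 2) := by gcongr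
  have h5 : e * ‖αn‖ ^ 2 ≤ e * (‖ε‖ ^ 2 / l) := by gcongr
  have h6 : 4 * t * K * (1 + u / l) / a = 2 * (t * (K * (2 * (1 + u / l) / a))) := by ring
  have h7 : 2 * e * ‖ε‖ ^ 2 / l = 2 * (e * (‖ε‖ ^ 2 / l)) := by ring
  rw [h6, h7]
  linarith

end Deterministic

/-! ### The law of the sample -/

section SampleLaw

variable {Ω Ω' : Type*} [MeasurableSpace Ω] [MeasurableSpace Ω'] {P : Measure Ω}
  {P' : Measure Ω'} {n p K : ℕ}
  {Z : Ω → EuclideanSpace ℝ (Fin K)} {E : Ω → EuclideanSpace ℝ (Fin p)} {ε : Ω → ℝ}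
  {Zs : Fin n → Ω' → EuclideanSpace ℝ (Fin K)} {Es : Fin n → Ω' → EuclideanSpace ℝ (Fin p)}
  {εs : Fin n → Ω' → ℝ}

theorem IsFactorModel.map_eq_prod [IsProbabilityMeasure P] (hF : IsFactorModel P Z E ε) :
    P.map (fun ω => ((Z ω, E ω), ε ω)) = (P.map fun ω => (Z ω, E ω)).prod (P.map ε) := by
  have hZ := hF.measurable_Z
  have hE := hF.measurable_E
  have hε := hF.measurable_ε
  have hZE : IndepFun Z E P :=
    hF.indep_Z.comp (φ := id) (ψ := Prod.fst) measurable_id measurable_fst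
  have := Measure.isProbabilityMeasure_map (μ := P) hZ.aemeasurable
  have := Measure.isProbabilityMeasure_map (μ := P) hE.aemeasurable
  have := Measure.isProbabilityMeasure_map (μ := P) hε.aemeasurable
  have h1 : P.map (fun ω => (Z ω, (E ω, ε ω))) =
      (P.map Z).prod ((P.map E).prod (P.map ε)) := by
    rw [(indepFun_iff_map_prod_eq_prod_map_map hZ.aemeasurable
      (hE.prodMk hε).aemeasurable).1 hF.indep_Z,
      (indepFun_iff_map_prod_eq_prod_map_map hE.aemeasurable hε.aemeasurable).1 hF.indep_E_ε]
  rw [(indepFun_iff_map_prod_eq_prod_map_map hZ.aemeasurable hE.aemeasurable).1 hZE,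
    ← MeasurableEquiv.prodAssoc.map_measurableEquiv_injective.eq_iff, Measure.prodAssoc_prod, ← h1,
    Measure.map_map MeasurableEquiv.prodAssoc.measurable ((hZ.prodMk hE).prodMk hε)]
  rfl

theorem IsIIDSample.aemeasurable (hS : IsIIDSample P Z E ε P' Zs Es εs) (i : Fin n) :
    AEMeasurable (fun ω => ((Zs i ω, Es i ω), εs i ω)) P' := by
  have h := (hS.identDistrib i).aemeasurable_fst
  exact (h.fst.prodMk h.snd.fst).prodMk h.snd.snd

theorem IsIIDSample.aemeasurable_sample (hS : IsIIDSample P Z E ε P' Zs Es εs) :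
    AEMeasurable (fun ω => ((fun i => (Zs i ω, Es i ω)), fun i => εs i ω)) P' :=
  (aemeasurable_pi_lambda _ fun i => (hS.aemeasurable i).fst).prodMk
    (aemeasurable_pi_lambda _ fun i => (hS.aemeasurable i).snd)

/-- The pairs `(Z_i, E_i)` are grouped apart from the `ε_i`, so that Fubini amounts to conditioning
on the design matrix. -/
theorem IsIIDSample.map_eq_prod [IsProbabilityMeasure P] [IsProbabilityMeasure P']
    (hF : IsFactorModel P Z E ε)
    (hS : IsIIDSample P Z E ε P' Zs Es εs) :
    P'.map (fun ω => ((fun i => (Zs i ω, Es i ω)), fun i => εs i ω)) =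
      (Measure.pi fun _ : Fin n => P.map fun ω => (Z ω, E ω)).prod
        (Measure.pi fun _ : Fin n => P.map ε) := by
  have hZE : Measurable fun ω => (Z ω, E ω) := hF.measurable_Z.prodMk hF.measurable_E
  have := Measure.isProbabilityMeasure_map (μ := P) hZE.aemeasurable
  have := Measure.isProbabilityMeasure_map (μ := P) hF.measurable_ε.aemeasurable
  have hmeas : AEMeasurable (fun ω i => ((Zs i ω, Es i ω), εs i ω)) P' :=
    aemeasurable_pi_lambda _ fun i => hS.aemeasurable i
  have hind : iIndepFun (fun i ω => ((Zs i ω, Es i ω), εs i ω)) P' :=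
    hS.indep.comp (fun _ q => ((q.1, q.2.1), q.2.2)) fun _ => by fun_prop
  have hpi : P'.map (fun ω i => ((Zs i ω, Es i ω), εs i ω)) =
      Measure.pi fun _ : Fin n => (P.map fun ω => (Z ω, E ω)).prod (P.map ε) := by
    rw [(iIndepFun_iff_map_fun_eq_pi_map hS.aemeasurable).1 hind]
    congr 1
    funext i
    rw [← hF.map_eq_prod]
    exact ((hS.identDistrib i).comp
      (u := fun q : EuclideanSpace ℝ (Fin K) × EuclideanSpace ℝ (Fin p) × ℝ =>
        ((q.1, q.2.1), q.2.2)) (by fun_prop)).map_eq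
  rw [← (measurePreserving_arrowProdEquivProdArrow _ _ (Fin n)
    (fun _ => P.map fun ω => (Z ω, E ω)) (fun _ => P.map ε)).map_eq, ← hpi,
    AEMeasurable.map_map_of_aemeasurable
      (MeasurableEquiv.measurable _).aemeasurable hmeas]
  rfl

end SampleLaw

/-! ### Data matrices -/

section RowMatrix

variable {n d : ℕ}

/-- The matrix with rows `x i`. -/
def rowMatrix (x : Fin n → EuclideanSpace ℝ (Fin d)) : Matrix (Fin n) (Fin d) ℝ :=
  Matrix.of fun i j => x i j

theorem rowMatrix_apply (x : Fin n → EuclideanSpace ℝ (Fin d)) (v : EuclideanSpace ℝ (Fin d))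
    (i : Fin n) : Matrix.toEuclideanLin (rowMatrix x) v i = inner ℝ (x i) v := by
  simp [Matrix.toEuclideanLin, rowMatrix, Matrix.mulVec, dotProduct, PiLp.inner_apply, mul_comm]

theorem norm_sq_rowMatrix (x : Fin n → EuclideanSpace ℝ (Fin d)) (v : EuclideanSpace ℝ (Fin d)) :
    ‖Matrix.toEuclideanLin (rowMatrix x) v‖ ^ 2 = ∑ i, inner ℝ (x i) v ^ 2 := by
  rw [EuclideanSpace.real_norm_sq_eq]
  simp_rw [rowMatrix_apply]

theorem rowMatrix_transpose_apply (x : Fin n → EuclideanSpace ℝ (Fin d))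
    (v : EuclideanSpace ℝ (Fin n)) :
    Matrix.toEuclideanLin (rowMatrix x).transpose v = ∑ i, v i • x i := by
  ext j
  simp [Matrix.toEuclideanLin, rowMatrix, Matrix.mulVec, dotProduct, mul_comm]

end RowMatrix

/-! ### Union bounds over nets -/

theorem measure_exists_mem_le {T α : Type*} [MeasurableSpace T] {μ : Measure T} (N : Finset α)
    {S : α → Set T} {C q : ℝ} (hC : (N.card : ℝ) ≤ C) (hq : 0 ≤ q)
    (h : ∀ v ∈ N, μ (S v) ≤ ENNReal.ofReal q) :
    μ {x | ∃ v ∈ N, x ∈ S v} ≤ ENNReal.ofReal (C * q) := by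
  have h1 : {x | ∃ v ∈ N, x ∈ S v} = ⋃ v ∈ N, S v := by ext; simp
  rw [h1]
  calc μ (⋃ v ∈ N, S v) ≤ ∑ v ∈ N, μ (S v) := measure_biUnion_finset_le _ _
    _ ≤ ∑ _v ∈ N, ENNReal.ofReal q := Finset.sum_le_sum h
    _ = ENNReal.ofReal (N.card * q) := by
      rw [Finset.sum_const, nsmul_eq_mul, ENNReal.ofReal_mul (by positivity),
        ENNReal.ofReal_natCast]
    _ ≤ _ := ENNReal.ofReal_le_ofReal (by gcongr)

/-! ### The smallest singular value of the factor matrix -/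

section FactorMatrix

variable {T : Type*} [MeasurableSpace T] {κ : Measure T} [IsProbabilityMeasure κ] {n d : ℕ}
  {f : T → EuclideanSpace ℝ (Fin d)} {L : ℝ}

theorem measure_sum_inner_sq_le (hf : Measurable f) (hL : 0 < L) {x : EuclideanSpace ℝ (Fin d)}
    (hlow : ∀ a, 0 ≤ a → ∫⁻ t, ENNReal.ofReal (Real.exp (-(a * inner ℝ (f t) x ^ 2))) ∂κ ≤
      ENNReal.ofReal (Real.exp (-a + 4 * L ^ 4 * a ^ 2 / 2))) :
    Measure.pi (fun _ : Fin n => κ)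
      {t | ‖Matrix.toEuclideanLin (rowMatrix fun i => f (t i)) x‖ ^ 2 ≤ n / 4} ≤
      ENNReal.ofReal (Real.exp (-(n / (16 * L ^ 4)))) := by
  -- Minimizer of the exponent `-a + 2L⁴a²`, with value `-a/2`.
  set a : ℝ := 1 / (4 * L ^ 4) with ha
  have ha0 : 0 < a := by positivity
  have hint : ∫⁻ t, ENNReal.ofReal (Real.exp
      (-(a * ‖Matrix.toEuclideanLin (rowMatrix fun i => f (t i)) x‖ ^ 2)))
      ∂Measure.pi (fun _ : Fin n => κ) ≤ ENNReal.ofReal (Real.exp (-(n * (a / 2)))) := by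
    simp_rw [norm_sq_rowMatrix, Finset.mul_sum, ← Finset.sum_neg_distrib, ofReal_exp_sum]
    rw [lintegral_prod_pi (fun _ : Fin n => κ)
      (f := fun _ t => ENNReal.ofReal (Real.exp (-(a * inner ℝ (f t) x ^ 2))))
      (fun _ => by fun_prop)]
    refine (Finset.prod_le_prod' fun i _ => hlow a ha0.le).trans (le_of_eq ?_)
    rw [← ofReal_exp_sum, Finset.sum_const, Finset.card_univ, Fintype.card_fin, nsmul_eq_mul]
    congr 2
    rw [ha]
    field_simp
    ring
  have hm : Measurable fun t : Fin n → T =>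
      -(a * ‖Matrix.toEuclideanLin (rowMatrix fun i => f (t i)) x‖ ^ 2) := by
    simp_rw [norm_sq_rowMatrix]
    fun_prop
  have h := measure_ge_le_of_lintegral_exp_le hm.aemeasurable (b := -(a * (n / 4))) hint
  refine le_trans (measure_mono fun t ht => ?_) (h.trans (le_of_eq ?_))
  · rw [Set.mem_ofPred_eq] at ht ⊢
    rw [neg_le_neg_iff]
    gcongr
  · congr 2
    rw [ha]
    field_simp
    ring

/-- The crude bound `2 ≤ e` per row is enough: this upper estimate serves only to pass from the net
to the sphere. -/
theorem measure_lt_sum_inner_sq_le (hf : Measurable f) (hL : 0 < L)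
    {x : EuclideanSpace ℝ (Fin d)}
    (hup : ∫⁻ t, ENNReal.ofReal (Real.exp (inner ℝ (f t) x ^ 2 / L ^ 2)) ∂κ ≤ 2) :
    Measure.pi (fun _ : Fin n => κ)
      {t | 2 * L ^ 2 * n ≤ ‖Matrix.toEuclideanLin (rowMatrix fun i => f (t i)) x‖ ^ 2} ≤
      ENNReal.ofReal (Real.exp (-n)) := by
  have hint : ∫⁻ t, ENNReal.ofReal (Real.exp
      (‖Matrix.toEuclideanLin (rowMatrix fun i => f (t i)) x‖ ^ 2 / L ^ 2))
      ∂Measure.pi (fun _ : Fin n => κ) ≤ ENNReal.ofReal (Real.exp (n * 1)) := by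
    simp_rw [norm_sq_rowMatrix, Finset.sum_div, ofReal_exp_sum]
    rw [lintegral_prod_pi (fun _ : Fin n => κ)
      (f := fun _ t => ENNReal.ofReal (Real.exp (inner ℝ (f t) x ^ 2 / L ^ 2)))
      (fun _ => by fun_prop)]
    have h2 : (2 : ENNReal) ≤ ENNReal.ofReal (Real.exp 1) := by
      rw [← ENNReal.ofReal_ofNat]
      refine ENNReal.ofReal_le_ofReal ?_
      linarith [Real.add_one_le_exp 1]
    refine (Finset.prod_le_prod' fun i _ => hup.trans h2).trans (le_of_eq ?_)
    rw [← ofReal_exp_sum, Finset.sum_const, Finset.card_univ, Fintype.card_fin, nsmul_eq_mul]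
  have hm : Measurable fun t : Fin n → T =>
      ‖Matrix.toEuclideanLin (rowMatrix fun i => f (t i)) x‖ ^ 2 / L ^ 2 := by
    simp_rw [norm_sq_rowMatrix]
    fun_prop
  have h := measure_ge_le_of_lintegral_exp_le hm.aemeasurable (b := 2 * n) hint
  refine le_trans (measure_mono fun t ht => ?_) (h.trans (le_of_eq ?_))
  · rw [Set.mem_ofPred_eq] at ht ⊢
    rw [le_div_iff₀ (by positivity)]
    linarith
  · congr 2
    ring

theorem measure_factor_matrix_small_le (hf : Measurable f) (hL : 0 < L)
    {B : Matrix (Fin d) (Fin d) ℝ} (hB : Function.Surjective (Matrix.toEuclideanLin B))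
    (hlow : ∀ x, ‖Matrix.toEuclideanLin B x‖ = 1 → ∀ a, 0 ≤ a →
      ∫⁻ t, ENNReal.ofReal (Real.exp (-(a * inner ℝ (f t) x ^ 2))) ∂κ ≤
      ENNReal.ofReal (Real.exp (-a + 4 * L ^ 4 * a ^ 2 / 2)))
    (hup : ∀ x, ‖Matrix.toEuclideanLin B x‖ = 1 →
      ∫⁻ t, ENNReal.ofReal (Real.exp (inner ℝ (f t) x ^ 2 / L ^ 2)) ∂κ ≤ 2)
    {γ : ℝ} (hγ : 0 < γ) (hγ2 : γ ≤ 1 / 2) (hγL : γ * (32 * L) ≤ 1) :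
    Measure.pi (fun _ : Fin n => κ) {t | ¬ ∀ x, (n : ℝ) / 16 * ‖Matrix.toEuclideanLin B x‖ ^ 2 ≤
      ‖Matrix.toEuclideanLin (rowMatrix fun i => f (t i)) x‖ ^ 2} ≤
      ENNReal.ofReal ((1 + 2 / γ) ^ d *
        (Real.exp (-(n / (16 * L ^ 4))) + Real.exp (-n))) := by
  obtain ⟨N, hN1, hNcard, hnet⟩ := exists_sphere_net (EuclideanSpace ℝ (Fin d)) hγ
  rw [finrank_euclideanSpace_fin] at hNcard
  -- The substitution `x = B⁻¹v` normalizes `⟨f, x⟩` at the points `v` of an ordinary sphere net.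
  let e : EuclideanSpace ℝ (Fin d) ≃ₗ[ℝ] EuclideanSpace ℝ (Fin d) :=
    LinearEquiv.ofBijective (Matrix.toEuclideanLin B)
      ⟨LinearMap.injective_iff_surjective.2 hB, hB⟩
  have hBe : ∀ v, Matrix.toEuclideanLin B (e.symm v) = v := fun v => e.apply_symm_apply v
  let S : EuclideanSpace ℝ (Fin d) → Set (Fin n → T) := fun v =>
    {t | ‖Matrix.toEuclideanLin (rowMatrix fun i => f (t i)) (e.symm v)‖ ^ 2 ≤ n / 4} ∪
    {t | 2 * L ^ 2 * n ≤ ‖Matrix.toEuclideanLin (rowMatrix fun i => f (t i)) (e.symm v)‖ ^ 2}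
  have hS : ∀ v ∈ N, Measure.pi (fun _ : Fin n => κ) (S v) ≤
      ENNReal.ofReal (Real.exp (-(n / (16 * L ^ 4))) + Real.exp (-n)) := fun v hv => by
    have hv1 : ‖Matrix.toEuclideanLin B (e.symm v)‖ = 1 := by rw [hBe, hN1 v hv]
    rw [ENNReal.ofReal_add (Real.exp_pos _).le (Real.exp_pos _).le]
    exact (measure_union_le _ _).trans (add_le_add
      (measure_sum_inner_sq_le hf hL (hlow _ hv1)) (measure_lt_sum_inner_sq_le hf hL (hup _ hv1)))
  refine le_trans (measure_mono fun t ht => ?_)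
    (measure_exists_mem_le N hNcard (by positivity) hS)
  by_contra hcon
  simp only [Set.mem_ofPred_eq, not_exists, not_and, S, Set.mem_union, not_or, not_le] at hcon
  refine ht fun x => ?_
  let F : EuclideanSpace ℝ (Fin d) →ₗ[ℝ] EuclideanSpace ℝ (Fin n) :=
    (Matrix.toEuclideanLin (rowMatrix fun i => f (t i))).comp e.symm.toLinearMap
  have hU : ∀ v ∈ N, ‖F v‖ ≤ √2 * L * √n := fun v hv => by
    refine abs_le_of_sq_le_sq' ?_ (by positivity) |>.2
    rw [mul_pow, mul_pow, Real.sq_sqrt (by positivity), Real.sq_sqrt (by positivity)]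
    exact (hcon v hv).2.le
  have hl : ∀ v ∈ N, √n / 2 ≤ ‖F v‖ := fun v hv => by
    refine abs_le_of_sq_le_sq' ?_ (by positivity) |>.2
    rw [div_pow, Real.sq_sqrt (by positivity)]
    norm_num
    exact (hcon v hv).1.le
  have h1 := norm_le_of_net hγ2 hnet F hU
  have h2 := le_norm_of_net hnet F (by positivity) h1 hl (Matrix.toEuclideanLin B x)
  have h3 : F (Matrix.toEuclideanLin B x) =
      Matrix.toEuclideanLin (rowMatrix fun i => f (t i)) x := by
    simp only [F, LinearMap.comp_apply]
    congr 1
    exact e.symm_apply_apply x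
  rw [h3] at h2
  have hsq2 : √2 ≤ 2 := by
    rw [Real.sqrt_le_left (by norm_num)]; norm_num
  -- Since `32Lγ ≤ 1`, the net error is at most `√n/8`.
  have h4 : √n / 4 ≤ √n / 2 - γ * (2 * (√2 * L * √n)) := by
    have h5 : γ * (2 * (√2 * L * √n)) = γ * (32 * L) * (√2 * √n / 16) := by ring
    have h6 : γ * (32 * L) * (√2 * √n / 16) ≤ 1 * (√2 * √n / 16) := by gcongr
    have h7 : √2 * √n ≤ 2 * √n := by gcongr
    rw [h5]
    linarith [Real.sqrt_nonneg n]
  have h5 : √n / 4 * ‖Matrix.toEuclideanLin B x‖ ≤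
      ‖Matrix.toEuclideanLin (rowMatrix fun i => f (t i)) x‖ :=
    (mul_le_mul_of_nonneg_right h4 (norm_nonneg _)).trans h2
  calc (n : ℝ) / 16 * ‖Matrix.toEuclideanLin B x‖ ^ 2
      = (√n / 4 * ‖Matrix.toEuclideanLin B x‖) ^ 2 := by
        rw [mul_pow, div_pow, Real.sq_sqrt (by positivity)]
        norm_num
    _ ≤ _ := by gcongr

end FactorMatrix

/-! ### Linear images of the response noise -/

section ResponseNoise

variable {n d : ℕ} {μ : Measure ℝ} [IsProbabilityMeasure μ] {V : ℝ}

theorem lintegral_exp_inner_pi_le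
    (hsub : ∀ t, ∫⁻ x, ENNReal.ofReal (Real.exp (t * x)) ∂μ ≤
      ENNReal.ofReal (Real.exp (V * t ^ 2 / 2))) (w : Fin n → ℝ) (t : ℝ) :
    ∫⁻ e, ENNReal.ofReal (Real.exp (t * ∑ i, w i * e i)) ∂Measure.pi (fun _ : Fin n => μ) ≤
      ENNReal.ofReal (Real.exp (V * t ^ 2 * (∑ i, w i ^ 2) / 2)) := by
  have h1 : ∀ e : Fin n → ℝ, ENNReal.ofReal (Real.exp (t * ∑ i, w i * e i)) =
      ∏ i, ENNReal.ofReal (Real.exp (t * w i * e i)) := fun e => by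
    rw [← ofReal_exp_sum, Finset.mul_sum]
    simp_rw [mul_assoc]
  simp_rw [h1]
  rw [lintegral_prod_pi (fun _ : Fin n => μ)
    (f := fun i x => ENNReal.ofReal (Real.exp (t * w i * x))) (fun _ => by fun_prop)]
  refine (Finset.prod_le_prod' fun i _ => hsub (t * w i)).trans (le_of_eq ?_)
  rw [← ofReal_exp_sum, Finset.mul_sum, Finset.sum_div]
  simp_rw [mul_pow, mul_assoc]

theorem measure_lt_inner_sq_le (hV : 0 ≤ V)
    (hsub : ∀ t, ∫⁻ x, ENNReal.ofReal (Real.exp (t * x)) ∂μ ≤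
      ENNReal.ofReal (Real.exp (V * t ^ 2 / 2)))
    (hzero : V = 0 → ∀ᵐ x ∂μ, x = 0) (w : Fin n → ℝ) {ρ : ℝ} (hρ : 0 ≤ ρ) :
    Measure.pi (fun _ : Fin n => μ)
      {e | 2 * V * ρ * ∑ i, w i ^ 2 < (∑ i, w i * e i) ^ 2} ≤
      ENNReal.ofReal (2 * Real.exp (-ρ)) := by
  -- The Chernoff parameter below divides by `V * S`, so a vanishing variance or weight vector is
  -- treated apart; the strict inequality in the event then makes it null or empty.
  rcases hV.eq_or_lt with rfl | hV
  · have h0 : ∀ᵐ e ∂Measure.pi (fun _ : Fin n => μ), ∀ i, e i = 0 := ae_all_iff.2 fun i =>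
      (measurePreserving_eval (fun _ : Fin n => μ) i).quasiMeasurePreserving.ae (hzero rfl)
    refine le_of_eq_of_le (measure_mono_null (t := {e | ¬ ∀ i, e i = 0}) (fun e he hcon => ?_) h0)
      bot_le
    rw [Set.mem_ofPred_eq] at he
    simp [hcon] at he
  have hS0 : 0 ≤ ∑ i, w i ^ 2 := by positivity
  rcases hS0.eq_or_lt with hS | hS
  · have hw : ∀ i, w i = 0 := fun i => by
      have := (Finset.sum_eq_zero_iff_of_nonneg fun i _ => sq_nonneg (w i)).1 hS.symm i
        (Finset.mem_univ i)
      simpa using this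
    simp [hw]
  set S := ∑ i, w i ^ 2
  set a := √(2 * V * ρ * S)
  have ha : a ^ 2 = 2 * V * ρ * S := Real.sq_sqrt (by positivity)
  have ha0 : 0 ≤ a := Real.sqrt_nonneg _
  -- Optimal for the Gaussian-type bound `exp(V t² S/2 - t a)`, whose exponent becomes `-ρ`.
  set t := a / (V * S)
  have ht0 : 0 ≤ t := by positivity
  have hta : t * a = 2 * ρ := by
    simp only [t]
    rw [div_mul_eq_mul_div, ← sq, ha]
    field_simp
  have htV : V * t ^ 2 * S / 2 = ρ := by
    have : V * t ^ 2 * S / 2 = t * a / 2 := by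
      simp only [t]
      field_simp
    rw [this, hta]
    ring
  have hsum : ∀ t' : ℝ, t' ^ 2 = t ^ 2 → Measure.pi (fun _ : Fin n => μ)
      {e | 2 * ρ ≤ t' * ∑ i, w i * e i} ≤ ENNReal.ofReal (Real.exp (-ρ)) := fun t' ht' => by
    have h1 := lintegral_exp_inner_pi_le hsub w t'
    rw [ht', htV] at h1
    have hm : Measurable fun e : Fin n → ℝ => t' * ∑ i, w i * e i := by fun_prop
    refine (measure_ge_le_of_lintegral_exp_le hm.aemeasurable h1).trans (le_of_eq ?_)
    congr 2
    ring
  calc _ ≤ Measure.pi (fun _ : Fin n => μ) ({e | 2 * ρ ≤ t * ∑ i, w i * e i} ∪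
        {e | 2 * ρ ≤ (-t) * ∑ i, w i * e i}) := by
        refine measure_mono fun e he => ?_
        rw [Set.mem_ofPred_eq] at he
        rw [← ha] at he
        have h1 : a ≤ |∑ i, w i * e i| := (le_abs_self a).trans (sq_le_sq.1 he.le)
        refine (le_abs.1 h1).imp (fun h => ?_) fun h => ?_
        · rw [Set.mem_ofPred_eq, ← hta]
          exact mul_le_mul_of_nonneg_left h ht0
        · rw [Set.mem_ofPred_eq, ← hta, neg_mul, ← mul_neg]
          exact mul_le_mul_of_nonneg_left h ht0
    _ ≤ _ := measure_union_le _ _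
    _ ≤ ENNReal.ofReal (Real.exp (-ρ)) + ENNReal.ofReal (Real.exp (-ρ)) :=
        add_le_add (hsum t rfl) (hsum (-t) (by ring))
    _ = _ := by
        rw [← ENNReal.ofReal_add (Real.exp_pos _).le (Real.exp_pos _).le, two_mul]

/-- A union over the rows of `W` replaces a concentration inequality for quadratic forms. With `ρ`
later of order `log n`, this produces the logarithm in the final rate. -/
theorem measure_lt_norm_sq_matrix_le (hV : 0 ≤ V)
    (hsub : ∀ t, ∫⁻ x, ENNReal.ofReal (Real.exp (t * x)) ∂μ ≤
      ENNReal.ofReal (Real.exp (V * t ^ 2 / 2)))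
    (hzero : V = 0 → ∀ᵐ x ∂μ, x = 0) (W : Matrix (Fin d) (Fin n) ℝ) {ρ : ℝ} (hρ : 0 ≤ ρ) :
    Measure.pi (fun _ : Fin n => μ)
      {e | ¬ ‖Matrix.toEuclideanLin W (WithLp.toLp 2 e)‖ ^ 2 ≤
        2 * V * ρ * ∑ k, ∑ i, W k i ^ 2} ≤ ENNReal.ofReal (d * (2 * Real.exp (-ρ))) := by
  refine le_trans (measure_mono fun e he => ?_)
    (measure_exists_mem_le (Finset.univ : Finset (Fin d)) (C := d) (by simp) (by positivity)
      fun k _ => measure_lt_inner_sq_le hV hsub hzero (W k) hρ)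
  by_contra hcon
  simp only [Set.mem_ofPred_eq, Finset.mem_univ, true_and, not_exists, not_lt] at hcon
  refine he ?_
  rw [EuclideanSpace.real_norm_sq_eq, Finset.mul_sum]
  refine Finset.sum_le_sum fun k _ => ?_
  simpa [Matrix.toEuclideanLin, Matrix.mulVec, dotProduct] using hcon k

/-- The union bound, conditionally on an independent random matrix. -/
theorem measure_prod_lt_norm_sq_matrix_le {T : Type*} [MeasurableSpace T] {ν : Measure T}
    [IsProbabilityMeasure ν] (hV : 0 ≤ V)
    (hsub : ∀ t, ∫⁻ x, ENNReal.ofReal (Real.exp (t * x)) ∂μ ≤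
      ENNReal.ofReal (Real.exp (V * t ^ 2 / 2)))
    (hzero : V = 0 → ∀ᵐ x ∂μ, x = 0) {W : T → Matrix (Fin d) (Fin n) ℝ}
    (hW : ∀ k i, Measurable fun x => W x k i) {ρ : ℝ} (hρ : 0 ≤ ρ) :
    (ν.prod (Measure.pi fun _ : Fin n => μ))
      {q | ¬ ‖Matrix.toEuclideanLin (W q.1) (WithLp.toLp 2 q.2)‖ ^ 2 ≤
        2 * V * ρ * ∑ k, ∑ i, W q.1 k i ^ 2} ≤ ENNReal.ofReal (d * (2 * Real.exp (-ρ))) := by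
  have hmeas : MeasurableSet {q : T × (Fin n → ℝ) |
      ¬ ‖Matrix.toEuclideanLin (W q.1) (WithLp.toLp 2 q.2)‖ ^ 2 ≤
        2 * V * ρ * ∑ k, ∑ i, W q.1 k i ^ 2} := by
    have hnorm : ∀ q : T × (Fin n → ℝ),
        ‖Matrix.toEuclideanLin (W q.1) (WithLp.toLp 2 q.2)‖ ^ 2 =
          ∑ k, (∑ i, W q.1 k i * q.2 i) ^ 2 := fun q => by
      rw [EuclideanSpace.real_norm_sq_eq]
      simp [Matrix.toEuclideanLin, Matrix.mulVec, dotProduct]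
    simp_rw [hnorm, not_le]
    have hW' : ∀ k i, Measurable fun q : T × (Fin n → ℝ) => W q.1 k i := fun k i =>
      (hW k i).comp measurable_fst
    refine measurableSet_lt ?_ ?_
    · fun_prop
    · fun_prop
  rw [Measure.prod_apply hmeas]
  calc _ ≤ ∫⁻ _x : T, ENNReal.ofReal (d * (2 * Real.exp (-ρ))) ∂ν :=
        lintegral_mono fun x => measure_lt_norm_sq_matrix_le hV hsub hzero (W x) hρ
    _ = _ := by simp

end ResponseNoise

/-! ### Measurability of the pseudo-inverse in the matrix entries. -/

section MeasurableInverse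

variable {T : Type*} [MeasurableSpace T] {p d : ℕ}

theorem measurable_det {M : T → Matrix (Fin d) (Fin d) ℝ}
    (hM : ∀ i j, Measurable fun x => M x i j) : Measurable fun x => (M x).det := by
  simp_rw [Matrix.det_apply]
  fun_prop

/-- The inverse is the adjugate divided by the determinant, with value `0` at singular matrices, so
no invertibility is required. -/
theorem measurable_inv_apply {M : T → Matrix (Fin d) (Fin d) ℝ}
    (hM : ∀ i j, Measurable fun x => M x i j) (i j : Fin d) :
    Measurable fun x => (M x)⁻¹ i j := by
  simp only [Matrix.inv_def, Ring.inverse_eq_inv', Matrix.smul_apply, smul_eq_mul,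
    Matrix.adjugate_apply]
  refine (measurable_det hM).inv.mul (measurable_det fun i' j' => ?_)
  rcases eq_or_ne i' j with rfl | h
  · simp
  · simp only [Matrix.updateRow_ne h]
    exact hM i' j'

theorem measurable_mul_apply {p' d' : ℕ} {M : T → Matrix (Fin p') (Fin d) ℝ}
    {N : T → Matrix (Fin d) (Fin d') ℝ}
    (hM : ∀ i j, Measurable fun x => M x i j) (hN : ∀ i j, Measurable fun x => N x i j)
    (i : Fin p') (j : Fin d') : Measurable fun x => (M x * N x) i j := by
  simp only [Matrix.mul_apply]
  fun_prop

theorem measurable_rightInv_apply {M : T → Matrix (Fin p) (Fin d) ℝ}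
    (hM : ∀ i j, Measurable fun x => M x i j) (i : Fin p) (j : Fin d) :
    Measurable fun x => rightInv (M x) i j :=
  measurable_mul_apply hM (measurable_inv_apply (measurable_mul_apply (fun i j => hM j i) hM)) i j

end MeasurableInverse

/-! ### The noise matrix -/

section Projection

variable {p d : ℕ} {A : Matrix (Fin p) (Fin d) ℝ}

/-- The orthogonal projection onto the complement of the range of `A`. -/
def complProj (A : Matrix (Fin p) (Fin d) ℝ) : Matrix (Fin p) (Fin p) ℝ :=
  1 - rightInv A * A.transpose

theorem complProj_apply (x : EuclideanSpace ℝ (Fin p)) :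
    Matrix.toEuclideanLin (complProj A) x =
      x - Matrix.toEuclideanLin (rightInv A * A.transpose) x := by
  ext i
  simp [complProj, Matrix.toEuclideanLin]

theorem inner_rightInv_mul_transpose (h : Function.Injective A.mulVec)
    (x : EuclideanSpace ℝ (Fin p)) :
    inner ℝ x (Matrix.toEuclideanLin (rightInv A * A.transpose) x) =
      ‖Matrix.toEuclideanLin (rightInv A * A.transpose) x‖ ^ 2 := by
  rw [toEuclideanLin_mul_apply]
  exact inner_rightInv h _ x rfl

theorem norm_sq_complProj_add (h : Function.Injective A.mulVec) (x : EuclideanSpace ℝ (Fin p)) :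
    ‖Matrix.toEuclideanLin (complProj A) x‖ ^ 2 +
      ‖Matrix.toEuclideanLin (rightInv A * A.transpose) x‖ ^ 2 = ‖x‖ ^ 2 := by
  rw [complProj_apply, norm_sub_sq_real, inner_rightInv_mul_transpose h]
  ring

theorem norm_complProj_le (h : Function.Injective A.mulVec) (x : EuclideanSpace ℝ (Fin p)) :
    ‖Matrix.toEuclideanLin (complProj A) x‖ ≤ ‖x‖ := by
  refine abs_le_of_sq_le_sq' ?_ (norm_nonneg _) |>.2
  linarith [norm_sq_complProj_add h x,
    sq_nonneg ‖Matrix.toEuclideanLin (rightInv A * A.transpose) x‖]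

theorem complProj_mul_apply (h : Function.Injective A.mulVec) (w : EuclideanSpace ℝ (Fin d)) :
    Matrix.toEuclideanLin (complProj A) (Matrix.toEuclideanLin A w) = 0 := by
  have hu := (Matrix.isUnit_iff_isUnit_det _).1 (isUnit_transpose_mul_self h)
  rw [complProj_apply, ← toEuclideanLin_mul_apply, rightInv, Matrix.mul_assoc, Matrix.mul_assoc,
    Matrix.nonsing_inv_mul _ hu, Matrix.mul_one, sub_self]

theorem sum_sq_eq_sum_norm_sq {m m' : ℕ} (H : Matrix (Fin m) (Fin m') ℝ) :
    ∑ j, ∑ k, H k j ^ 2 =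
      ∑ j, ‖Matrix.toEuclideanLin H (EuclideanSpace.single j 1)‖ ^ 2 := by
  simp only [EuclideanSpace.real_norm_sq_eq, toEuclideanLin_single_apply]

/-- For an orthogonal projection the squared Frobenius norm is the trace, here the rank `d`. -/
theorem sum_sq_rightInv_mul_transpose (h : Function.Injective A.mulVec) :
    ∑ j, ∑ k, (rightInv A * A.transpose) k j ^ 2 = d := by
  have htr : (rightInv A * A.transpose).trace = d := by
    rw [Matrix.trace_mul_comm, transpose_mul_rightInv h, Matrix.trace_one, Fintype.card_fin]
  rw [sum_sq_eq_sum_norm_sq, ← htr, Matrix.trace]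
  refine Finset.sum_congr rfl fun j _ => ?_
  rw [← inner_rightInv_mul_transpose h, EuclideanSpace.inner_single_left,
    toEuclideanLin_single_apply]
  simp

/-- Projecting away `d` directions removes at most `d * O` from the squared Frobenius norm. -/
theorem sum_sq_le_sum_sq_complProj_mul (h : Function.Injective A.mulVec)
    {R : Matrix (Fin p) (Fin p) ℝ} {O : ℝ} (hO : 0 ≤ O)
    (hR : ∀ x, ‖Matrix.toEuclideanLin R x‖ ^ 2 ≤ O * ‖x‖ ^ 2) :
    ∑ j, ∑ k, R k j ^ 2 ≤ ∑ j, ∑ k, (complProj A * R) k j ^ 2 + d * O := by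
  set H := rightInv A * A.transpose with hH
  have h1 : ∑ j, ∑ k, R k j ^ 2 =
      ∑ j, ∑ k, (complProj A * R) k j ^ 2 + ∑ j, ∑ k, (H * R) k j ^ 2 := by
    rw [sum_sq_eq_sum_norm_sq, sum_sq_eq_sum_norm_sq, sum_sq_eq_sum_norm_sq,
      ← Finset.sum_add_distrib]
    refine Finset.sum_congr rfl fun j _ => ?_
    rw [toEuclideanLin_mul_apply, toEuclideanLin_mul_apply, norm_sq_complProj_add h]
  -- Row `k` of `H * R` is `Rᵀ` applied to row `k` of `H`; summation gives `O` times the squared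
  -- Frobenius norm of `H`.
  have h2 : ∑ j, ∑ k, (H * R) k j ^ 2 ≤ d * O := by
    rw [← sum_sq_rightInv_mul_transpose h, ← hH, Finset.sum_comm (f := fun j k => (H * R) k j ^ 2),
      Finset.sum_comm (f := fun j k => H k j ^ 2), Finset.sum_mul]
    refine Finset.sum_le_sum fun k _ => ?_
    have h3 := norm_sq_toEuclideanLin_transpose_le hO hR
      (Matrix.toEuclideanLin H.transpose (EuclideanSpace.single k 1))
    rw [← toEuclideanLin_mul_apply, ← Matrix.transpose_mul] at h3
    simp only [EuclideanSpace.real_norm_sq_eq, toEuclideanLin_single_apply,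
      Matrix.transpose_apply] at h3
    rwa [mul_comm] at h3
  linarith

end Projection

/-! ### Singular values of the noise matrix, before and after projection. -/

section NoiseMatrix

variable {T : Type*} [MeasurableSpace T] {κ : Measure T} [IsProbabilityMeasure κ] {n p : ℕ}
  {g : T → EuclideanSpace ℝ (Fin p)} {R : Matrix (Fin p) (Fin p) ℝ} {s q O : ℝ}

/-- A combination of independent rows with unit coefficient vector inherits the sub-Gaussian bound
of a single row. -/
theorem lintegral_exp_inner_rowMatrix_transpose_le (hg : Measurable g)
    (hsub : ∀ w, ∫⁻ t, ENNReal.ofReal (Real.exp (inner ℝ w (g t))) ∂κ ≤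
      ENNReal.ofReal (Real.exp (s * ‖Matrix.toEuclideanLin R w‖ ^ 2 / 2)))
    {v : EuclideanSpace ℝ (Fin n)} (hv : ‖v‖ = 1) (w : EuclideanSpace ℝ (Fin p)) :
    ∫⁻ t, ENNReal.ofReal (Real.exp (inner ℝ w
      (Matrix.toEuclideanLin (rowMatrix fun i => g (t i)).transpose v)))
      ∂Measure.pi (fun _ : Fin n => κ) ≤
      ENNReal.ofReal (Real.exp (s * ‖Matrix.toEuclideanLin R w‖ ^ 2 / 2)) := by
  have h1 : ∀ t : Fin n → T, ENNReal.ofReal (Real.exp (inner ℝ w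
      (Matrix.toEuclideanLin (rowMatrix fun i => g (t i)).transpose v))) =
      ∏ i, ENNReal.ofReal (Real.exp (inner ℝ (v i • w) (g (t i)))) := fun t => by
    rw [← ofReal_exp_sum, rowMatrix_transpose_apply, inner_sum]
    simp_rw [inner_smul_left, inner_smul_right, conj_trivial]
  simp_rw [h1]
  rw [lintegral_prod_pi (fun _ : Fin n => κ)
    (f := fun i t => ENNReal.ofReal (Real.exp (inner ℝ (v i • w) (g t)))) (fun _ => by fun_prop)]
  refine (Finset.prod_le_prod' fun i _ => hsub (v i • w)).trans (le_of_eq ?_)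
  rw [← ofReal_exp_sum]
  congr 2
  simp_rw [map_smul, norm_smul, mul_pow, Real.norm_eq_abs, sq_abs]
  have h2 := EuclideanSpace.real_norm_sq_eq v
  rw [hv, one_pow] at h2
  rw [← Finset.sum_div, ← Finset.mul_sum, ← Finset.sum_mul, ← h2, one_mul]

theorem measurable_rowMatrix_transpose_apply (hg : Measurable g) (v : EuclideanSpace ℝ (Fin n)) :
    Measurable fun t : Fin n → T =>
      Matrix.toEuclideanLin (rowMatrix fun i => g (t i)).transpose v := by
  simp_rw [rowMatrix_transpose_apply]
  fun_prop

theorem measure_le_norm_sq_noise_le (hg : Measurable g) (hs : 0 < s) (hO : 0 < O)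
    (hR : ∀ x, ‖Matrix.toEuclideanLin R x‖ ^ 2 ≤ O * ‖x‖ ^ 2)
    (hsub : ∀ w, ∫⁻ t, ENNReal.ofReal (Real.exp (inner ℝ w (g t))) ∂κ ≤
      ENNReal.ofReal (Real.exp (s * ‖Matrix.toEuclideanLin R w‖ ^ 2 / 2)))
    {v : EuclideanSpace ℝ (Fin n)} (hv : ‖v‖ = 1) :
    Measure.pi (fun _ : Fin n => κ) {t | 4 * s * ∑ i, ∑ k, R k i ^ 2 ≤
      ‖Matrix.toEuclideanLin (rowMatrix fun i => g (t i)).transpose v‖ ^ 2} ≤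
      ENNReal.ofReal (Real.exp (-((∑ i, ∑ k, R k i ^ 2) / (2 * O)))) := by
  have hV := measurable_rowMatrix_transpose_apply hg v
  set τ := ∑ i, ∑ k, R k i ^ 2
  -- The largest value allowed by `lintegral_exp_norm_sq_le`.
  set l : ℝ := 1 / (4 * s * O) with hl
  have hl0 : 0 < l := by positivity
  have h1 := lintegral_exp_norm_sq_le hV.aemeasurable hO.le hs.le hR
    (lintegral_exp_inner_rowMatrix_transpose_le hg hsub hv) hl0.le
    (by rw [hl]; field_simp; exact le_rfl)
  have h2 := measure_ge_le_of_lintegral_exp_le ((hV.norm.pow_const 2).const_mul l).aemeasurable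
    (b := l * (4 * s * τ)) h1
  refine le_trans (measure_mono fun t ht => ?_) (h2.trans (le_of_eq ?_))
  · rw [Set.mem_ofPred_eq] at ht ⊢
    exact mul_le_mul_of_nonneg_left ht hl0.le
  · congr 2
    rw [hl]
    field_simp
    ring

theorem pi_pi_eq_map_curry {ι ι' : Type*} [Fintype ι] [Fintype ι'] (μ : ι' → Measure ℝ)
    [∀ j, IsProbabilityMeasure (μ j)] :
    (Measure.pi fun _ : ι => Measure.pi μ) =
      (Measure.pi fun a : ι × ι' => μ a.2).map (MeasurableEquiv.curry ι ι' ℝ) := by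
  simp_rw [← Measure.infinitePi_eq_pi]
  exact (Measure.infinitePi_map_curry (fun (_ : ι) (j : ι') => μ j)).symm

/-- The `n` rows are flattened into `n·p` independent scalars, in which the projected combination is
linear with matrix `Q`, `Q k (i, j) = v i * (Pm * R) k j`. As `‖v‖ = 1`, `Q` has the Frobenius norm
of `Pm * R` and the same operator bound, so the scalar lower-tail estimate applies. -/
theorem lintegral_exp_neg_norm_sq_noise_le (hg : Measurable g) {μ : Fin p → Measure ℝ}
    [∀ i, IsProbabilityMeasure (μ i)] (hs : 0 < s) (hq : 0 ≤ q) (hO : 0 ≤ O)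
    (hR : ∀ x, ‖Matrix.toEuclideanLin R x‖ ^ 2 ≤ O * ‖x‖ ^ 2)
    (hlaw : κ.map g = (Measure.pi μ).map fun x => Matrix.toEuclideanLin R (WithLp.toLp 2 x))
    (hsub : ∀ i t, ∫⁻ x, ENNReal.ofReal (Real.exp (t * x)) ∂μ i ≤
      ENNReal.ofReal (Real.exp (s * t ^ 2 / 2)))
    (hvar : ∀ i, ∀ a : ℝ, 0 ≤ a → ∫⁻ x, ENNReal.ofReal (Real.exp (-(a * x ^ 2))) ∂μ i ≤
      ENNReal.ofReal (Real.exp (-a + q * a ^ 2 / 2)))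
    {Pm : Matrix (Fin p) (Fin p) ℝ} (hPm : ∀ x, ‖Matrix.toEuclideanLin Pm x‖ ≤ ‖x‖)
    {v : EuclideanSpace ℝ (Fin n)} (hv : ‖v‖ = 1) {l : ℝ} (hl : 0 ≤ l) (hls : 8 * l * s * O ≤ 1) :
    ∫⁻ t, ENNReal.ofReal (Real.exp (-(l * ‖Matrix.toEuclideanLin Pm
      (Matrix.toEuclideanLin (rowMatrix fun i => g (t i)).transpose v)‖ ^ 2)))
      ∂Measure.pi (fun _ : Fin n => κ) ≤
    ENNReal.ofReal (Real.exp (-(l * ∑ j, ∑ k, (Pm * R) k j ^ 2) +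
      l ^ 2 * (q + 8 * s ^ 2) * O * ∑ j, ∑ k, (Pm * R) k j ^ 2)) := by
  have hv2 := EuclideanSpace.real_norm_sq_eq v
  rw [hv, one_pow] at hv2
  let Q : Matrix (Fin p) (Fin n × Fin p) ℝ := Matrix.of fun k a => v a.1 * (Pm * R) k a.2
  let avg : EuclideanSpace ℝ (Fin n × Fin p) → EuclideanSpace ℝ (Fin p) := fun x =>
    WithLp.toLp 2 fun j => ∑ i, v i * x (i, j)
  have hQ : ∀ x, Matrix.toEuclideanLin Q x = Matrix.toEuclideanLin (Pm * R) (avg x) := fun x => by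
    ext k
    simp only [Matrix.toEuclideanLin, Matrix.toLpLin_apply, Matrix.mulVec, dotProduct, Q, avg,
      Matrix.of_apply, Finset.mul_sum, Fintype.sum_prod_type_right]
    exact Finset.sum_congr rfl fun j _ => Finset.sum_congr rfl fun i _ => by ring
  have havg : ∀ x, ‖avg x‖ ^ 2 ≤ ‖x‖ ^ 2 := fun x => by
    rw [EuclideanSpace.real_norm_sq_eq, EuclideanSpace.real_norm_sq_eq,
      Fintype.sum_prod_type_right]
    refine Finset.sum_le_sum fun j _ => ?_
    have := Finset.sum_mul_sq_le_sq_mul_sq Finset.univ (fun i => v i) (fun i => x (i, j))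
    rwa [← hv2, one_mul] at this
  have hQR : ∀ x, ‖Matrix.toEuclideanLin Q x‖ ^ 2 ≤ O * ‖x‖ ^ 2 := fun x => by
    rw [hQ, toEuclideanLin_mul_apply]
    have h1 := hPm (Matrix.toEuclideanLin R (avg x))
    calc _ ≤ ‖Matrix.toEuclideanLin R (avg x)‖ ^ 2 := by gcongr
      _ ≤ O * ‖avg x‖ ^ 2 := hR _
      _ ≤ _ := mul_le_mul_of_nonneg_left (havg x) hO
  have hQF : ∑ a, ∑ k, Q k a ^ 2 = ∑ j, ∑ k, (Pm * R) k j ^ 2 := by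
    rw [Fintype.sum_prod_type]
    simp only [Q, Matrix.of_apply, mul_pow, ← Finset.mul_sum, ← Finset.sum_mul]
    rw [← hv2, one_mul]
  let F : (Fin n → EuclideanSpace ℝ (Fin p)) → ENNReal := fun y =>
    ENNReal.ofReal (Real.exp (-(l * ‖Matrix.toEuclideanLin Pm
      (∑ i, v i • y i)‖ ^ 2)))
  have hPmc : Measurable (Matrix.toEuclideanLin Pm) :=
    (LinearMap.continuous_of_finiteDimensional _).measurable
  have hRc : Measurable (fun x : Fin p → ℝ => Matrix.toEuclideanLin R (WithLp.toLp 2 x)) :=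
    (LinearMap.continuous_of_finiteDimensional
      (Matrix.toEuclideanLin R)).measurable.comp (by fun_prop)
  have hF : Measurable F := by fun_prop
  have hmapg : (Measure.pi fun _ : Fin n => κ).map (fun t i => g (t i)) =
      (Measure.pi fun _ : Fin n => Measure.pi μ).map
        (fun y i => Matrix.toEuclideanLin R (WithLp.toLp 2 (y i))) := by
    have := Measure.isProbabilityMeasure_map (μ := κ) hg.aemeasurable
    have := Measure.isProbabilityMeasure_map (μ := Measure.pi μ) hRc.aemeasurable
    have h1 := Measure.pi_map_pi (μ := fun _ : Fin n => κ) fun _ => hg.aemeasurable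
    have h2 := Measure.pi_map_pi (μ := fun _ : Fin n => Measure.pi μ) fun _ => hRc.aemeasurable
    rw [h1, h2, hlaw]
  calc _ = ∫⁻ t, F (fun i => g (t i)) ∂Measure.pi (fun _ : Fin n => κ) := by
        simp_rw [rowMatrix_transpose_apply, F]
    _ = ∫⁻ x, F (fun i => Matrix.toEuclideanLin R (WithLp.toLp 2 fun j => x (i, j)))
        ∂Measure.pi fun a : Fin n × Fin p => μ a.2 := by
        rw [← lintegral_map hF (by fun_prop), hmapg, lintegral_map hF (by fun_prop),
          pi_pi_eq_map_curry, lintegral_map (by fun_prop) (by fun_prop)]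
        rfl
    _ = ∫⁻ x, ENNReal.ofReal (Real.exp
        (-(l * ‖Matrix.toEuclideanLin Q (WithLp.toLp 2 x)‖ ^ 2)))
        ∂Measure.pi fun a : Fin n × Fin p => μ a.2 := by
        refine lintegral_congr fun x => ?_
        have h1 : avg (WithLp.toLp 2 x) = ∑ i, v i • WithLp.toLp 2 fun j => x (i, j) := by
          ext j
          simp [avg]
        simp only [F]
        rw [hQ, toEuclideanLin_mul_apply, h1, map_sum (Matrix.toEuclideanLin R)]
        simp_rw [map_smul]
    _ ≤ _ := lintegral_exp_neg_norm_sq_le (fun a : Fin n × Fin p => μ a.2) hs hq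
        (fun a => hsub a.2) (fun a => hvar a.2) Q hO hQR hl hls
    _ = _ := by rw [hQF]

theorem measure_norm_sq_noise_le (hg : Measurable g) {μ : Fin p → Measure ℝ}
    [∀ i, IsProbabilityMeasure (μ i)] (hs : 0 < s) (hq : 0 ≤ q) (hO : 0 < O)
    (hR : ∀ x, ‖Matrix.toEuclideanLin R x‖ ^ 2 ≤ O * ‖x‖ ^ 2)
    (hlaw : κ.map g = (Measure.pi μ).map fun x => Matrix.toEuclideanLin R (WithLp.toLp 2 x))
    (hsub : ∀ i t, ∫⁻ x, ENNReal.ofReal (Real.exp (t * x)) ∂μ i ≤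
      ENNReal.ofReal (Real.exp (s * t ^ 2 / 2)))
    (hvar : ∀ i, ∀ a : ℝ, 0 ≤ a → ∫⁻ x, ENNReal.ofReal (Real.exp (-(a * x ^ 2))) ∂μ i ≤
      ENNReal.ofReal (Real.exp (-a + q * a ^ 2 / 2)))
    {Pm : Matrix (Fin p) (Fin p) ℝ} (hPm : ∀ x, ‖Matrix.toEuclideanLin Pm x‖ ≤ ‖x‖)
    {τ : ℝ} (hτ : τ ≤ 2 * ∑ j, ∑ k, (Pm * R) k j ^ 2)
    {v : EuclideanSpace ℝ (Fin n)} (hv : ‖v‖ = 1) :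
    Measure.pi (fun _ : Fin n => κ) {t | ‖Matrix.toEuclideanLin Pm
      (Matrix.toEuclideanLin (rowMatrix fun i => g (t i)).transpose v)‖ ^ 2 ≤ τ / 8} ≤
      ENNReal.ofReal (Real.exp (-(τ / (8 * (2 * (q + 8 * s ^ 2) + 8 * s) * O)))) := by
  set τ' := ∑ j, ∑ k, (Pm * R) k j ^ 2
  have hτ' : 0 ≤ τ' := by positivity
  -- With `l = 1/(k'O)`, the first summand makes the quadratic correction at most half the linear
  -- term, and the second ensures `8lsO ≤ 1`.
  set k' := 2 * (q + 8 * s ^ 2) + 8 * s with hk'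
  have hk0 : 0 < k' := by positivity
  set l : ℝ := 1 / (k' * O) with hl
  have hl0 : 0 < l := by positivity
  have hlO : l * O = 1 / k' := by rw [hl]; field_simp
  have hls : 8 * l * s * O ≤ 1 := by
    have : 8 * l * s * O = 8 * s / k' := by
      rw [show 8 * l * s * O = 8 * s * (l * O) by ring, hlO]; ring
    rw [this, div_le_one hk0, hk']
    nlinarith [sq_nonneg s]
  have h1 := lintegral_exp_neg_norm_sq_noise_le hg hs hq hO.le hR hlaw hsub hvar hPm hv hl0.le hls
  have hV := measurable_rowMatrix_transpose_apply (n := n) hg v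
  have hPmc : Measurable (Matrix.toEuclideanLin Pm) :=
    (LinearMap.continuous_of_finiteDimensional _).measurable
  have h2 := measure_ge_le_of_lintegral_exp_le
    (((hPmc.comp hV).norm.pow_const 2).const_mul l).neg.aemeasurable
    (b := -(l * (τ' / 4))) h1
  refine le_trans (measure_mono fun t ht => ?_) (h2.trans (ENNReal.ofReal_le_ofReal ?_))
  · rw [Set.mem_ofPred_eq] at ht ⊢
    rw [Pi.neg_apply, neg_le_neg_iff]
    refine mul_le_mul_of_nonneg_left (ht.trans ?_) hl0.le
    linarith
  · refine Real.exp_le_exp.2 ?_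
    have h3 : l ^ 2 * (q + 8 * s ^ 2) * O * τ' ≤ l * τ' / 2 := by
      rw [show l ^ 2 * (q + 8 * s ^ 2) * O * τ' = (l * O) * (q + 8 * s ^ 2) * (l * τ') by ring, hlO]
      have h4 : 1 / k' * (q + 8 * s ^ 2) ≤ 1 / 2 := by
        rw [one_div_mul_eq_div, div_le_div_iff₀ hk0 two_pos, hk']
        linarith
      calc _ ≤ 1 / 2 * (l * τ') := by gcongr
        _ = _ := by ring
    have h5 : τ / (8 * k' * O) = l * (τ / 8) := by rw [hl]; field_simp
    have h6 : l * (τ / 8) ≤ l * (τ' / 4) := mul_le_mul_of_nonneg_left (by linarith) hl0.le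
    rw [h5]
    linarith

/-- The singular values of the noise matrix, and of its projection. -/
theorem measure_noise_matrix_le (hg : Measurable g) {μ : Fin p → Measure ℝ}
    [∀ i, IsProbabilityMeasure (μ i)] (hs : 0 < s) (hq : 0 ≤ q) (hO : 0 < O)
    (hR : ∀ x, ‖Matrix.toEuclideanLin R x‖ ^ 2 ≤ O * ‖x‖ ^ 2)
    (hlaw : κ.map g = (Measure.pi μ).map fun x => Matrix.toEuclideanLin R (WithLp.toLp 2 x))
    (hsubg : ∀ w, ∫⁻ t, ENNReal.ofReal (Real.exp (inner ℝ w (g t))) ∂κ ≤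
      ENNReal.ofReal (Real.exp (s * ‖Matrix.toEuclideanLin R w‖ ^ 2 / 2)))
    (hsub : ∀ i t, ∫⁻ x, ENNReal.ofReal (Real.exp (t * x)) ∂μ i ≤
      ENNReal.ofReal (Real.exp (s * t ^ 2 / 2)))
    (hvar : ∀ i, ∀ a : ℝ, 0 ≤ a → ∫⁻ x, ENNReal.ofReal (Real.exp (-(a * x ^ 2))) ∂μ i ≤
      ENNReal.ofReal (Real.exp (-a + q * a ^ 2 / 2)))
    {Pm : Matrix (Fin p) (Fin p) ℝ} (hPm : ∀ x, ‖Matrix.toEuclideanLin Pm x‖ ≤ ‖x‖)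
    {τ : ℝ} (hτR : τ = ∑ j, ∑ k, R k j ^ 2) (hτ : τ ≤ 2 * ∑ j, ∑ k, (Pm * R) k j ^ 2)
    {γ : ℝ} (hγ : 0 < γ) (hγ2 : γ ≤ 1 / 2) (hγs : 512 * s * γ ^ 2 ≤ 1) :
    Measure.pi (fun _ : Fin n => κ) {t | ¬ ((∀ α,
        ‖Matrix.toEuclideanLin (rowMatrix fun i => g (t i)) α‖ ^ 2 ≤ 16 * s * τ * ‖α‖ ^ 2) ∧
      ∀ v, τ / 32 * ‖v‖ ^ 2 ≤ ‖Matrix.toEuclideanLin Pm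
        (Matrix.toEuclideanLin (rowMatrix fun i => g (t i)).transpose v)‖ ^ 2)} ≤
      ENNReal.ofReal ((1 + 2 / γ) ^ n * (Real.exp (-(τ / (2 * O))) +
        Real.exp (-(τ / (8 * (2 * (q + 8 * s ^ 2) + 8 * s) * O))))) := by
  obtain ⟨N, hN1, hNcard, hnet⟩ := exists_sphere_net (EuclideanSpace ℝ (Fin n)) hγ
  rw [finrank_euclideanSpace_fin] at hNcard
  have hτ0 : 0 ≤ τ := by rw [hτR]; positivity
  let S : EuclideanSpace ℝ (Fin n) → Set (Fin n → T) := fun v =>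
    {t | 4 * s * τ ≤ ‖Matrix.toEuclideanLin (rowMatrix fun i => g (t i)).transpose v‖ ^ 2} ∪
    {t | ‖Matrix.toEuclideanLin Pm
      (Matrix.toEuclideanLin (rowMatrix fun i => g (t i)).transpose v)‖ ^ 2 ≤ τ / 8}
  have hS : ∀ v ∈ N, Measure.pi (fun _ : Fin n => κ) (S v) ≤
      ENNReal.ofReal (Real.exp (-(τ / (2 * O))) +
        Real.exp (-(τ / (8 * (2 * (q + 8 * s ^ 2) + 8 * s) * O)))) := fun v hv => by
    rw [ENNReal.ofReal_add (Real.exp_pos _).le (Real.exp_pos _).le]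
    refine (measure_union_le _ _).trans (add_le_add ?_
      (measure_norm_sq_noise_le hg hs hq hO hR hlaw hsub hvar hPm hτ (hN1 v hv)))
    rw [hτR]
    exact measure_le_norm_sq_noise_le hg hs hO hR hsubg (hN1 v hv)
  refine le_trans (measure_mono fun t ht => ?_)
    (measure_exists_mem_le N hNcard (by positivity) hS)
  by_contra hcon
  simp only [Set.mem_ofPred_eq, not_exists, not_and, S, Set.mem_union, not_or, not_le] at hcon
  set F := Matrix.toEuclideanLin (rowMatrix fun i => g (t i)).transpose with hF
  set U := √(4 * s * τ) with hUdef
  have hU2 : U ^ 2 = 4 * s * τ := Real.sq_sqrt (by positivity)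
  have hU0 : 0 ≤ U := Real.sqrt_nonneg _
  have hU : ∀ v ∈ N, ‖F v‖ ≤ U := fun v hv =>
    (abs_le_of_sq_le_sq' (by rw [hU2]; exact (hcon v hv).1.le) hU0).2
  have h1 := norm_le_of_net hγ2 hnet F hU
  refine ht ⟨fun α => ?_, fun v => ?_⟩
  · have h2 : ∀ v, ‖F v‖ ^ 2 ≤ 16 * s * τ * ‖v‖ ^ 2 := fun v => by
      calc ‖F v‖ ^ 2 ≤ (2 * U * ‖v‖) ^ 2 := by gcongr; exact h1 v
        _ = 4 * U ^ 2 * ‖v‖ ^ 2 := by ring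
        _ = _ := by rw [hU2]; ring
    have h3 := norm_sq_toEuclideanLin_transpose_le (by positivity) h2 α
    rwa [Matrix.transpose_transpose] at h3
  · set b := √(τ / 8) with hb
    have hb2 : b ^ 2 = τ / 8 := Real.sq_sqrt (by positivity)
    have hb0 : 0 ≤ b := Real.sqrt_nonneg _
    have hbN : ∀ v ∈ N, b ≤ ‖((Matrix.toEuclideanLin Pm).comp F) v‖ := fun v hv =>
      (abs_le_of_sq_le_sq' (by rw [hb2]; exact (hcon v hv).2.le) (norm_nonneg _)).2
    have h2 := le_norm_of_net hnet ((Matrix.toEuclideanLin Pm).comp F) (U := 2 * U)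
      (by positivity) (fun x => (hPm _).trans (h1 x)) hbN v
    -- The condition on `γ` is exactly `(2γU)² = 16sτγ² ≤ τ/32 = (b/2)²`.
    have h3 : γ * (2 * U) ≤ b / 2 := by
      refine abs_le_of_sq_le_sq' ?_ (by positivity) |>.2
      rw [mul_pow, mul_pow, hU2, div_pow, hb2]
      nlinarith [mul_le_mul_of_nonneg_right hγs hτ0]
    have h4 : b / 2 * ‖v‖ ≤ ‖Matrix.toEuclideanLin Pm (F v)‖ :=
      (mul_le_mul_of_nonneg_right (by linarith) (norm_nonneg _)).trans h2
    calc τ / 32 * ‖v‖ ^ 2 = (b / 2 * ‖v‖) ^ 2 := by rw [mul_pow, div_pow, hb2]; ring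
      _ ≤ _ := by gcongr

end NoiseMatrix

/-- The law of the noise as a linear image of a product measure. -/
theorem IsSubGaussianModel.exists_law_noise {Ω : Type*} [MeasurableSpace Ω] {P : Measure Ω}
    [IsProbabilityMeasure P] {p K : ℕ} {Z : Ω → EuclideanSpace ℝ (Fin K)}
    {E : Ω → EuclideanSpace ℝ (Fin p)} {ε : Ω → ℝ} {M : ℝ} (h : IsSubGaussianModel M P Z E ε)
    (hM : 0 < M) :
    ∃ μ : Fin p → Measure ℝ, (∀ i, IsProbabilityMeasure (μ i)) ∧
      P.map E = (Measure.pi μ).map (fun x =>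
        Matrix.toEuclideanLin (psdSqrt (covMatrix E P)) (WithLp.toLp 2 x)) ∧
      (∀ i t, ∫⁻ x, ENNReal.ofReal (Real.exp (t * x)) ∂μ i ≤
        ENNReal.ofReal (Real.exp (2 * (2 * M) ^ 2 * t ^ 2 / 2))) ∧
      ∀ i, ∀ a : ℝ, 0 ≤ a → ∫⁻ x, ENNReal.ofReal (Real.exp (-(a * x ^ 2))) ∂μ i ≤
        ENNReal.ofReal (Real.exp (-a + 4 * (2 * M) ^ 4 * a ^ 2 / 2)) := by
  obtain ⟨E', hmeas, hae, hind, hE'⟩ := h.exists_noise hM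
  have hj : ∀ j, Measurable fun ω => E' ω j := fun j => by fun_prop
  have hlin : Measurable fun x : Fin p → ℝ =>
      Matrix.toEuclideanLin (psdSqrt (covMatrix E P)) (WithLp.toLp 2 x) :=
    (LinearMap.continuous_of_finiteDimensional
      (Matrix.toEuclideanLin (psdSqrt (covMatrix E P)))).measurable.comp (by fun_prop)
  refine ⟨fun j => P.map fun ω => E' ω j,
    fun j => Measure.isProbabilityMeasure_map (hj j).aemeasurable, ?_, fun j t => ?_,
    fun j a ha => ?_⟩
  · rw [← (iIndepFun_iff_map_fun_eq_pi_map fun j => (hj j).aemeasurable).1 hind,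
      Measure.map_map hlin (measurable_pi_lambda _ hj)]
    exact Measure.map_congr hae
  · rw [lintegral_map (by fun_prop) (hj j)]
    exact (hE' j).1.lintegral_exp_mul_le (hE' j).2.1 t
  · rw [lintegral_map (by fun_prop) (hj j)]
    exact (hE' j).1.lintegral_exp_neg_mul_sq_le (hE' j).2.2 ha

/-! ### The excess risk on the data -/

theorem measure_prod_preimage_fst_le {S T : Type*} [MeasurableSpace S] [MeasurableSpace T]
    {μ : Measure S} {ν : Measure T} [SFinite ν] [IsProbabilityMeasure ν] (B : Set S) :
    μ.prod ν {q | q.1 ∈ B} ≤ μ B := by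
  have h : {q : S × T | q.1 ∈ B} = B ×ˢ Set.univ := by ext; simp
  rw [h, Measure.prod_prod, measure_univ, mul_one]

theorem measure_prod_preimage_snd_le {S T : Type*} [MeasurableSpace S] [MeasurableSpace T]
    {μ : Measure S} {ν : Measure T} [SFinite ν] [IsProbabilityMeasure μ] (B : Set T) :
    μ.prod ν {q | q.2 ∈ B} ≤ ν B := by
  have h : {q : S × T | q.2 ∈ B} = Set.univ ×ˢ B := by ext; simp
  rw [h, Measure.prod_prod, measure_univ, one_mul]

section Sample

variable {Ω' : Type*} {n p K : ℕ} {A : Matrix (Fin p) (Fin K) ℝ} {β : EuclideanSpace ℝ (Fin K)}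
  {Zs : Fin n → Ω' → EuclideanSpace ℝ (Fin K)} {Es : Fin n → Ω' → EuclideanSpace ℝ (Fin p)}
  {εs : Fin n → Ω' → ℝ}

theorem dataMatrix_feature (ω : Ω') :
    dataMatrix (fun i => feature A (Zs i) (Es i)) ω =
      rowMatrix (fun i => Zs i ω) * A.transpose + rowMatrix fun i => Es i ω := by
  ext i j
  simp [dataMatrix, feature, rowMatrix, Matrix.toEuclideanLin, Matrix.mulVec, dotProduct,
    Matrix.mul_apply, mul_comm]

theorem toLp_response (ω : Ω') :
    WithLp.toLp 2 (fun i => response β (Zs i) (εs i) ω) =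
      Matrix.toEuclideanLin (rowMatrix fun i => Zs i ω) β + WithLp.toLp 2 fun i => εs i ω := by
  ext i
  simp [response, rowMatrix_apply]

variable {Ω : Type*} [MeasurableSpace Ω] [MeasurableSpace Ω'] {P : Measure Ω} {P' : Measure Ω'}
  {Z : Ω → EuclideanSpace ℝ (Fin K)} {E : Ω → EuclideanSpace ℝ (Fin p)} {ε : Ω → ℝ} {M : ℝ}

theorem IsSubGaussianModel.ae_map_ε_eq_zero (h : IsSubGaussianModel M P Z E ε) (hM : 0 < M)
    (hε : Measurable ε) (h0 : Var[ε; P] = 0) : ∀ᵐ x ∂P.map ε, x = 0 := by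
  obtain ⟨ε', hae, -, -⟩ := h.exists_response_noise hM
  refine (ae_map_iff hε.aemeasurable (measurableSet_singleton (0 : ℝ))).2 ?_
  filter_upwards [hae] with ω hω
  change ε ω = 0
  rw [hω, h0, Real.sqrt_zero, zero_mul]

/-- The probability that one of the good events for the sample fails. -/
def failureBound (M γ ρ τ O : ℝ) (n K : ℕ) : ℝ :=
  (1 + 2 / γ) ^ K * (Real.exp (-(n / (16 * (2 * M) ^ 4))) + Real.exp (-n)) +
  (1 + 2 / γ) ^ n * (Real.exp (-(τ / (2 * O))) + Real.exp (-(τ / (8 * (2 * (4 * (2 * M) ^ 4 +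
    8 * (2 * (2 * M) ^ 2) ^ 2) + 8 * (2 * (2 * M) ^ 2)) * O)))) +
  K * (2 * Real.exp (-ρ)) + n * (2 * Real.exp (-ρ))

/-- Union bound over four bad events: a small factor matrix, an ill-conditioned noise matrix, large
`Wε` given the design, and large `‖ε‖`. Off them the deterministic estimate applies with `a = n/16`,
`u = 16sτ`, `l = τ/32`. -/
theorem measure_risk_gt_le [IsProbabilityMeasure P] [IsProbabilityMeasure P'] (hM : 0 < M)
    (hF : IsFactorModel P Z E ε) (hS : IsIIDSample P Z E ε P' Zs Es εs)
    (h : IsSubGaussianModel M P Z E ε) (hA : A.rank = K) (hZr : (covMatrix Z P).rank = K)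
    (hn : 0 < n) (hO : 0 < opNorm (covMatrix E P))
    (hτ : 2 * (K * opNorm (covMatrix E P)) ≤ (covMatrix E P).trace)
    (hτ0 : 0 < (covMatrix E P).trace)
    {γ : ℝ} (hγ : 0 < γ) (hγ2 : γ ≤ 1 / 2) (hγM : γ * (64 * M) ≤ 1) {ρ : ℝ} (hρ : 0 ≤ ρ) {s t : ℝ}
    (hs : s = 2 * (2 * M) ^ 2) (ht : t = 2 * (s * Var[ε; P]) * ρ) :
    P' {ω | ¬ (risk P (feature A Z E) (response β Z ε) (glsEstimator A β Zs Es εs ω) - Var[ε; P] ≤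
      4 * (1 + 512 * s) * (256 * s * ((covMatrix E P).trace / n) + opNorm (covMatrix E P)) *
          ‖Matrix.toEuclideanLin (rightInv A) β‖ ^ 2 + 64 * (1 + 512 * s) * t * (K / n) +
        64 * opNorm (covMatrix E P) * t * (n / (covMatrix E P).trace))} ≤
      ENNReal.ofReal (failureBound M γ ρ (covMatrix E P).trace (opNorm (covMatrix E P)) n K) := by
  have hZE : Measurable fun ω => (Z ω, E ω) := hF.measurable_Z.prodMk hF.measurable_E
  have := Measure.isProbabilityMeasure_map (μ := P) hZE.aemeasurable
  have := Measure.isProbabilityMeasure_map (μ := P) hF.measurable_ε.aemeasurable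
  have hQE := covMatrix_posSemidef (h.memLp_E hM)
  have hQZ := covMatrix_posSemidef (h.memLp_Z hM)
  have hinj : Function.Injective A.mulVec := mulVec_injective_of_rank_eq hA
  set O := opNorm (covMatrix E P) with hOdef
  set τ := (covMatrix E P).trace with hτdef
  set B := psdSqrt (covMatrix Z P) with hB
  set R := psdSqrt (covMatrix E P) with hRdef
  have hR : ∀ x, ‖Matrix.toEuclideanLin R x‖ ^ 2 ≤ O * ‖x‖ ^ 2 := norm_sq_psdSqrt_le hQE
  have hs0 : 0 < s := by rw [hs]; positivity
  have hV0 : 0 ≤ s * Var[ε; P] := mul_nonneg hs0.le (variance_nonneg _ _)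
  have ht0 : 0 ≤ t := by rw [ht]; positivity
  have hτR : τ = ∑ j, ∑ k, R k j ^ 2 := (sum_sq_psdSqrt hQE).symm
  -- Removing the `K` directions of the range of `A` costs at most `K * O`, hence at most half of
  -- `τ`.
  have hτP : τ ≤ 2 * ∑ j, ∑ k, (complProj A * R) k j ^ 2 := by
    have := sum_sq_le_sum_sq_complProj_mul hinj hO.le hR
    rw [← hτR] at this
    linarith
  -- the exponential moments under the law of the sample
  have hlow : ∀ x, ‖Matrix.toEuclideanLin B x‖ = 1 → ∀ a, 0 ≤ a →
      ∫⁻ q, ENNReal.ofReal (Real.exp (-(a * inner ℝ q.1 x ^ 2))) ∂P.map (fun ω => (Z ω, E ω)) ≤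
      ENNReal.ofReal (Real.exp (-a + 4 * (2 * M) ^ 4 * a ^ 2 / 2)) := fun x hx a ha => by
    rw [lintegral_map (by fun_prop) hZE]
    refine (h.subGaussianBound_inner_Z hM hx).lintegral_exp_neg_mul_sq_le ?_ ha
    rw [h.integral_inner_Z_sq hM hF.mean_Z, hx, one_pow]
  have hup : ∀ x, ‖Matrix.toEuclideanLin B x‖ = 1 →
      ∫⁻ q, ENNReal.ofReal (Real.exp (inner ℝ q.1 x ^ 2 / (2 * M) ^ 2))
        ∂P.map (fun ω => (Z ω, E ω)) ≤ 2 := fun x hx => by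
    rw [lintegral_map (by fun_prop) hZE]
    exact (h.subGaussianBound_inner_Z hM hx).lintegral_le
  have hsubg : ∀ w, ∫⁻ q, ENNReal.ofReal (Real.exp (inner ℝ w q.2))
      ∂P.map (fun ω => (Z ω, E ω)) ≤
      ENNReal.ofReal (Real.exp (s * ‖Matrix.toEuclideanLin R w‖ ^ 2 / 2)) := fun w => by
    rw [lintegral_map (by fun_prop) hZE, hs]
    exact h.lintegral_exp_inner_E_le hM w
  obtain ⟨μ, hμ, hlaw, hsub, hvar⟩ := h.exists_law_noise hM
  have hlaw' : (P.map fun ω => (Z ω, E ω)).map Prod.snd = (Measure.pi μ).map fun x =>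
      Matrix.toEuclideanLin R (WithLp.toLp 2 x) := by
    rw [Measure.map_map measurable_snd hZE]
    exact hlaw
  rw [← hs] at hsub
  have hsubε : ∀ r, ∫⁻ x, ENNReal.ofReal (Real.exp (r * x)) ∂P.map ε ≤
      ENNReal.ofReal (Real.exp (s * Var[ε; P] * r ^ 2 / 2)) := fun r => by
    rw [lintegral_map (by fun_prop) hF.measurable_ε, hs]
    exact h.lintegral_exp_mul_ε_le hM r
  have hzero : s * Var[ε; P] = 0 → ∀ᵐ x ∂P.map ε, x = 0 := fun h0 =>
    h.ae_map_ε_eq_zero hM hF.measurable_ε ((mul_eq_zero.1 h0).resolve_left hs0.ne')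
  -- the good events
  let X : (Fin n → EuclideanSpace ℝ (Fin K) × EuclideanSpace ℝ (Fin p)) →
      Matrix (Fin n) (Fin p) ℝ := fun x =>
    rowMatrix (fun i => (x i).1) * A.transpose + rowMatrix fun i => (x i).2
  let W : (Fin n → EuclideanSpace ℝ (Fin K) × EuclideanSpace ℝ (Fin p)) →
      Matrix (Fin K) (Fin n) ℝ := fun x => B * A.transpose * rightInv (X x).transpose
  have hXm : ∀ i j, Measurable fun x => X x i j := fun i j => by
    simp only [X, Matrix.add_apply, Matrix.mul_apply, rowMatrix, Matrix.of_apply]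
    fun_prop
  have hWm : ∀ k i, Measurable fun x => W x k i :=
    measurable_mul_apply (fun _ _ => measurable_const)
      (measurable_rightInv_apply fun i j => hXm j i)
  have hE1 := measure_factor_matrix_small_le (n := n) measurable_fst (by positivity : 0 < 2 * M)
    (psdSqrt_surjective hQZ hZr) hlow hup hγ hγ2 (by linarith)
  -- For `s = 8M²` the left side is `(64Mγ)²`.
  have hγs : 512 * s * γ ^ 2 ≤ 1 := by
    have h1 : 0 ≤ γ * (64 * M) := by positivity
    rw [hs]
    nlinarith
  have hE2 := measure_noise_matrix_le (n := n) measurable_snd hs0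
    (by positivity : 0 ≤ 4 * (2 * M) ^ 4) hO hR hlaw' hsubg hsub hvar
    (norm_complProj_le hinj) hτR hτP hγ hγ2 hγs
  have hE5 := measure_prod_lt_norm_sq_matrix_le
    (ν := Measure.pi fun _ : Fin n => P.map fun ω => (Z ω, E ω)) hV0 hsubε hzero hWm hρ
  -- The identity matrix turns the row bound into `‖ε‖² ≤ t n`.
  have hE4 := measure_lt_norm_sq_matrix_le hV0 hsubε hzero (1 : Matrix (Fin n) (Fin n) ℝ) hρ
  have hframe : ∀ k : Fin n, ∑ i, (1 : Matrix (Fin n) (Fin n) ℝ) k i ^ 2 = 1 := fun k => by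
    simp [Matrix.one_apply]
  rw [← ht] at hE4 hE5
  simp_rw [hframe] at hE4
  set S1 := {x : Fin n → EuclideanSpace ℝ (Fin K) × EuclideanSpace ℝ (Fin p) |
    ¬ ∀ w, (n : ℝ) / 16 * ‖Matrix.toEuclideanLin B w‖ ^ 2 ≤
      ‖Matrix.toEuclideanLin (rowMatrix fun i => (x i).1) w‖ ^ 2} with hS1
  set S2 := {x : Fin n → EuclideanSpace ℝ (Fin K) × EuclideanSpace ℝ (Fin p) |
    ¬ ((∀ α, ‖Matrix.toEuclideanLin (rowMatrix fun i => (x i).2) α‖ ^ 2 ≤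
      16 * s * τ * ‖α‖ ^ 2) ∧ ∀ v, τ / 32 * ‖v‖ ^ 2 ≤ ‖Matrix.toEuclideanLin (complProj A)
        (Matrix.toEuclideanLin (rowMatrix fun i => (x i).2).transpose v)‖ ^ 2)} with hS2
  set S3 := {q : (Fin n → EuclideanSpace ℝ (Fin K) × EuclideanSpace ℝ (Fin p)) × (Fin n → ℝ) |
    ¬ ‖Matrix.toEuclideanLin (W q.1) (WithLp.toLp 2 q.2)‖ ^ 2 ≤
      t * ∑ k, ∑ i, W q.1 k i ^ 2} with hS3
  set S4 := {e : Fin n → ℝ | ¬ ‖Matrix.toEuclideanLin (1 : Matrix (Fin n) (Fin n) ℝ)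
    (WithLp.toLp 2 e)‖ ^ 2 ≤ t * ∑ _k : Fin n, 1} with hS4
  let S := {q : (Fin n → EuclideanSpace ℝ (Fin K) × EuclideanSpace ℝ (Fin p)) × (Fin n → ℝ) |
    q.1 ∈ S1} ∪ {q | q.1 ∈ S2} ∪ S3 ∪ {q | q.2 ∈ S4}
  -- The inequality used for the image measure holds for arbitrary sets, so measurability of `S` is
  -- not needed.
  refine le_trans (measure_mono
    (t := (fun ω => ((fun i => (Zs i ω, Es i ω)), fun i => εs i ω)) ⁻¹' S) fun ω hω => ?_)
    ((Measure.le_map_apply hS.aemeasurable_sample S).trans ?_)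
  · by_contra hcon
    simp only [Set.mem_preimage, S, Set.mem_union, not_or, hS1, hS2, hS3, hS4, Set.mem_ofPred_eq,
      not_not] at hcon
    obtain ⟨⟨⟨h1, h2, h3⟩, h4⟩, h5⟩ := hcon
    refine hω ?_
    -- The projection annihilates `A Zmᵀ` and does not increase norms, so `Xᵀ` is at least as large
    -- as the projected noise.
    have hX : ∀ v, τ / 32 * ‖v‖ ^ 2 ≤ ‖Matrix.toEuclideanLin
        (X fun i => (Zs i ω, Es i ω)).transpose v‖ ^ 2 := fun v => by
      refine (h3 v).trans ?_
      have h6 : Matrix.toEuclideanLin (complProj A) (Matrix.toEuclideanLin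
          (X fun i => (Zs i ω, Es i ω)).transpose v) = Matrix.toEuclideanLin (complProj A)
          (Matrix.toEuclideanLin (rowMatrix fun i => Es i ω).transpose v) := by
        simp only [X, Matrix.transpose_add, Matrix.transpose_mul, Matrix.transpose_transpose,
          map_add, LinearMap.add_apply, toEuclideanLin_mul_apply]
        rw [complProj_mul_apply hinj, zero_add]
      rw [← h6]
      gcongr
      exact norm_complProj_le hinj _
    have hmain := error_le_of_good_sample (X := X fun i => (Zs i ω, Es i ω)) rfl
      (by positivity : (0 : ℝ) < n / 16) (by positivity : 0 ≤ 16 * s * τ)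
      (by positivity : 0 < τ / 32) h1 h2 hX (transpose_rightInv_apply hinj β) ht0 hO.le h4
    have hε : ‖WithLp.toLp 2 fun i => εs i ω‖ ^ 2 ≤ t * n := by
      have h6 : Matrix.toEuclideanLin (1 : Matrix (Fin n) (Fin n) ℝ)
          (WithLp.toLp 2 fun i => εs i ω) = WithLp.toLp 2 fun i => εs i ω := by
        ext i
        simp [Matrix.toEuclideanLin]
      rw [h6] at h5
      simpa using h5
    have hα : glsEstimator A β Zs Es εs ω = minNormEstimator (X fun i => (Zs i ω, Es i ω))
        (Matrix.toEuclideanLin (rowMatrix fun i => Zs i ω) β + WithLp.toLp 2 fun i => εs i ω) := by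
      rw [glsEstimator, dataMatrix_feature, toLp_response]
    rw [← hα] at hmain
    rw [risk_eq hM hF h, add_sub_cancel_right, quadForm_eq_norm_sq hQZ, quadForm_eq_norm_sq hQE]
    have hul : 16 * s * τ / (τ / 32) = 512 * s := by field_simp; norm_num
    have hua : 16 * s * τ / (n / 16) = 256 * s * (τ / n) := by field_simp; norm_num
    have hE3 : 2 * O * ‖WithLp.toLp 2 fun i => εs i ω‖ ^ 2 / (τ / 32) ≤
        64 * O * t * (n / τ) := by
      calc _ ≤ 2 * O * (t * n) / (τ / 32) := by gcongr
        _ = _ := by field_simp; ring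
    have hE6 : 4 * t * K * (1 + 512 * s) / (n / 16) = 64 * (1 + 512 * s) * t * (K / n) := by
      field_simp; ring
    rw [hul, hua, hE6] at hmain
    exact (add_le_add le_rfl (hR _)).trans (hmain.trans (by linarith))
  · rw [hS.map_eq_prod hF]
    have e1 : 0 ≤ (1 + 2 / γ) ^ K *
        (Real.exp (-(n / (16 * (2 * M) ^ 4))) + Real.exp (-n)) := by positivity
    have e2 : 0 ≤ (1 + 2 / γ) ^ n * (Real.exp (-(τ / (2 * O))) + Real.exp (-(τ / (8 *
        (2 * (4 * (2 * M) ^ 4 + 8 * s ^ 2) + 8 * s) * O)))) := by positivity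
    have e3 : 0 ≤ K * (2 * Real.exp (-ρ)) := by positivity
    have e4 : 0 ≤ n * (2 * Real.exp (-ρ)) := by positivity
    rw [failureBound, ← hs, ENNReal.ofReal_add (by positivity) e4,
      ENNReal.ofReal_add (by positivity) e3, ENNReal.ofReal_add e1 e2]
    refine (measure_union_le _ _).trans (add_le_add ?_
      ((measure_prod_preimage_snd_le S4).trans hE4))
    refine (measure_union_le _ _).trans (add_le_add ?_ hE5)
    exact (measure_union_le _ _).trans (add_le_add
      ((measure_prod_preimage_fst_le S1).trans hE1) ((measure_prod_preimage_fst_le S2).trans hE2))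

end Sample

/-! ### Minimizers of the risk -/

/-- Stacking `T` over `R` gives a single least-squares problem, which has a minimizer even when it
is degenerate. -/
theorem exists_isMinOn_norm_sq_add {d p : ℕ} (T : Matrix (Fin d) (Fin p) ℝ)
    (R : Matrix (Fin p) (Fin p) ℝ) (b : EuclideanSpace ℝ (Fin d)) : ∃ α, ∀ u,
    ‖Matrix.toEuclideanLin T α - b‖ ^ 2 + ‖Matrix.toEuclideanLin R α‖ ^ 2 ≤
      ‖Matrix.toEuclideanLin T u - b‖ ^ 2 + ‖Matrix.toEuclideanLin R u‖ ^ 2 := by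
  let X : Matrix (Fin (d + p)) (Fin p) ℝ :=
    Matrix.of fun i j => Fin.append (fun k => T k j) (fun k => R k j) i
  let y : EuclideanSpace ℝ (Fin (d + p)) := WithLp.toLp 2 (Fin.append b.ofLp 0)
  have hX : ∀ u, ‖Matrix.toEuclideanLin X u - y‖ ^ 2 =
      ‖Matrix.toEuclideanLin T u - b‖ ^ 2 + ‖Matrix.toEuclideanLin R u‖ ^ 2 := fun u => by
    simp only [EuclideanSpace.real_norm_sq_eq, Fin.sum_univ_add]
    simp [X, y, Matrix.toEuclideanLin, Matrix.mulVec, dotProduct]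
  obtain ⟨α, hα, -⟩ := exists_isMinNormLeastSquares X y
  refine ⟨α, fun u => ?_⟩
  rw [← hX, ← hX]
  have := hα u
  gcongr

section Risk

variable {Ω : Type*} [MeasurableSpace Ω] {P : Measure Ω} [IsProbabilityMeasure P] {p K : ℕ}
  {A : Matrix (Fin p) (Fin K) ℝ} {β : EuclideanSpace ℝ (Fin K)} {Z : Ω → EuclideanSpace ℝ (Fin K)}
  {E : Ω → EuclideanSpace ℝ (Fin p)} {ε : Ω → ℝ} {M : ℝ}

theorem exists_isMinOn_risk (hM : 0 < M) (hF : IsFactorModel P Z E ε)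
    (h : IsSubGaussianModel M P Z E ε) :
    ∃ α, IsMinOn (risk P (feature A Z E) (response β Z ε)) Set.univ α := by
  set B := psdSqrt (covMatrix Z P)
  obtain ⟨α, hα⟩ := exists_isMinOn_norm_sq_add (B * A.transpose) (psdSqrt (covMatrix E P))
    (Matrix.toEuclideanLin B β)
  refine ⟨α, fun u _ => ?_⟩
  have h1 := hα u
  simp only [toEuclideanLin_mul_apply, ← map_sub] at h1
  change risk _ _ _ α ≤ risk _ _ _ u
  rw [risk_eq hM hF h, risk_eq hM hF h, quadForm_eq_norm_sq (covMatrix_posSemidef (h.memLp_Z hM)),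
    quadForm_eq_norm_sq (covMatrix_posSemidef (h.memLp_Z hM)),
    quadForm_eq_norm_sq (covMatrix_posSemidef (h.memLp_E hM)),
    quadForm_eq_norm_sq (covMatrix_posSemidef (h.memLp_E hM))]
  gcongr

theorem variance_le_risk (hM : 0 < M) (hF : IsFactorModel P Z E ε)
    (h : IsSubGaussianModel M P Z E ε) (α : EuclideanSpace ℝ (Fin p)) :
    Var[ε; P] ≤ risk P (feature A Z E) (response β Z ε) α := by
  rw [risk_eq hM hF h, quadForm_eq_norm_sq (covMatrix_posSemidef (h.memLp_Z hM)),
    quadForm_eq_norm_sq (covMatrix_posSemidef (h.memLp_E hM))]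
  exact le_add_of_nonneg_left (by positivity)

end Risk

/-! ### The size of the interpolating coefficient -/

theorem norm_sq_rightInv_coefficient_le {p K : ℕ} {A : Matrix (Fin p) (Fin K) ℝ}
    {Q : Matrix (Fin K) (Fin K) ℝ} {β : EuclideanSpace ℝ (Fin K)} {z c : ℝ} (hK : 1 ≤ K)
    (hA : A.rank = K) (hQ : Q.IsHermitian) (hz : 0 < z) (hzQ : z ≤ kthEigenvalue K Q)
    (hβ : quadForm Q β ≤ c) :
    ‖Matrix.toEuclideanLin (rightInv A) β‖ ^ 2 ≤ c / z / kthEigenvalue K (A.transpose * A) := by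
  have hlam := kthEigenvalue_pos hK (posDef_transpose_mul_self hA)
  have hAlow : ∀ w, kthEigenvalue K (A.transpose * A) * ‖w‖ ^ 2 ≤
      ‖Matrix.toEuclideanLin A w‖ ^ 2 := fun w => by
    refine (kthEigenvalue_mul_norm_sq_le hK (posDef_transpose_mul_self hA).1 w).trans (le_of_eq ?_)
    rw [toEuclideanLin_mul_apply, inner_toEuclideanLin_transpose, real_inner_self_eq_norm_sq]
  rw [le_div_iff₀ hlam, le_div_iff₀ hz]
  have h1 := mul_norm_sq_rightInv_le hlam hAlow β
  have h2 := kthEigenvalue_mul_norm_sq_le hK hQ β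
  have h3 : z * ‖β‖ ^ 2 ≤ c := by
    rw [quadForm] at hβ
    exact (mul_le_mul_of_nonneg_right hzQ (sq_nonneg _)).trans (h2.trans hβ)
  nlinarith

/-! ### The failure probability -/

/-- Only a probability of order `1/n` is needed, so `exp(-y)` is weakened to `1/y`. -/
theorem pow_mul_exp_neg_le {N x y : ℝ} (hN : 0 < N) (m : ℕ) (hy : 0 < y)
    (h : m * Real.log N + y ≤ x) : N ^ m * Real.exp (-x) ≤ 1 / y := by
  calc N ^ m * Real.exp (-x) = Real.exp (m * Real.log N - x) := by
        rw [sub_eq_add_neg, Real.exp_add, Real.exp_nat_mul, Real.exp_log hN]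
    _ ≤ Real.exp (-y) := Real.exp_le_exp.2 (by linarith)
    _ = 1 / Real.exp y := by rw [Real.exp_neg, one_div]
    _ ≤ 1 / y := one_div_le_one_div_of_le hy (by linarith [Real.add_one_le_exp y])

theorem one_sub_le_measureReal {Ω : Type*} [MeasurableSpace Ω] {P : Measure Ω}
    [IsProbabilityMeasure P] {S S' : Set Ω} {q q' : ℝ} (hS : P S ≤ ENNReal.ofReal q) (hq : 0 ≤ q)
    (hqq' : q ≤ q') (hSS' : ∀ ω, ω ∉ S → ω ∈ S') : 1 - q' ≤ P.real S' := by
  have h1 : P.real S ≤ q := ENNReal.toReal_le_of_le_ofReal hq hS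
  have h2 : P.real (S ∪ S') = 1 := by
    have : S ∪ S' = Set.univ := Set.eq_univ_of_forall fun ω => by
      by_cases hω : ω ∈ S
      · exact Or.inl hω
      · exact Or.inr (hSS' ω hω)
    rw [this, probReal_univ]
  have h3 := measureReal_union_le (μ := P) S S'
  linarith

theorem failureBound_nonneg {M γ ρ τ O : ℝ} (hγ : 0 < γ) (n K : ℕ) :
    0 ≤ failureBound M γ ρ τ O n K := by
  unfold failureBound
  positivity

/-- In each net term half of the exponent, or all but `n` of it, absorbs the cardinality of the net;
`hn` serves the `K`-dimensional net and `hτ` the `n`-dimensional one. -/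
theorem failureBound_le {M γ τ O C : ℝ} {n K : ℕ} (hM : 0 < M) (hγ : 0 < γ) (hO : 0 < O)
    (hK : 1 ≤ K) (hC1 : 1 ≤ C) (hC2 : 2 * Real.log (1 + 2 / γ) ≤ C)
    (hC3 : 32 * (2 * M) ^ 4 * Real.log (1 + 2 / γ) ≤ C)
    (hC4 : 2 * (Real.log (1 + 2 / γ) + 1) ≤ C)
    (hC5 : 8 * (2 * (4 * (2 * M) ^ 4 + 8 * (2 * (2 * M) ^ 2) ^ 2) + 8 * (2 * (2 * M) ^ 2)) *
      (Real.log (1 + 2 / γ) + 1) ≤ C) (hn : C * K < n) (hτ : C * n < τ / O) :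
    failureBound M γ (2 * Real.log n) τ O n K ≤ (32 * (2 * M) ^ 4 + 8) / n := by
  have hK0 : (1 : ℝ) ≤ K := by exact_mod_cast hK
  have hKn : (K : ℝ) < n := lt_of_le_of_lt (by nlinarith) hn
  have hn0 : (0 : ℝ) < n := by linarith
  have hN : 0 < 1 + 2 / γ := by positivity
  set ℓ := Real.log (1 + 2 / γ)
  set k := 2 * (4 * (2 * M) ^ 4 + 8 * (2 * (2 * M) ^ 2) ^ 2) + 8 * (2 * (2 * M) ^ 2)
  have hk0 : 0 < k := by positivity
  have h1 : (1 + 2 / γ) ^ K * Real.exp (-(n / (16 * (2 * M) ^ 4))) ≤ 32 * (2 * M) ^ 4 / n := by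
    refine (pow_mul_exp_neg_le hN K (y := n / (32 * (2 * M) ^ 4)) (by positivity) ?_).trans
      (le_of_eq (by rw [one_div_div]))
    have h : K * ℓ ≤ n / (32 * (2 * M) ^ 4) := by
      rw [le_div_iff₀ (by positivity)]
      nlinarith
    have h' : n / (16 * (2 * M) ^ 4) = n / (32 * (2 * M) ^ 4) + n / (32 * (2 * M) ^ 4) := by
      field_simp
      norm_num
    linarith
  have h2 : (1 + 2 / γ) ^ K * Real.exp (-n) ≤ 2 / n := by
    refine (pow_mul_exp_neg_le hN K (y := n / 2) (by positivity) ?_).trans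
      (le_of_eq (by rw [one_div_div]))
    nlinarith
  have h3 : (1 + 2 / γ) ^ n * Real.exp (-(τ / (2 * O))) ≤ 1 / n := by
    refine pow_mul_exp_neg_le hN n hn0 ?_
    have h : τ / (2 * O) = τ / O / 2 := by field_simp
    rw [h]
    nlinarith
  have h4 : (1 + 2 / γ) ^ n * Real.exp (-(τ / (8 * k * O))) ≤ 1 / n := by
    refine pow_mul_exp_neg_le hN n hn0 ?_
    have h : τ / (8 * k * O) = τ / O / (8 * k) := by field_simp
    rw [h, le_div_iff₀ (by positivity)]
    nlinarith
  -- The choice `ρ = 2 log n` leaves `2/n` after a union over `n` coordinates.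
  have h5 : Real.exp (-(2 * Real.log n)) = 1 / (n * n) := by
    rw [Real.exp_neg, two_mul, Real.exp_add, Real.exp_log hn0, one_div]
  have h6 : n * (2 * Real.exp (-(2 * Real.log n))) = 2 / n := by
    rw [h5]
    field_simp
  have h7 : K * (2 * Real.exp (-(2 * Real.log n))) ≤ 2 / n := by
    rw [← h6]
    gcongr
  have h8 : (32 * (2 * M) ^ 4 + 8) / n = 32 * (2 * M) ^ 4 / n + 2 / n + (1 / n + 1 / n) + 2 / n +
      2 / n := by
    field_simp
    ring
  rw [failureBound, h8, mul_add, mul_add]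
  exact add_le_add (add_le_add (add_le_add (add_le_add h1 h2) (add_le_add h3 h4)) h7) h6.le

theorem excess_bound_le {s O τ nβ t K n p lamA z₁ e₁ e₂ r₁ r₂ b v : ℝ}
    (hs : 0 < s) (hn : 0 < n) (hp : 0 < p) (hK : 0 < K) (hlam : 0 < lamA)
    (hz₁ : 0 < z₁) (he₁ : 0 < e₁) (he₂ : 0 < e₂) (hr₁ : 0 < r₁) (hr₂ : 0 < r₂) (hb : 0 < b)
    (hv : 0 ≤ v) (ht : t = 4 * s * v) (hO : O ≤ e₂) (hτ1 : r₁ * p * e₁ ≤ τ)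
    (hτ2 : τ ≤ r₂ * p * e₂) (hnp : n ≤ r₂ * p) (hβ0 : 0 ≤ nβ)
    (hβ : nβ ≤ b * K / z₁ / lamA) :
    4 * (1 + 512 * s) * (256 * s * (τ / n) + O) * nβ + 64 * (1 + 512 * s) * t * (K / n) +
        64 * O * t * (n / τ) ≤
      (4 * (1 + 512 * s) * ((256 * s + 1) * (r₂ * e₂)) * (b / z₁) + 256 * s * (1 + 512 * s) +
        256 * s * e₂ / (r₁ * e₁)) * (K / lamA * (p / n) + v * (n / p + K / n)) := by
  have hτ0 : 0 < τ := lt_of_lt_of_le (by positivity) hτ1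
  have h1 : 256 * s * (τ / n) + O ≤ (256 * s + 1) * (r₂ * e₂) * (p / n) := by
    have h2 : τ / n ≤ r₂ * e₂ * (p / n) := by
      rw [← mul_div_assoc]
      gcongr
      linarith
    -- Because `n ≤ r₂p`, a bounded quantity is dominated by `p/n`, so the penalty term merges with
    -- the factor term.
    have h3 : O ≤ r₂ * e₂ * (p / n) := by
      rw [← mul_div_assoc, le_div_iff₀ hn]
      nlinarith
    nlinarith
  have h4 : 4 * (1 + 512 * s) * (256 * s * (τ / n) + O) * nβ ≤
      4 * (1 + 512 * s) * ((256 * s + 1) * (r₂ * e₂)) * (b / z₁) * (K / lamA * (p / n)) := by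
    calc _ ≤ 4 * (1 + 512 * s) * ((256 * s + 1) * (r₂ * e₂) * (p / n)) * (b * K / z₁ / lamA) := by
          gcongr
      _ = _ := by field_simp
  have h5 : 64 * (1 + 512 * s) * t * (K / n) = 256 * s * (1 + 512 * s) * (v * (K / n)) := by
    rw [ht]; ring
  have h6 : 64 * O * t * (n / τ) ≤ 256 * s * e₂ / (r₁ * e₁) * (v * (n / p)) := by
    rw [ht]
    calc _ ≤ 64 * e₂ * (4 * s * v) * (n / (r₁ * p * e₁)) := by gcongr
      _ = _ := by field_simp; ring
  have g1 : 0 ≤ K / lamA * (p / n) := by positivity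
  have g2 : 0 ≤ v * (K / n) := by positivity
  have g3 : 0 ≤ v * (n / p) := by positivity
  set c1 := 4 * (1 + 512 * s) * ((256 * s + 1) * (r₂ * e₂)) * (b / z₁)
  set c2 := 256 * s * (1 + 512 * s)
  set c3 := 256 * s * e₂ / (r₁ * e₁)
  have f1 : 0 ≤ c1 := by positivity
  have f2 : 0 ≤ c2 := by positivity
  have f3 : 0 ≤ c3 := by positivity
  rw [h5]
  -- A single constant in front of all three rates only adds nonnegative cross terms.
  have hx : (c1 + c2 + c3) * (K / lamA * (p / n) + v * (n / p + K / n)) =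
      c1 * (K / lamA * (p / n)) + c2 * (v * (K / n)) + c3 * (v * (n / p)) +
      (c1 * (v * (n / p)) + c1 * (v * (K / n)) + c2 * (K / lamA * (p / n)) + c2 * (v * (n / p)) +
        c3 * (K / lamA * (p / n)) + c3 * (v * (K / n))) := by ring
  have hy : 0 ≤ c1 * (v * (n / p)) + c1 * (v * (K / n)) + c2 * (K / lamA * (p / n)) +
      c2 * (v * (n / p)) + c3 * (K / lamA * (p / n)) + c3 * (v * (K / n)) := by positivity
  rw [hx]
  linarith

end FactorRegression

end

/-! ### Choice of constants and assembly. -/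

theorem mainTheorem9 :
    ∀ M : ℝ, 0 < M →
    ∃ C > (0 : ℝ), ∃ c > (0 : ℝ),
    ∀ z₁ z₂ e₁ e₂ r₁ r₂ b : ℝ,
      0 < z₁ → 0 < z₂ → 0 < e₁ → 0 < e₂ → 0 < r₁ → 0 < r₂ → 0 < b →
    ∃ D > (0 : ℝ), ∀ a > (0 : ℝ), ∃ D' > (0 : ℝ),
    ∀ (n p K : ℕ)
      (Ω : Type*) [MeasurableSpace Ω] (P : Measure Ω) [IsProbabilityMeasure P]
      (Ω' : Type*) [MeasurableSpace Ω'] (P' : Measure Ω') [IsProbabilityMeasure P']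
      (A : Matrix (Fin p) (Fin K) ℝ) (β : EuclideanSpace ℝ (Fin K))
      (Z : Ω → EuclideanSpace ℝ (Fin K)) (E : Ω → EuclideanSpace ℝ (Fin p)) (ε : Ω → ℝ)
      (Zs : Fin n → Ω' → EuclideanSpace ℝ (Fin K))
      (Es : Fin n → Ω' → EuclideanSpace ℝ (Fin p)) (εs : Fin n → Ω' → ℝ),
      1 ≤ K →
      FactorRegression.IsFactorModel P Z E ε →
      FactorRegression.IsIIDSample P Z E ε P' Zs Es εs →
      A.rank = K →
      (FactorRegression.covMatrix Z P).rank = K →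
      FactorRegression.IsSubGaussianModel M P Z E ε →
      C * K < n →
      C * n < FactorRegression.effRank (FactorRegression.covMatrix E P) →
      z₁ ≤ FactorRegression.kthEigenvalue K (FactorRegression.covMatrix Z P) →
      FactorRegression.kthEigenvalue K (FactorRegression.covMatrix Z P) ≤ z₂ →
      e₁ ≤ FactorRegression.opNorm (FactorRegression.covMatrix E P) →
      FactorRegression.opNorm (FactorRegression.covMatrix E P) ≤ e₂ →
      r₁ * p ≤ FactorRegression.effRank (FactorRegression.covMatrix E P) →
      FactorRegression.effRank (FactorRegression.covMatrix E P) ≤ r₂ * p →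
      FactorRegression.quadForm (FactorRegression.covMatrix Z P) β ≤ b * K →
      let R : EuclideanSpace ℝ (Fin p) → ℝ := FactorRegression.risk P
        (FactorRegression.feature A Z E) (FactorRegression.response β Z ε)
      let αhat : Ω' → EuclideanSpace ℝ (Fin p) := FactorRegression.glsEstimator A β Zs Es εs
      let lamA : ℝ := FactorRegression.kthEigenvalue K (A.transpose * A)
      let V : ℝ := Var[ε; P] * (((n : ℝ) / p + (K : ℝ) / n) * Real.log n)
      (∃ αstar, IsMinOn R Set.univ αstar) ∧
      ∀ αstar, IsMinOn R Set.univ αstar →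
        1 - c / n ≤ P'.real {ω | R (αhat ω) - R αstar ≤ R (αhat ω) - Var[ε; P] ∧
          R (αhat ω) - Var[ε; P] ≤ D * ((K : ℝ) / lamA * ((p : ℝ) / n) + V)} ∧
        (a * ((p : ℝ) / K) ≤ lamA →
          1 - c / n ≤ P'.real {ω | R (αhat ω) - R αstar ≤ R (αhat ω) - Var[ε; P] ∧
            R (αhat ω) - Var[ε; P] ≤ D' * ((K : ℝ) ^ 2 / n + V)}) := by
  intro M hM
  obtain ⟨γ, hγ, hγ2, hγM⟩ : ∃ γ : ℝ, 0 < γ ∧ γ ≤ 1 / 2 ∧ γ * (64 * M) ≤ 1 := by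
    refine ⟨min (1 / 2) (1 / (64 * M)), by positivity, min_le_left _ _, ?_⟩
    rw [← le_div_iff₀ (by positivity)]
    exact min_le_right _ _
  set ℓ := Real.log (1 + 2 / γ) with hℓ
  have hℓ0 : 0 ≤ ℓ := Real.log_nonneg (by linarith [div_pos two_pos hγ])
  set k := 2 * (4 * (2 * M) ^ 4 + 8 * (2 * (2 * M) ^ 2) ^ 2) + 8 * (2 * (2 * M) ^ 2) with hk
  have hk0 : 0 < k := by positivity
  set s := 2 * (2 * M) ^ 2 with hs
  have hs0 : 0 < s := by positivity
  -- The sum dominates every threshold of `failureBound_le`; the leading `2` gives `2KO ≤ τ` and `K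
  -- < n < τ/O`.
  set C := 2 + 2 * (ℓ + 1) + 32 * (2 * M) ^ 4 * ℓ + 8 * k * (ℓ + 1) with hC
  have hc1 : 0 ≤ 32 * (2 * M) ^ 4 * ℓ := by positivity
  have hc2 : 0 ≤ 8 * k * (ℓ + 1) := by positivity
  refine ⟨C, by linarith, 32 * (2 * M) ^ 4 + 8, by positivity,
    fun z₁ z₂ e₁ e₂ r₁ r₂ b hz₁ _ he₁ he₂ hr₁ hr₂ hb => ?_⟩
  set D := 4 * (1 + 512 * s) * ((256 * s + 1) * (r₂ * e₂)) * (b / z₁) +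
    256 * s * (1 + 512 * s) + 256 * s * e₂ / (r₁ * e₁) with hD
  have hD0 : 0 < D := by positivity
  -- The factor `1 + 1/a` covers `(K/λ)(p/n) ≤ (1/a)K²/n`, valid when `λ ≥ a p/K`, while keeping the
  -- noise term.
  refine ⟨D, hD0, fun a ha => ⟨D * (1 + 1 / a), by positivity, ?_⟩⟩
  intro n p K Ω _ P _ Ω' _ P' _ A β Z E ε Zs Es εs hK hF hS hA hZr h hn hr hz1 _ hO1 hO2 hre1 hre2
    hβ R αhat lamA V
  have hK0 : (1 : ℝ) ≤ K := by exact_mod_cast hK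
  have hC2 : 2 ≤ C := by linarith
  have hCK : 2 * (K : ℝ) ≤ C * K := mul_le_mul_of_nonneg_right hC2 (by linarith)
  have hKn : (K : ℝ) < n := by linarith
  have hn0 : (0 : ℝ) < n := by linarith
  set O := FactorRegression.opNorm (FactorRegression.covMatrix E P) with hO
  have hO0 : 0 < O := lt_of_lt_of_le he₁ hO1
  have hQ0 : FactorRegression.covMatrix E P ≠ 0 := fun h0 => by
    rw [hO, h0, FactorRegression.opNorm, map_zero, norm_zero] at hO0
    exact lt_irrefl _ hO0
  rw [FactorRegression.effRank, if_neg hQ0, ← hO] at hr hre1 hre2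
  set τ := (FactorRegression.covMatrix E P).trace with hτ
  have hnr : (n : ℝ) < τ / O :=
    (le_mul_of_one_le_left hn0.le (by linarith)).trans_lt hr
  -- Positivity of `p` follows from `0 < n < τ/O ≤ r₂p`.
  have hp0 : (0 : ℝ) < p := (mul_pos_iff_of_pos_left hr₂).1 ((hn0.trans hnr).trans_le hre2)
  have hτO : 2 * (K * O) ≤ τ := by
    have h1 : 2 * K ≤ τ / O := by linarith
    rw [le_div_iff₀ hO0] at h1
    linarith
  have hτ0 : 0 < τ := lt_of_lt_of_le (by positivity) hτO
  have hτ1 : r₁ * p * e₁ ≤ τ := by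
    rw [le_div_iff₀ hO0] at hre1
    exact (mul_le_mul_of_nonneg_left hO1 (by positivity)).trans hre1
  have hτ2 : τ ≤ r₂ * p * e₂ := by
    rw [div_le_iff₀ hO0] at hre2
    exact hre2.trans (mul_le_mul_of_nonneg_left hO2 (by positivity))
  have hlam : 0 < lamA :=
    FactorRegression.kthEigenvalue_pos hK (FactorRegression.posDef_transpose_mul_self hA)
  have hα₀ : ‖Matrix.toEuclideanLin (FactorRegression.rightInv A) β‖ ^ 2 ≤ b * K / z₁ / lamA :=
    FactorRegression.norm_sq_rightInv_coefficient_le hK hA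
      (FactorRegression.covMatrix_posSemidef (h.memLp_Z hM)).1 hz₁ hz1 hβ
  have hn1 : (1 : ℝ) ≤ n := by linarith
  have hv0 : 0 ≤ Var[ε; P] * Real.log n :=
    mul_nonneg (variance_nonneg _ _) (Real.log_nonneg hn1)
  -- The logarithm is grouped with the variance: `ρ = 2 log n` makes the noise level `t = 4s·σ² log
  -- n`.
  have hV : V = Var[ε; P] * Real.log n * (n / p + K / n) := by ring
  have hV0 : 0 ≤ V := by
    rw [hV]
    positivity
  have hbad := FactorRegression.measure_risk_gt_le (β := β) hM hF hS h hA hZr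
    (by exact_mod_cast hn0) hO0 hτO hτ0 hγ hγ2 hγM (ρ := 2 * Real.log n)
    (by linarith [Real.log_nonneg hn1]) (s := s) hs rfl
  have hfail := FactorRegression.failureBound_le hM hγ hO0 hK (C := C) (by linarith) (by linarith)
    (by linarith) (by linarith) (by linarith) hn hr
  have hexc := FactorRegression.excess_bound_le (t := 2 * (s * Var[ε; P]) * (2 * Real.log n))
    (v := Var[ε; P] * Real.log n) (K := K) hs0 hn0 hp0 (by linarith) hlam hz₁ he₁ he₂ hr₁ hr₂ hb hv0
    (by ring) hO2 hτ1 hτ2 (hnr.le.trans hre2) (sq_nonneg _) hα₀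
  rw [← hV] at hexc
  refine ⟨FactorRegression.exists_isMinOn_risk hM hF h, fun αstar _ => ?_⟩
  -- The noise variance bounds the risk from below at every point, so this comparison is
  -- deterministic.
  have hstar : ∀ ω, R (αhat ω) - R αstar ≤ R (αhat ω) - Var[ε; P] := fun ω =>
    sub_le_sub_left (FactorRegression.variance_le_risk hM hF h αstar) _
  refine ⟨FactorRegression.one_sub_le_measureReal hbad
    (FactorRegression.failureBound_nonneg hγ n K) hfail fun ω hω => ⟨hstar ω, ?_⟩, fun hlamA =>
    FactorRegression.one_sub_le_measureReal hbad (FactorRegression.failureBound_nonneg hγ n K)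
      hfail fun ω hω => ⟨hstar ω, ?_⟩⟩
  · exact (not_not.1 hω).trans hexc
  · refine (not_not.1 hω).trans (hexc.trans ?_)
    have h1 : K / lamA * (p / n) ≤ 1 / a * ((K : ℝ) ^ 2 / n) := by
      calc K / lamA * (p / n) ≤ K / (a * (p / K)) * (p / n) := by gcongr
        _ = _ := by field_simp
    have h2 : 0 ≤ 1 / a * V := by positivity
    have h3 : 0 ≤ (K : ℝ) ^ 2 / n := by positivity
    rw [mul_assoc D]
    refine mul_le_mul_of_nonneg_left ?_ hD0.le
    linarith
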